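/- Let $M$ be a smooth manifold (Hausdorff, second countable) and $n\ge 0$. All vector bundles are smooth, real and of finite rank. For a graded bundle $B_1[1]\oplus\dots\oplus B_n[n]$ over a manifold $N$, the functions of the corresponding split $[n]$-manifold are the sections $\Gamma(\underline S(B^*))$ of the bundle of graded symmetric algebras generated by the $B_i^*$, placed in degree $i$; a homological vector field is a derivation of degree $1$ of this graded algebra with square zero. Let $\mathcal A=A_1[1]\oplus\dots\oplus A_n[n]$ be a split Lie $n$-algebroid over $M$, with homological vector field $\mathcal Q_{\mathcal A}$ on $\Gamma(\underline S(\mathcal A^*))$. Let $q_V\colon V\to M$, $C_1,\dots,C_n$ be vector bundles over $M$, put $\underline C=C_1[1]\oplus\dots\oplus C_n[n]$, and let $\underline D=D_1[1]\oplus\dots\oplus D_n[n]\to V$ be the decomposed double vector bundle $D_i=q_V^!(A_i\oplus C_i)$ with sides $V$ and $\mathcal A$ and core $\underline C$; it is a split $[n]$-manifold over $V$ and a vector bundle $\pi_{\mathcal A}\colon\underline D\to\mathcal A$. Its basic functions are the $\pi_{\mathcal A}^\star(\alpha)$ with $\alpha\in\Gamma(\underline S(\mathcal A^*))$ (in particular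 $f\circ q_V$ for $f\in C^\infty(M)$). Its linear functions are the elements of $\Gamma(\underline S(\mathcal A^*))\otimes\Gamma(V^*\oplus\underline C^*)$, where $\psi\in\Gamma(V^*)$ is identified with the fibrewise linear function $\ell_\psi\in C^\infty(V)$. Functions are bigraded: $f\circ q_V$ has bidegree $(0,0)$, $\pi_{\mathcal A}^\star(\alpha)$ with $|\alpha|=i$ has bidegree $(0,i)$, $\ell_\psi$ has bidegree $(1,-1)$, and sections of $C_i^*$ have bidegree $(1,i-1)$. A VB-Lie $n$-algebroid structure on $\underline D$ over $(\mathcal A,\mathcal Q_{\mathcal A})$ is a homological vector field $\mathcal Q_{\underline D}$ on $\underline D\to V$ that maps linear functions to linear functions and satisfies $\mathcal Q_{\underline D}\circ\pi_{\mathcal A}^\star=\pi_{\mathcal A}^\star\circ\mathcal Q_{\mathcal A}$. Let $\underline D'$ be a second decomposed VB-Lie $n$-algebroid over the same $(\mathcal A,\mathcal Q_{\mathcal A})$, with side $V'$, core $\underline C'$ and homological vector field $\mathcal Q_{\underline D'}$. A morphism $G\colon\underline D\to\underline D'$ of VB-Lie $n$-algebroids that acts trivially on basic functions consists of a smooth map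 $G_V\colon V\to V'$ and a degree-preserving algebra morphism $G^\star$ from the functions of $\underline D'$ to those of $\underline D$ that restricts to $G_V^*$ on $C^\infty(V')$, preserves the bidegree, maps $\pi_{\mathcal A}^\star(\alpha)$ to $\pi_{\mathcal A}^\star(\alpha)$ for all $\alpha\in\Gamma(\underline S(\mathcal A^*))$, and satisfies $G^\star\circ\mathcal Q_{\underline D'}=\mathcal Q_{\underline D}\circ G^\star$. A representation up to homotopy of $\mathcal A$ on a graded bundle $\underline E$ over $M$ (an $\mathcal A$-representation) is an operator $\mathcal D$ of degree $1$ on $\Gamma(\underline S(\mathcal A^*))\otimes\Gamma(\underline E)$ with $\mathcal D(\xi\eta)=\mathcal Q_{\mathcal A}(\xi)\eta+(-1)^{|\xi|}\xi\,\mathcal D\eta$ and $\mathcal D^2=0$. A morphism $(\underline E,\mathcal D)\to(\underline E',\mathcal D')$ is a degree-preserving $\Gamma(\underline S(\mathcal A^*))$-linear map $\mu$ with $\mu\circ\mathcal D=\mathcal D'\circ\mu$. In $\underline E=V[0]\oplus\underline C$ and $\underline E'=V'[0]\oplus\underline C'$ the sections of $V,V'$ have degree $0$ and those of $C_i,C_i'$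 have degree $-i$. Let $\langle\cdot,\cdot\rangle$ be the $\Gamma(\underline S(\mathcal A^*))$-valued pairing $\langle\xi\otimes\psi,\zeta\otimes b\rangle=(-1)^{|\psi||\zeta|}\psi(b)\,\xi\zeta$ of $\Gamma(\underline S(\mathcal A^*))\otimes\Gamma(\underline E^*)$ with $\Gamma(\underline S(\mathcal A^*))\otimes\Gamma(\underline E)$. An $\mathcal A$-representation $\mathcal D$ on $\underline E$ is called associated to $\mathcal Q_{\underline D}$ if the restriction $\mathcal D^*$ of $\mathcal Q_{\underline D}$ to the linear functions $\Gamma(\underline S(\mathcal A^*))\otimes\Gamma(\underline E^*)$ is the dual of $\mathcal D$, that is, $\mathcal Q_{\mathcal A}\langle\psi,\eta\rangle=\langle\mathcal D^*\psi,\eta\rangle+(-1)^{|\psi|}\langle\psi,\mathcal D\eta\rangle$ for all homogeneous $\psi$ and all $\eta$. **Proposition (Correspondence of morphisms).** There are a unique $\mathcal A$-representation $\mathcal D$ on $V[0]\oplus\underline C$ associated to $\mathcal Q_{\underline D}$ and a unique $\mathcal A$-representation $\mathcal D'$ on $V'[0]\oplus\underline C'$ associated to $\mathcal Q_{\underline D'}$.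 There is a one-to-one correspondence $G\leftrightarrow\mu$ between the morphisms of VB-Lie $n$-algebroids $G\colon\underline D\to\underline D'$ that act trivially on basic functions and the morphisms of $\mathcal A$-representations $\mu\colon(V[0]\oplus\underline C,\mathcal D)\to(V'[0]\oplus\underline C',\mathcal D')$. Here $G$ corresponds to $\mu$ if and only if the restriction of $G^\star$ to linear functions is the dual $\mu^\star$ of $\mu$, where $\langle\mu^\star\psi,\eta\rangle=\langle\psi,\mu\eta\rangle$. -/

import Mathlib

open scoped Manifold ContDiff Topology TensorProduct

universe u

noncomputable section

namespace VBLie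

/-! ### Graded symmetric algebra -/

/-- The relations that define the graded symmetric algebra: the generators are linear in `v : W k`, and
generators of degrees `deg k`, `deg l` commute up to the sign `(-1) ^ (deg k * deg l)`. -/
inductive GSym.Rel {κ : Type*} (deg : κ → ℕ) (W : κ → Type*)
    [∀ k, AddCommGroup (W k)] [∀ k, Module ℝ (W k)] :
    FreeAlgebra ℝ (Σ k, W k) → FreeAlgebra ℝ (Σ k, W k) → Prop
  | add (k : κ) (v w : W k) :
      GSym.Rel deg W (FreeAlgebra.ι ℝ ⟨k, v + w⟩)
        (FreeAlgebra.ι ℝ ⟨k, v⟩ + FreeAlgebra.ι ℝ ⟨k, w⟩)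
  | smul (k : κ) (r : ℝ) (v : W k) :
      GSym.Rel deg W (FreeAlgebra.ι ℝ ⟨k, r • v⟩) (r • FreeAlgebra.ι ℝ ⟨k, v⟩)
  | comm (k l : κ) (v : W k) (w : W l) :
      GSym.Rel deg W (FreeAlgebra.ι ℝ ⟨k, v⟩ * FreeAlgebra.ι ℝ ⟨l, w⟩)
        ((-1 : ℝ) ^ (deg k * deg l) • (FreeAlgebra.ι ℝ ⟨l, w⟩ * FreeAlgebra.ι ℝ ⟨k, v⟩))

/-- The graded symmetric algebra of the graded vector space `⨁ k, W k`, with `W k` in degree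
`deg k`. -/
def GSym {κ : Type*} (deg : κ → ℕ) (W : κ → Type*)
    [∀ k, AddCommGroup (W k)] [∀ k, Module ℝ (W k)] : Type _ :=
  RingQuot (GSym.Rel deg W)

namespace GSym

variable {κ : Type*} (deg : κ → ℕ) (W : κ → Type*)
  [∀ k, AddCommGroup (W k)] [∀ k, Module ℝ (W k)]

instance : Ring (GSym deg W) := inferInstanceAs (Ring (RingQuot _))
instance : Algebra ℝ (GSym deg W) := inferInstanceAs (Algebra ℝ (RingQuot _))

/-- The inclusion of the generators `W k` (placed in degree `deg k`). -/
def gen (k : κ) : W k →ₗ[ℝ] GSym deg W where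
  toFun v := RingQuot.mkAlgHom ℝ (GSym.Rel deg W) (FreeAlgebra.ι ℝ ⟨k, v⟩)
  map_add' v w := by
    rw [RingQuot.mkAlgHom_rel ℝ (GSym.Rel.add k v w), map_add]; rfl
  map_smul' r v := by
    rw [RingQuot.mkAlgHom_rel ℝ (GSym.Rel.smul k r v), map_smul]; rfl

/-- The universal property. -/
def lift {B : Type*} [Ring B] [Algebra ℝ B] (φ : ∀ k, W k →ₗ[ℝ] B)
    (h : ∀ k l v w, φ k v * φ l w = (-1 : ℝ) ^ (deg k * deg l) • (φ l w * φ k v)) :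
    GSym deg W →ₐ[ℝ] B :=
  RingQuot.liftAlgHom ℝ ⟨FreeAlgebra.lift ℝ (fun s => φ s.1 s.2), by
    intro x y hxy
    induction hxy with
    | add k v w => simp
    | smul k r v => simp
    | comm k l v w => simpa using h k l v w⟩

@[simp] lemma lift_gen {B : Type*} [Ring B] [Algebra ℝ B] (φ : ∀ k, W k →ₗ[ℝ] B)
    (h : ∀ k l v w, φ k v * φ l w = (-1 : ℝ) ^ (deg k * deg l) • (φ l w * φ k v))
    (k : κ) (v : W k) : lift deg W φ h (gen deg W k v) = φ k v := by
  unfold lift gen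
  erw [RingQuot.liftAlgHom_mkAlgHom_apply]
  simp

lemma gen_mul_gen (k l : κ) (v : W k) (w : W l) :
    gen deg W k v * gen deg W l w
      = (-1 : ℝ) ^ (deg k * deg l) • (gen deg W l w * gen deg W k v) := by
  have := RingQuot.mkAlgHom_rel ℝ (GSym.Rel.comm (deg := deg) k l v w)
  rw [map_mul, map_smul, map_mul] at this
  exact this

/-- The homogeneous part of degree `i`. -/
def part (i : ℕ) : Submodule ℝ (GSym deg W) :=
  Submodule.span ℝ {x | ∃ l : List (Σ k, W k), (l.map fun s => deg s.1).sum = i ∧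
    x = (l.map fun s => gen deg W s.1 s.2).prod}

variable {deg W} in
lemma part_mul {i j : ℕ} {x y : GSym deg W} (hx : x ∈ part deg W i) (hy : y ∈ part deg W j) :
    x * y ∈ part deg W (i + j) := by
  induction hx, hy using Submodule.span_induction₂ with
  | mem_mem x y hx hy =>
    obtain ⟨l, hl, rfl⟩ := hx
    obtain ⟨l', hl', rfl⟩ := hy
    exact Submodule.subset_span ⟨l ++ l', by simp [hl, hl'], by simp⟩
  | zero_left y hy => simp
  | zero_right x hx => simp
  | add_left x y z _ _ _ h1 h2 => rw [add_mul]; exact add_mem h1 h2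
  | add_right x y z _ _ _ h1 h2 => rw [mul_add]; exact add_mem h1 h2
  | smul_left r x y _ _ h => rw [smul_mul_assoc]; exact Submodule.smul_mem _ r h
  | smul_right r x y _ _ h => rw [mul_smul_comm]; exact Submodule.smul_mem _ r h

lemma one_mem_part : (1 : GSym deg W) ∈ part deg W 0 :=
  Submodule.subset_span ⟨[], by simp, by simp⟩

lemma gen_mem_part (k : κ) (v : W k) : gen deg W k v ∈ part deg W (deg k) :=
  Submodule.subset_span ⟨[⟨k, v⟩], by simp, by simp⟩

/-- A homomorphism that maps every generator into the part of its degree preserves degrees. -/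
lemma map_mem_part {κ' : Type*} {deg' : κ' → ℕ} {W' : κ' → Type*} [∀ k, AddCommGroup (W' k)]
    [∀ k, Module ℝ (W' k)] (φ : GSym deg W →ₐ[ℝ] GSym deg' W')
    (h : ∀ k v, φ (gen deg W k v) ∈ part deg' W' (deg k)) {i : ℕ} {x : GSym deg W}
    (hx : x ∈ part deg W i) : φ x ∈ part deg' W' i := by
  induction hx using Submodule.span_induction with
  | mem x hx =>
    obtain ⟨l, rfl, rfl⟩ := hx
    induction l with
    | nil => simpa using one_mem_part deg' W'
    | cons s l ih =>
      simp only [List.map_cons, List.sum_cons, List.prod_cons, map_mul]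
      exact part_mul (h s.1 s.2) ih
  | zero => simp
  | add x y _ _ h1 h2 => rw [map_add]; exact add_mem h1 h2
  | smul r x _ h1 => rw [map_smul]; exact Submodule.smul_mem _ r h1

/-- The parity automorphism: multiplication by `(-1) ^ i` in degree `i`. -/
def parity : GSym deg W →ₐ[ℝ] GSym deg W :=
  lift deg W (fun k => (-1 : ℝ) ^ deg k • gen deg W k) (by
    intro k l v w
    simp only [LinearMap.smul_apply, smul_mul_smul_comm, gen_mul_gen deg W k l v w, smul_smul]
    congr 1; ring)

lemma parity_pow_mem_part (a : ℕ) {i : ℕ} {x : GSym deg W} (hx : x ∈ part deg W i) :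
    (parity deg W ^ a) x ∈ part deg W i := by
  induction a with
  | zero => simpa using hx
  | succ a ih =>
    rw [pow_succ', AlgHom.mul_apply]
    refine map_mem_part deg W _ (fun k v => ?_) ih
    simpa [parity] using Submodule.smul_mem _ _ (gen_mem_part deg W k v)

end GSym

/-! ### Vector bundles over a manifold -/

/-- A smooth real vector bundle of finite rank over the `d`-dimensional manifold `M`. -/
structure VB (d : ℕ) (M : Type u) [TopologicalSpace M]
    [ChartedSpace (EuclideanSpace ℝ (Fin d)) M] where
  F : Type u
  fiber : M → Type u
  [normedF : NormedAddCommGroup F]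
  [spaceF : NormedSpace ℝ F]
  [finF : FiniteDimensional ℝ F]
  [topTotal : TopologicalSpace (Bundle.TotalSpace F fiber)]
  [groupFiber : ∀ m, AddCommGroup (fiber m)]
  [moduleFiber : ∀ m, Module ℝ (fiber m)]
  [topFiber : ∀ m, TopologicalSpace (fiber m)]
  [fiberBundle : FiberBundle F fiber]
  [vectorBundle : VectorBundle ℝ F fiber]
  [smoothBundle : ContMDiffVectorBundle ∞ F fiber (𝓡 d)]

attribute [instance] VB.normedF VB.spaceF VB.finF VB.topTotal VB.groupFiber VB.moduleFiber
  VB.topFiber VB.fiberBundle VB.vectorBundle VB.smoothBundle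

namespace VB

variable {d : ℕ} {M : Type u} [TopologicalSpace M] [ChartedSpace (EuclideanSpace ℝ (Fin d)) M]

/-- The dual vector bundle. -/
def dual (B : VB d M) : VB d M where
  F := B.F →L[ℝ] ℝ
  fiber := fun m => B.fiber m →L[ℝ] Bundle.Trivial M ℝ m

/-- Smooth sections. -/
abbrev Sec (B : VB d M) : Type u := ContMDiffSection (𝓡 d) B.F ∞ B.fiber

/-- The total space. -/
abbrev Total (B : VB d M) : Type u := Bundle.TotalSpace B.F B.fiber

/-- The model with corners of the total space, as a manifold. -/
abbrev model (B : VB d M) := (𝓡 d).prod 𝓘(ℝ, B.F)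

/-- The bundle projection. -/
abbrev proj (B : VB d M) : B.Total → M := Bundle.TotalSpace.proj

/-- The evaluation pairing of the dual fibre with the fibre. -/
def ev (B : VB d M) (m : M) : B.dual.fiber m →ₗ[ℝ] B.fiber m →ₗ[ℝ] ℝ where
  toFun ψ := ContinuousLinearMap.toLinearMap (ψ : B.fiber m →L[ℝ] ℝ)
  map_add' _ _ := rfl
  map_smul' _ _ := rfl

/-- The fibre-wise linear function `ℓ_ψ` on the total space defined by a section `ψ` of the dual. -/
def linFun (B : VB d M) (ψ : B.dual.Sec) : B.Total → ℝ := fun v => B.ev v.1 (ψ v.1) v.2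

lemma contMDiff_ev_comp {EN HN : Type*} [NormedAddCommGroup EN] [NormedSpace ℝ EN]
    [TopologicalSpace HN] (J : ModelWithCorners ℝ EN HN) {N : Type*} [TopologicalSpace N]
    [ChartedSpace HN N] (B : VB d M) (ψ : B.dual.Sec) (b : N → M) (hb : ContMDiff J (𝓡 d) ∞ b)
    (v : ∀ x, B.fiber (b x)) (hv : ContMDiff J B.model ∞
      (fun x => (Bundle.TotalSpace.mk' B.F (b x) (v x) : B.Total))) :
    ContMDiff J 𝓘(ℝ, ℝ) ∞ (fun x => B.ev (b x) (ψ (b x)) (v x)) := by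
  have h1 : ContMDiff J B.dual.model ∞
      (fun x => (Bundle.TotalSpace.mk' B.dual.F (b x) (ψ (b x)) : B.dual.Total)) :=
    ψ.contMDiff.comp hb
  have h2 := ContMDiff.clm_bundle_apply (F₁ := B.F) (F₂ := ℝ) (E₁ := B.fiber)
    (E₂ := Bundle.Trivial M ℝ) (b := b) (IB := 𝓡 d) (ϕ := fun x => ψ (b x)) (v := v) h1 hv
  exact fun x => (Bundle.contMDiffAt_totalSpace.1 (h2 x)).2

lemma contMDiff_linFun (B : VB d M) (ψ : B.dual.Sec) :
    ContMDiff B.model 𝓘(ℝ, ℝ) ∞ (B.linFun ψ) :=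
  contMDiff_ev_comp B.model B ψ B.proj (Bundle.contMDiff_proj B.fiber) (fun v => v.2) contMDiff_id

lemma contMDiff_ev (B : VB d M) (ψ : B.dual.Sec) (b : B.Sec) :
    ContMDiff (𝓡 d) 𝓘(ℝ, ℝ) ∞ (fun m => B.ev m (ψ m) (b m)) :=
  contMDiff_ev_comp (𝓡 d) B ψ (fun m => m) contMDiff_id b b.contMDiff

end VB

/-! ### Functions on split graded manifolds -/

section Functions

variable {d : ℕ} {M : Type u} [TopologicalSpace M] [ChartedSpace (EuclideanSpace ℝ (Fin d)) M]
  {EN HN : Type*} [NormedAddCommGroup EN] [NormedSpace ℝ EN] [TopologicalSpace HN]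
  (J : ModelWithCorners ℝ EN HN) {N : Type u} [TopologicalSpace N] [ChartedSpace HN N]
  (q : N → M) {κ : Type} (deg : κ → ℕ) (W : κ → VB d M)

/-- Families of elements of the graded symmetric algebras of the fibres of `q^! (⨁ k, W k)`, where
`W k` is placed in degree `deg k`. -/
abbrev Raw : Type u := ∀ x : N, GSym deg (fun k => (W k).fiber (q x))

variable {q} {W} in
/-- A function on the base, as a family. -/
def Raw.ofFun (f : N → ℝ) : Raw q deg W := fun x => algebraMap ℝ _ (f x)

variable {q} {W} in
/-- The pull-back along `q` of a section of `W k`, as a family. -/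
def Raw.ofSec (k : κ) (a : (W k).Sec) : Raw q deg W :=
  fun x => GSym.gen deg (fun k => (W k).fiber (q x)) k (a (q x))

/-- The polynomials in pull-backs of smooth sections of the `W k`, with smooth functions on `N` as
coefficients. -/
def Poly : Subalgebra ℝ (Raw q deg W) :=
  Algebra.adjoin ℝ ({s | ∃ f : N → ℝ, ContMDiff J 𝓘(ℝ, ℝ) ∞ f ∧ s = Raw.ofFun deg f} ∪
    {s | ∃ (k : κ) (a : (W k).Sec), s = Raw.ofSec deg k a})

/-- A family is smooth if it is locally a polynomial in (pulled-back) smooth sections with smooth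
coefficients; this is smoothness in local frames of the bundle of graded symmetric algebras. -/
def Smooth : Subalgebra ℝ (Raw q deg W) where
  carrier := {s | ∀ x₀, ∃ t ∈ Poly J q deg W, ∀ᶠ x in 𝓝 x₀, s x = t x}
  mul_mem' := by
    intro a b ha hb x₀
    obtain ⟨t, ht, h⟩ := ha x₀
    obtain ⟨t', ht', h'⟩ := hb x₀
    exact ⟨t * t', mul_mem ht ht', by filter_upwards [h, h'] with x h h'; simp [h, h']⟩
  add_mem' := by
    intro a b ha hb x₀
    obtain ⟨t, ht, h⟩ := ha x₀
    obtain ⟨t', ht', h'⟩ := hb x₀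
    exact ⟨t + t', add_mem ht ht', by filter_upwards [h, h'] with x h h'; simp [h, h']⟩
  algebraMap_mem' := fun r x₀ => ⟨_, algebraMap_mem _ r, by simp⟩

/-- Smooth sections that are homogeneous of degree `i`. -/
def Homog (i : ℕ) : Submodule ℝ (Raw q deg W) where
  carrier := {s | s ∈ Smooth J q deg W ∧
    ∀ x, s x ∈ GSym.part deg (fun k => (W k).fiber (q x)) i}
  add_mem' := fun ha hb => ⟨add_mem ha.1 hb.1, fun x => add_mem (ha.2 x) (hb.2 x)⟩
  zero_mem' := ⟨zero_mem _, fun _ => zero_mem _⟩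
  smul_mem' := fun r _ ha =>
    ⟨Subalgebra.smul_mem _ ha.1 r, fun x => Submodule.smul_mem _ r (ha.2 x)⟩

/-- The graded algebra of functions of the split graded manifold over `N` whose bundle of linear
coordinates is `q^! (⨁ k, W k)` with `W k` in degree `deg k`: the finite sums of homogeneous smooth
sections of the bundle of graded symmetric algebras. -/
def Fn : Subalgebra ℝ (Raw q deg W) := Algebra.adjoin ℝ {s | ∃ i, s ∈ Homog J q deg W i}

variable {J q deg W}

lemma homog_mul_mem {i j : ℕ} {s t : Raw q deg W} (hs : s ∈ Homog J q deg W i)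
    (ht : t ∈ Homog J q deg W j) : s * t ∈ Homog J q deg W (i + j) :=
  ⟨mul_mem hs.1 ht.1, fun x => GSym.part_mul (hs.2 x) (ht.2 x)⟩

lemma mem_Fn_of_homog {i : ℕ} {s : Raw q deg W} (hs : s ∈ Homog J q deg W i) : s ∈ Fn J q deg W :=
  Algebra.subset_adjoin ⟨i, hs⟩

lemma mem_smooth_of_poly {s : Raw q deg W} (hs : s ∈ Poly J q deg W) : s ∈ Smooth J q deg W :=
  fun _ => ⟨s, hs, by simp⟩

lemma ofFun_mem_homog {f : N → ℝ} (hf : ContMDiff J 𝓘(ℝ, ℝ) ∞ f) :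
    (Raw.ofFun deg f : Raw q deg W) ∈ Homog J q deg W 0 :=
  ⟨mem_smooth_of_poly (Algebra.subset_adjoin (Or.inl ⟨f, hf, rfl⟩)), fun x => by
    simp only [Raw.ofFun, Algebra.algebraMap_eq_smul_one]
    exact Submodule.smul_mem _ _ (GSym.one_mem_part _ _)⟩

lemma ofSec_mem_homog (k : κ) (a : (W k).Sec) :
    (Raw.ofSec deg k a : Raw q deg W) ∈ Homog J q deg W (deg k) :=
  ⟨mem_smooth_of_poly (Algebra.subset_adjoin (Or.inr ⟨k, a, rfl⟩)), fun _ =>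
    GSym.gen_mem_part _ _ k _⟩

/-- Functions are finite sums of homogeneous ones. -/
lemma mem_span_of_mem_Fn {s : Raw q deg W} (hs : s ∈ Fn J q deg W) :
    s ∈ Submodule.span ℝ {s | ∃ i, s ∈ Homog J q deg W i} := by
  induction hs using Algebra.adjoin_induction with
  | mem x hx => exact Submodule.subset_span hx
  | algebraMap r =>
    rw [Algebra.algebraMap_eq_smul_one]
    exact Submodule.smul_mem _ _ (Submodule.subset_span
      ⟨0, one_mem _, fun _ => GSym.one_mem_part _ _⟩)
  | add x y _ _ h1 h2 => exact add_mem h1 h2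
  | mul x y hx hy h1 h2 =>
    clear hx hy
    induction h1, h2 using Submodule.span_induction₂ with
    | mem_mem x y hx hy =>
      obtain ⟨i, hi⟩ := hx
      obtain ⟨j, hj⟩ := hy
      exact Submodule.subset_span ⟨i + j, homog_mul_mem hi hj⟩
    | zero_left y hy => simp
    | zero_right x hx => simp
    | add_left x y z _ _ _ h1 h2 => rw [add_mul]; exact add_mem h1 h2
    | add_right x y z _ _ _ h1 h2 => rw [mul_add]; exact add_mem h1 h2
    | smul_left r x y _ _ h => rw [smul_mul_assoc]; exact Submodule.smul_mem _ r h
    | smul_right r x y _ _ h => rw [mul_smul_comm]; exact Submodule.smul_mem _ r h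

variable (q deg W) in
/-- A smooth function on the base, as a function of degree `0` of the graded manifold. -/
def Fn.ofFun (f : C^∞⟮J, N; 𝓘(ℝ, ℝ), ℝ⟯) : Fn J q deg W :=
  ⟨Raw.ofFun deg f, mem_Fn_of_homog (ofFun_mem_homog f.contMDiff)⟩

variable (J q deg W) in
/-- The functions that are homogeneous of degree `i`. -/
def Fn.part (i : ℕ) : Submodule ℝ (Fn J q deg W) :=
  (Homog J q deg W i).comap (Fn J q deg W).val.toLinearMap

variable (J q deg W) in
/-- Homological vector fields: degree `1` derivations of the algebra of functions with square `0`. -/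
structure HomVF where
  op : Fn J q deg W →ₗ[ℝ] Fn J q deg W
  map_deg : ∀ i, ∀ s ∈ Fn.part J q deg W i, op s ∈ Fn.part J q deg W (i + 1)
  leibniz : ∀ i, ∀ s ∈ Fn.part J q deg W i, ∀ t,
    op (s * t) = op s * t + (-1 : ℝ) ^ i • (s * op t)
  sq_zero : ∀ s, op (op s) = 0

end Functions

/-! ### Graded modules of sections over a split graded manifold -/

section Sections

variable {d : ℕ} {M : Type u} [TopologicalSpace M] [ChartedSpace (EuclideanSpace ℝ (Fin d)) M]
  {n : ℕ} (A : Fin n → VB d M)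

/-- The `i`-th summand (counted from `0`) of a graded bundle `A₁[1] ⊕ ⋯ ⊕ Aₙ[n]` gives coordinates
of degree `i + 1`. -/
def dg {n : ℕ} (i : Fin n) : ℕ := i + 1

/-- The fibre at `m` of the bundle of graded symmetric algebras `S(A^*)`, with `A_i^*` in
degree `i`. -/
abbrev SA (m : M) : Type u := GSym dg (fun i => (A i).dual.fiber m)

/-- The graded algebra `Γ(S(A^*))` of functions of the split `[n]`-manifold
`A = A₁[1] ⊕ ⋯ ⊕ Aₙ[n]` over `M`. -/
abbrev FnA : Subalgebra ℝ (Raw (fun m : M => m) dg (fun i => (A i).dual)) :=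
  Fn (𝓡 d) (fun m : M => m) dg (fun i => (A i).dual)

/-- Lie `n`-algebroid structures on `A`. -/
abbrev LieStr : Type u := HomVF (𝓡 d) (fun m : M => m) dg (fun i => (A i).dual)

variable {κ : Type} (e : κ → ℤ) (B : κ → VB d M)

/-- Families of elements of the fibres of `S(A^*) ⊗ (⨁ k, B k)`. -/
abbrev RawMod : Type u := ∀ (m : M) (k : κ), SA A m ⊗[ℝ] (B k).fiber m

instance : Module (∀ m, SA A m) (RawMod A B) := inferInstance
instance : Module (FnA A) (RawMod A B) := inferInstance
instance : SMul (FnA A) (RawMod A B) := inferInstance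
instance : Module ℝ (RawMod A B) := inferInstance
instance : IsScalarTower ℝ (FnA A) (RawMod A B) where
  smul_assoc r f η := by
    funext m k
    exact smul_assoc r (f.1 m) (η m k)

variable {A B} in
lemma fn_smul_apply (f : FnA A) (η : RawMod A B) (m : M) (k : κ) :
    (f • η) m k = f.1 m • η m k := rfl

/-- A family is smooth if its components are locally finite sums `∑ t ⊗ b` with `t` a polynomial in
smooth sections and `b` a smooth section. -/
def SmoothMod : Submodule ℝ (RawMod A B) where
  carrier := {η | ∀ k m₀, ∃ u ∈ Submodule.span ℝ {u : ∀ m, SA A m ⊗[ℝ] (B k).fiber m |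
    ∃ t ∈ Poly (𝓡 d) (fun m : M => m) dg (fun i => (A i).dual), ∃ b : (B k).Sec,
      u = fun m => t m ⊗ₜ b m}, ∀ᶠ m in 𝓝 m₀, η m k = u m}
  add_mem' := by
    intro a b ha hb k x₀
    obtain ⟨t, ht, h⟩ := ha k x₀
    obtain ⟨t', ht', h'⟩ := hb k x₀
    exact ⟨t + t', add_mem ht ht', by filter_upwards [h, h'] with x h h'; simp [h, h']⟩
  zero_mem' := fun k x₀ => ⟨0, zero_mem _, by simp⟩
  smul_mem' := by
    intro r a ha k x₀
    obtain ⟨t, ht, h⟩ := ha k x₀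
    exact ⟨r • t, Submodule.smul_mem _ r ht, by filter_upwards [h] with x h; simp [h]⟩

/-- The part of `S(A^*) ⊗ B k` of degree `p` at a point, where the elements of `B k` have
degree `e k`. -/
def partMod (p : ℤ) (m : M) (k : κ) : Submodule ℝ (SA A m ⊗[ℝ] (B k).fiber m) :=
  Submodule.span ℝ {x | ∃ (i : ℕ) (ξ : SA A m) (b : (B k).fiber m),
    ξ ∈ GSym.part dg (fun i => (A i).dual.fiber m) i ∧ (i : ℤ) + e k = p ∧ x = ξ ⊗ₜ b}

/-- Smooth sections that are homogeneous of degree `p`. -/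
def HomogMod (p : ℤ) : Submodule ℝ (RawMod A B) where
  carrier := {η | η ∈ SmoothMod A B ∧ ∀ m k, η m k ∈ partMod A e B p m k}
  add_mem' := fun ha hb => ⟨add_mem ha.1 hb.1, fun m k => add_mem (ha.2 m k) (hb.2 m k)⟩
  zero_mem' := ⟨zero_mem _, fun _ _ => zero_mem _⟩
  smul_mem' := fun r _ ha =>
    ⟨Submodule.smul_mem _ r ha.1, fun m k => Submodule.smul_mem _ r (ha.2 m k)⟩

/-- The left graded module `Γ(S(A^*)) ⊗ Γ(⨁ k, B k)` over the functions on `A`, with `B k` in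
degree `e k`: the finite sums of homogeneous smooth sections of `S(A^*) ⊗ (⨁ k, B k)`. -/
def Mod : Submodule (FnA A) (RawMod A B) :=
  Submodule.span (FnA A) {η | ∃ p, η ∈ HomogMod A e B p}

instance : Module (FnA A) (Mod A e B) := Submodule.module _
instance : SMul (FnA A) (Mod A e B) := Module.toDistribMulAction.toSMul
instance : Module ℝ (Mod A e B) := Submodule.module' _

/-- The elements that are homogeneous of degree `p`. -/
def Mod.part (p : ℤ) : Submodule ℝ (Mod A e B) :=
  (HomogMod A e B p).comap ((Mod A e B).subtype.restrictScalars ℝ)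

variable {A} in
/-- The (left) representations up to homotopy of the Lie `n`-algebroid `(A, QA)` on the graded
vector bundle `⨁ k, B k`, with `B k` in degree `e k`. -/
structure Rep (QA : LieStr A) where
  op : Mod A e B →ₗ[ℝ] Mod A e B
  map_part : ∀ p, ∀ η ∈ Mod.part A e B p, op η ∈ Mod.part A e B (p + 1)
  leibniz : ∀ i, ∀ ξ ∈ Fn.part (𝓡 d) (fun m : M => m) dg (fun i => (A i).dual) i,
    ∀ η : Mod A e B, op (ξ • η) = QA.op ξ • η + (-1 : ℝ) ^ i • (ξ • op η)
  sq_zero : ∀ η, op (op η) = 0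

variable {A e B} in
/-- The morphisms of representations up to homotopy (over the identity of `A`). -/
structure RepHom {QA : LieStr A} {κ' : Type} {e' : κ' → ℤ} {B' : κ' → VB d M}
    (D : Rep e B QA) (D' : Rep e' B' QA) where
  map : Mod A e B →ₗ[FnA A] Mod A e' B'
  map_part : ∀ p, ∀ η ∈ Mod.part A e B p, map η ∈ Mod.part A e' B' p
  comm : ∀ η, map (D.op η) = D'.op (map η)

end Sections

/-! ### The pairing of a module with its dual -/

section Pairing

variable {d : ℕ} {M : Type u} [TopologicalSpace M] [ChartedSpace (EuclideanSpace ℝ (Fin d)) M]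
  {n : ℕ} (A : Fin n → VB d M) {κ : Type} (e : κ → ℤ) (B : κ → VB d M)

/-- The dual `Γ(S(A^*)) ⊗ Γ(⨁ k, (B k)^*)`, with `(B k)^*` in degree `- e k`. -/
abbrev DualMod : Submodule (FnA A) (RawMod A fun k => (B k).dual) :=
  Mod A (fun k => - e k) (fun k => (B k).dual)

/-- The pairing `⟨ξ ⊗ ψ, ζ ⊗ b⟩ = (-1) ^ (|ψ| |ζ|) ψ(b) ξ ζ` at a point. -/
def pairFib (m : M) (k : κ) :
    SA A m ⊗[ℝ] (B k).dual.fiber m →ₗ[ℝ] SA A m ⊗[ℝ] (B k).fiber m →ₗ[ℝ] SA A m :=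
  (TensorProduct.map₂ ((LinearMap.mul ℝ (SA A m)).compl₂
      (GSym.parity dg (fun i => (A i).dual.fiber m) ^ (e k).natAbs).toLinearMap)
    ((B k).ev m)).compr₂ (TensorProduct.rid ℝ (SA A m)).toLinearMap

variable {A B} in
lemma pairFib_tmul (m : M) (k : κ) (ξ ζ : SA A m) (ψ : (B k).dual.fiber m) (b : (B k).fiber m) :
    pairFib A e B m k (ξ ⊗ₜ ψ) (ζ ⊗ₜ b) = (B k).ev m ψ b •
      (ξ * (GSym.parity dg (fun i => (A i).dual.fiber m) ^ (e k).natAbs) ζ) := by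
  simp [pairFib]

variable {A B} in
lemma pairFib_smul (m : M) (k : κ) (f : SA A m) (x : SA A m ⊗[ℝ] (B k).dual.fiber m)
    (y : SA A m ⊗[ℝ] (B k).fiber m) :
    pairFib A e B m k (f • x) y = f * pairFib A e B m k x y := by
  induction x using TensorProduct.induction_on with
  | zero => simp
  | add x x' h h' => simp only [smul_add, map_add, LinearMap.add_apply, h, h', mul_add]
  | tmul ξ ψ =>
    induction y using TensorProduct.induction_on with
    | zero => simp
    | add x x' h h' => simp only [map_add, h, h', mul_add]
    | tmul ζ b =>
      simp only [TensorProduct.smul_tmul', pairFib_tmul, smul_eq_mul, mul_assoc, mul_smul_comm]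

/-- The pairing of families. -/
def pairRaw [Fintype κ] :
    RawMod A (fun k => (B k).dual) →ₗ[ℝ] RawMod A B →ₗ[ℝ]
      Raw (fun m : M => m) dg (fun i => (A i).dual) :=
  LinearMap.mk₂ ℝ (fun ψ η m => ∑ k, pairFib A e B m k (ψ m k) (η m k))
    (fun _ _ _ => by funext m; simp [Finset.sum_add_distrib])
    (fun _ _ _ => by funext m; simp [Finset.smul_sum])
    (fun _ _ _ => by funext m; simp [Finset.sum_add_distrib])
    (fun _ _ _ => by funext m; simp [Finset.smul_sum])

variable {A B e}

lemma parity_poly (a : ℕ) {t : Raw (fun m : M => m) dg (fun i => (A i).dual)}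
    (ht : t ∈ Poly (𝓡 d) (fun m : M => m) dg (fun i => (A i).dual)) :
    (fun m => (GSym.parity dg (fun i => (A i).dual.fiber m) ^ a) (t m)) ∈
      Poly (𝓡 d) (fun m : M => m) dg (fun i => (A i).dual) := by
  induction ht using Algebra.adjoin_induction with
  | mem x hx =>
    rcases hx with ⟨f, hf, rfl⟩ | ⟨k, s, rfl⟩
    · refine Algebra.subset_adjoin (Or.inl ⟨f, hf, ?_⟩)
      funext m
      exact AlgHom.commutes _ _
    · have : (fun m => (GSym.parity dg (fun i => (A i).dual.fiber m) ^ a)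
          ((Raw.ofSec dg k s : Raw (fun m : M => m) dg (fun i => (A i).dual)) m)) =
          (((-1 : ℝ) ^ dg k) ^ a) •
            (Raw.ofSec dg k s : Raw (fun m : M => m) dg (fun i => (A i).dual)) := by
        funext m
        induction a with
        | zero => simp
        | succ a ih =>
          rw [pow_succ', AlgHom.mul_apply, ih]
          simp [Raw.ofSec, GSym.parity, smul_smul, pow_succ]
      rw [this]
      have h : (Raw.ofSec dg k s : Raw (fun m : M => m) dg (fun i => (A i).dual)) ∈
          Poly (𝓡 d) (fun m : M => m) dg (fun i => (A i).dual) :=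
        Algebra.subset_adjoin (Or.inr ⟨k, s, rfl⟩)
      exact Subalgebra.smul_mem _ h _
  | algebraMap r =>
    convert algebraMap_mem (Poly (𝓡 d) (fun m : M => m) dg (fun i => (A i).dual)) r using 1
    funext m
    exact AlgHom.commutes _ _
  | add x y _ _ h h' =>
    convert add_mem h h' using 1
    funext m
    simp
  | mul x y _ _ h h' =>
    convert mul_mem h h' using 1
    funext m
    simp

lemma pairFib_smooth (k : κ) {u : ∀ m, SA A m ⊗[ℝ] (B k).dual.fiber m}
    {u' : ∀ m, SA A m ⊗[ℝ] (B k).fiber m}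
    (hu : u ∈ Submodule.span ℝ {u : ∀ m, SA A m ⊗[ℝ] (B k).dual.fiber m |
      ∃ t ∈ Poly (𝓡 d) (fun m : M => m) dg (fun i => (A i).dual), ∃ b : (B k).dual.Sec,
      u = fun m => t m ⊗ₜ b m})
    (hu' : u' ∈ Submodule.span ℝ {u : ∀ m, SA A m ⊗[ℝ] (B k).fiber m |
      ∃ t ∈ Poly (𝓡 d) (fun m : M => m) dg (fun i => (A i).dual), ∃ b : (B k).Sec,
      u = fun m => t m ⊗ₜ b m}) :
    (fun m => pairFib A e B m k (u m) (u' m)) ∈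
      Poly (𝓡 d) (fun m : M => m) dg (fun i => (A i).dual) := by
  induction hu, hu' using Submodule.span_induction₂ with
  | mem_mem x y hx hy =>
    obtain ⟨t, ht, ψ, rfl⟩ := hx
    obtain ⟨t', ht', b, rfl⟩ := hy
    have h : (Raw.ofFun dg (fun m => (B k).ev m (ψ m) (b m)) :
        Raw (fun m : M => m) dg (fun i => (A i).dual)) ∈
        Poly (𝓡 d) (fun m : M => m) dg (fun i => (A i).dual) :=
      Algebra.subset_adjoin (Or.inl ⟨_, (B k).contMDiff_ev ψ b, rfl⟩)
    convert mul_mem h (mul_mem ht (parity_poly (e k).natAbs ht')) using 1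
    funext m
    simp only [pairFib_tmul, Pi.mul_apply, Raw.ofFun, Algebra.smul_def]
  | zero_left y hy =>
    convert zero_mem (Poly (𝓡 d) (fun m : M => m) dg (fun i => (A i).dual)) using 1
    funext m; simp
  | zero_right x hx =>
    convert zero_mem (Poly (𝓡 d) (fun m : M => m) dg (fun i => (A i).dual)) using 1
    funext m; simp
  | add_left x y z _ _ _ h1 h2 =>
    convert add_mem h1 h2 using 1
    funext m; simp
  | add_right x y z _ _ _ h1 h2 =>
    convert add_mem h1 h2 using 1
    funext m; simp
  | smul_left r x y _ _ h =>
    convert Subalgebra.smul_mem _ h r using 1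
    funext m; simp
  | smul_right r x y _ _ h =>
    convert Subalgebra.smul_mem _ h r using 1
    funext m; simp

lemma pairFib_part {p p' : ℤ} (m : M) (k : κ) {x : SA A m ⊗[ℝ] (B k).dual.fiber m}
    {y : SA A m ⊗[ℝ] (B k).fiber m}
    (hx : x ∈ partMod A (fun k => - e k) (fun k => (B k).dual) p m k)
    (hy : y ∈ partMod A e B p' m k) :
    pairFib A e B m k x y ∈ GSym.part dg (fun i => (A i).dual.fiber m) (p + p').toNat := by
  induction hx, hy using Submodule.span_induction₂ with
  | mem_mem x y hx hy =>
    obtain ⟨i, ξ, ψ, hξ, hi, rfl⟩ := hx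
    obtain ⟨j, ζ, b, hζ, hj, rfl⟩ := hy
    dsimp only at hi
    have : (p + p').toNat = i + j := by omega
    rw [pairFib_tmul, this]
    exact Submodule.smul_mem _ _ (GSym.part_mul hξ (GSym.parity_pow_mem_part _ _ _ hζ))
  | zero_left y hy => simp
  | zero_right x hx => simp
  | add_left x y z _ _ _ h1 h2 => simpa using add_mem h1 h2
  | add_right x y z _ _ _ h1 h2 => simpa using add_mem h1 h2
  | smul_left r x y _ _ h => simpa using Submodule.smul_mem _ r h
  | smul_right r x y _ _ h => simpa using Submodule.smul_mem _ r h

lemma pairRaw_homog [Fintype κ] {p p' : ℤ} {ψ : RawMod A (fun k => (B k).dual)} {η : RawMod A B}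
    (hψ : ψ ∈ HomogMod A (fun k => - e k) (fun k => (B k).dual) p)
    (hη : η ∈ HomogMod A e B p') :
    pairRaw A e B ψ η ∈ Homog (𝓡 d) (fun m : M => m) dg (fun i => (A i).dual) (p + p').toNat := by
  have : pairRaw A e B ψ η = ∑ k, (fun m => pairFib A e B m k (ψ m k) (η m k)) := by
    funext m; simp [pairRaw]
  rw [this]
  refine sum_mem fun k _ => ⟨fun m₀ => ?_, fun m => pairFib_part m k (hψ.2 m k) (hη.2 m k)⟩
  obtain ⟨u, hu, h⟩ := hψ.1 k m₀
  obtain ⟨u', hu', h'⟩ := hη.1 k m₀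
  refine ⟨_, pairFib_smooth (e := e) k hu hu', ?_⟩
  filter_upwards [h, h'] with m h h'
  rw [h, h']

lemma smul_homogMod {i : ℕ} {p : ℤ} {f : Raw (fun m : M => m) dg (fun i => (A i).dual)}
    {η : RawMod A B} (hf : f ∈ Homog (𝓡 d) (fun m : M => m) dg (fun i => (A i).dual) i)
    (hη : η ∈ HomogMod A e B p) : f • η ∈ HomogMod A e B (i + p) := by
  refine ⟨fun k m₀ => ?_, fun m k => ?_⟩
  · obtain ⟨t, ht, h⟩ := hf.1 m₀
    obtain ⟨u, hu, h'⟩ := hη.1 k m₀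
    refine ⟨fun m => t m • u m, ?_, ?_⟩
    · clear h'
      induction hu using Submodule.span_induction with
      | mem x hx =>
        obtain ⟨s, hs, b, rfl⟩ := hx
        exact Submodule.subset_span ⟨t * s, mul_mem ht hs, b, by
          funext m; simp [TensorProduct.smul_tmul']⟩
      | zero =>
        convert Submodule.zero_mem _ using 1
        funext m; simp
      | add x y _ _ h1 h2 =>
        convert Submodule.add_mem _ h1 h2 using 1
        funext m; simp
      | smul r x _ h1 =>
        convert Submodule.smul_mem _ r h1 using 1
        funext m
        exact smul_comm (t m) r (x m)
    · filter_upwards [h, h'] with m h h'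
      change f m • η m k = _
      rw [h, h']
  · change f m • η m k ∈ _
    have h1 := hf.2 m
    have h2 := hη.2 m k
    generalize η m k = y at h2
    induction h2 using Submodule.span_induction with
    | mem x hx =>
      obtain ⟨j, ξ, b, hξ, hj, rfl⟩ := hx
      exact Submodule.subset_span ⟨i + j, f m * ξ, b, GSym.part_mul h1 hξ, by
        push_cast; omega, by simp [TensorProduct.smul_tmul']⟩
    | zero => simp
    | add x y _ _ h1 h2 => rw [smul_add]; exact add_mem h1 h2
    | smul r x _ h1 => rw [smul_comm]; exact Submodule.smul_mem _ r h1

/-- The elements of the module are finite sums of homogeneous ones. -/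
lemma mem_span_of_mem_Mod {η : RawMod A B} (hη : η ∈ Mod A e B) :
    η ∈ Submodule.span ℝ {η | ∃ p, η ∈ HomogMod A e B p} := by
  induction hη using Submodule.span_induction with
  | mem x hx => exact Submodule.subset_span hx
  | zero => exact zero_mem _
  | add x y _ _ h1 h2 => exact add_mem h1 h2
  | smul f x _ h1 =>
    have h2 := mem_span_of_mem_Fn f.2
    change f.1 • x ∈ _
    generalize f.1 = g at h2
    rename_i hx
    clear hx
    induction h2, h1 using Submodule.span_induction₂ with
    | mem_mem x y hx hy =>
      obtain ⟨i, hi⟩ := hx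
      obtain ⟨p, hp⟩ := hy
      exact Submodule.subset_span ⟨_, smul_homogMod hi hp⟩
    | zero_left y hy => simp
    | zero_right x hx => simp
    | add_left x y z _ _ _ h1 h2 => rw [add_smul]; exact add_mem h1 h2
    | add_right x y z _ _ _ h1 h2 => rw [smul_add]; exact add_mem h1 h2
    | smul_left r x y _ _ h => rw [smul_assoc]; exact Submodule.smul_mem _ r h
    | smul_right r x y _ _ h =>
      have : x • r • y = r • x • y := by
        funext m k; exact smul_comm (x m) r (y m k)
      rw [this]; exact Submodule.smul_mem _ r h

/-- The pairing of the dual module with the module, with values in the functions on `A`. -/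
def pair [Fintype κ] (ψ : DualMod A e B) (η : Mod A e B) : FnA A :=
  ⟨pairRaw A e B ψ.1 η.1, by
    have h1 := mem_span_of_mem_Mod ψ.2
    have h2 := mem_span_of_mem_Mod η.2
    generalize ψ.1 = x at h1
    generalize η.1 = y at h2
    induction h1, h2 using Submodule.span_induction₂ with
    | mem_mem x y hx hy =>
      obtain ⟨i, hi⟩ := hx
      obtain ⟨p, hp⟩ := hy
      exact mem_Fn_of_homog (pairRaw_homog hi hp)
    | zero_left y hy => simp
    | zero_right x hx => simp
    | add_left x y z _ _ _ h1 h2 => simpa using add_mem h1 h2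
    | add_right x y z _ _ _ h1 h2 => simpa using add_mem h1 h2
    | smul_left r x y _ _ h => simpa using Subalgebra.smul_mem _ h r
    | smul_right r x y _ _ h => simpa using Subalgebra.smul_mem _ h r⟩

end Pairing

/-! ### Decomposed graded double vector bundles -/

section Decomposed

variable {d : ℕ} {M : Type u} [TopologicalSpace M] [ChartedSpace (EuclideanSpace ℝ (Fin d)) M]
  {n : ℕ} (V : VB d M) (A C : Fin n → VB d M)

/-- The degrees of the coordinates of `(A₁ ⊕ C₁)[1] ⊕ ⋯ ⊕ (Aₙ ⊕ Cₙ)[n]`. -/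
def dgD {n : ℕ} : Fin n ⊕ Fin n → ℕ := Sum.elim dg dg

/-- The bundles `A_i^*` and `C_i^*`. -/
def coframe : Fin n ⊕ Fin n → VB d M :=
  Sum.elim (fun i => (A i).dual) (fun i => (C i).dual)

/-- The algebra of functions of the split `[n]`-manifold `D → V` given by the decomposed double
vector bundles `D_i = q_V^! (A_i ⊕ C_i)`. -/
abbrev FnD : Subalgebra ℝ (Raw V.proj dgD (coframe A C)) :=
  Fn V.model V.proj dgD (coframe A C)

/-- The inclusion `S(A^*) → S(A^* ⊕ C^*)` at a point. -/
def incl (m : M) : SA A m →ₐ[ℝ] GSym dgD (fun k => (coframe A C k).fiber m) :=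
  GSym.lift dg (fun i => (A i).dual.fiber m)
    (fun i => GSym.gen dgD (fun k => (coframe A C k).fiber m) (Sum.inl i))
    (fun i j v w => GSym.gen_mul_gen dgD (fun k => (coframe A C k).fiber m)
      (Sum.inl i) (Sum.inl j) v w)

variable {A C} in
lemma incl_gen (m : M) (i : Fin n) (α : (A i).dual.fiber m) :
    incl A C m (GSym.gen dg (fun i => (A i).dual.fiber m) i α)
      = GSym.gen dgD (fun k => (coframe A C k).fiber m) (Sum.inl i) α :=
  GSym.lift_gen _ _ _ _ _ _

variable {A C} in
lemma incl_part (m : M) {i : ℕ} {x : SA A m}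
    (hx : x ∈ GSym.part dg (fun i => (A i).dual.fiber m) i) :
    incl A C m x ∈ GSym.part dgD (fun k => (coframe A C k).fiber m) i :=
  GSym.map_mem_part _ _ _ (fun k v => by
    rw [incl_gen]; exact GSym.gen_mem_part dgD (fun k => (coframe A C k).fiber m) (Sum.inl k) v) hx

/-- Pull-back of families along the projection `D → A`. -/
def pullRaw : Raw (fun m : M => m) dg (fun i => (A i).dual) →ₐ[ℝ] Raw V.proj dgD (coframe A C) :=
  AlgHom.pi (fun v : V.Total => (incl A C v.proj).comp (Pi.evalAlgHom ℝ _ v.proj))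

variable {V A C}

lemma pullRaw_apply (s : Raw (fun m : M => m) dg (fun i => (A i).dual)) (v : V.Total) :
    pullRaw V A C s v = incl A C v.proj (s v.proj) := rfl

lemma pullRaw_poly {t : Raw (fun m : M => m) dg (fun i => (A i).dual)}
    (ht : t ∈ Poly (𝓡 d) (fun m : M => m) dg (fun i => (A i).dual)) :
    pullRaw V A C t ∈ Poly V.model V.proj dgD (coframe A C) := by
  induction ht using Algebra.adjoin_induction with
  | mem x hx =>
    rcases hx with ⟨f, hf, rfl⟩ | ⟨k, s, rfl⟩
    · refine Algebra.subset_adjoin (Or.inl ⟨f ∘ V.proj,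
        hf.comp (Bundle.contMDiff_proj V.fiber), ?_⟩)
      funext v
      exact AlgHom.commutes _ _
    · refine Algebra.subset_adjoin (Or.inr ⟨Sum.inl k, s, ?_⟩)
      funext v
      exact incl_gen _ _ _
  | algebraMap r => rw [AlgHom.commutes]; exact algebraMap_mem _ r
  | add x y _ _ h h' => rw [map_add]; exact add_mem h h'
  | mul x y _ _ h h' => rw [map_mul]; exact mul_mem h h'

lemma continuous_proj : Continuous V.proj := FiberBundle.continuous_proj V.F V.fiber

lemma pullRaw_homog {i : ℕ} {s : Raw (fun m : M => m) dg (fun i => (A i).dual)}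
    (hs : s ∈ Homog (𝓡 d) (fun m : M => m) dg (fun i => (A i).dual) i) :
    pullRaw V A C s ∈ Homog V.model V.proj dgD (coframe A C) i := by
  refine ⟨fun v₀ => ?_, fun v => incl_part _ (hs.2 _)⟩
  obtain ⟨t, ht, h⟩ := hs.1 v₀.proj
  refine ⟨_, pullRaw_poly ht, ?_⟩
  filter_upwards [continuous_proj.continuousAt.eventually h] with v hv
  rw [pullRaw_apply, pullRaw_apply, hv]

lemma pullRaw_mem {s : Raw (fun m : M => m) dg (fun i => (A i).dual)} (hs : s ∈ FnA A) :
    pullRaw V A C s ∈ FnD V A C := by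
  induction hs using Algebra.adjoin_induction with
  | mem x hx =>
    obtain ⟨i, hi⟩ := hx
    exact mem_Fn_of_homog (pullRaw_homog hi)
  | algebraMap r => rw [AlgHom.commutes]; exact algebraMap_mem _ r
  | add x y _ _ h h' => rw [map_add]; exact add_mem h h'
  | mul x y _ _ h h' => rw [map_mul]; exact mul_mem h h'

variable (V A C)

/-- The pull-back `π_A^⋆` of functions along the projection `D → A`; its values are the basic
functions. -/
def pull : FnA A →ₐ[ℝ] FnD V A C :=
  ((pullRaw V A C).comp (FnA A).val).codRestrict _ (fun s => pullRaw_mem s.2)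

/-- The graded vector bundle `E = V[0] ⊕ C₁[1] ⊕ ⋯ ⊕ Cₙ[n]`. -/
def tot : Option (Fin n) → VB d M := fun k => k.elim V C

/-- The degrees of the summands of `E`: elements of `V` have degree `0`, those of `C_i` have
degree `-i`. -/
def totDeg {n : ℕ} : Option (Fin n) → ℤ := fun k => k.elim 0 (fun i => -(dg i : ℤ))

/-- The linear function on the fibre of `D` over `v` defined by an element of `V^*` or `C_i^*`. -/
def linGen (v : V.Total) : (k : Option (Fin n)) →
    (tot V C k).dual.fiber v.proj →ₗ[ℝ] GSym dgD (fun k => (coframe A C k).fiber v.proj)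
  | none => (Algebra.linearMap ℝ _).comp ((V.ev v.proj).flip v.2)
  | some i => GSym.gen dgD (fun k => (coframe A C k).fiber v.proj) (Sum.inr i)

/-- `ξ ⊗ ψ ↦ π_A^⋆(ξ) ℓ_ψ` on the fibre over `v`. -/
def linFib (v : V.Total) (k : Option (Fin n)) :
    SA A v.proj ⊗[ℝ] (tot V C k).dual.fiber v.proj →ₗ[ℝ]
      GSym dgD (fun k => (coframe A C k).fiber v.proj) :=
  TensorProduct.lift (((LinearMap.mul ℝ _).comp (incl A C v.proj).toLinearMap).compl₂
    (linGen V A C v k))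

lemma linFib_tmul (v : V.Total) (k : Option (Fin n)) (ξ : SA A v.proj)
    (ψ : (tot V C k).dual.fiber v.proj) :
    linFib V A C v k (ξ ⊗ₜ ψ) = incl A C v.proj ξ * linGen V A C v k ψ := by
  simp [linFib]

lemma linFib_smul (v : V.Total) (k : Option (Fin n)) (ξ : SA A v.proj)
    (x : SA A v.proj ⊗[ℝ] (tot V C k).dual.fiber v.proj) :
    linFib V A C v k (ξ • x) = incl A C v.proj ξ * linFib V A C v k x := by
  induction x using TensorProduct.induction_on with
  | zero => simp
  | add x x' h h' => simp only [smul_add, map_add, h, h', mul_add]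
  | tmul ζ ψ => simp only [TensorProduct.smul_tmul', linFib_tmul, smul_eq_mul, map_mul, mul_assoc]

lemma linFib_poly (k : Option (Fin n)) {u : ∀ m, SA A m ⊗[ℝ] (tot V C k).dual.fiber m}
    (hu : u ∈ Submodule.span ℝ {u : ∀ m, SA A m ⊗[ℝ] (tot V C k).dual.fiber m |
      ∃ t ∈ Poly (𝓡 d) (fun m : M => m) dg (fun i => (A i).dual), ∃ b : (tot V C k).dual.Sec,
      u = fun m => t m ⊗ₜ b m}) :
    (fun v : V.Total => linFib V A C v k (u v.proj)) ∈
      Poly V.model V.proj dgD (coframe A C) := by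
  induction hu using Submodule.span_induction with
  | mem x hx =>
    obtain ⟨t, ht, b, rfl⟩ := hx
    have h : (fun v : V.Total => linGen V A C v k (b v.proj)) ∈
        Poly V.model V.proj dgD (coframe A C) := by
      cases k with
      | none => exact Algebra.subset_adjoin (Or.inl ⟨V.linFun b, V.contMDiff_linFun b, rfl⟩)
      | some i => exact Algebra.subset_adjoin (Or.inr ⟨Sum.inr i, b, rfl⟩)
    convert mul_mem (pullRaw_poly ht) h using 1
    funext v
    exact linFib_tmul _ _ _ _ _ _ _
  | zero =>
    convert zero_mem (Poly V.model V.proj dgD (coframe A C)) using 1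
    funext v; simp
  | add x y _ _ h1 h2 =>
    convert add_mem h1 h2 using 1
    funext v; simp
  | smul r x _ h =>
    convert Subalgebra.smul_mem _ h r using 1
    funext v; simp

lemma linFib_part (v : V.Total) (k : Option (Fin n)) {p : ℤ}
    {x : SA A v.proj ⊗[ℝ] (tot V C k).dual.fiber v.proj}
    (hx : x ∈ partMod A (fun k => - totDeg k) (fun k => (tot V C k).dual) p v.proj k) :
    linFib V A C v k x ∈ GSym.part dgD (fun k => (coframe A C k).fiber v.proj) p.toNat := by
  induction hx using Submodule.span_induction with
  | mem x hx =>
    obtain ⟨i, ξ, ψ, hξ, hi, rfl⟩ := hx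
    rw [linFib_tmul]
    have h : linGen V A C v k ψ ∈ GSym.part dgD (fun k => (coframe A C k).fiber v.proj)
        (-totDeg k).toNat := by
      cases k with
      | none =>
        change algebraMap ℝ (GSym dgD (fun k => (coframe A C k).fiber v.proj))
          (V.ev v.proj ψ v.2) ∈ GSym.part dgD (fun k => (coframe A C k).fiber v.proj) 0
        rw [Algebra.algebraMap_eq_smul_one]
        exact Submodule.smul_mem _ _
          (GSym.one_mem_part dgD (fun k => (coframe A C k).fiber v.proj))
      | some j =>
        have : (-totDeg (some j)).toNat = dgD (Sum.inr j : Fin n ⊕ Fin n) := by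
          simp [totDeg, dgD]
        rw [this]
        exact GSym.gen_mem_part dgD (fun k => (coframe A C k).fiber v.proj) (Sum.inr j) ψ
    have h0 : 0 ≤ -totDeg k := by
      cases k <;> simp [totDeg]
    have : p.toNat = i + (-totDeg k).toNat := by
      dsimp only at hi
      omega
    rw [this]
    exact GSym.part_mul (incl_part _ hξ) h
  | zero => simp
  | add x y _ _ h1 h2 => simpa using add_mem h1 h2
  | smul r x _ h => simpa using Submodule.smul_mem _ r h

/-- The linear functions of `D → A`, as families: a section `∑ ξ ⊗ ψ` of `S(A^*) ⊗ E^*` is mapped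
to `∑ π_A^⋆(ξ) ℓ_ψ`. -/
def linRaw : RawMod A (fun k => (tot V C k).dual) →ₗ[ℝ] Raw V.proj dgD (coframe A C) where
  toFun ψ v := ∑ k, linFib V A C v k (ψ v.proj k)
  map_add' _ _ := by funext v; simp [Finset.sum_add_distrib]
  map_smul' _ _ := by funext v; simp [Finset.smul_sum]

lemma linRaw_mem {ψ : RawMod A (fun k => (tot V C k).dual)}
    (hψ : ψ ∈ DualMod A totDeg (tot V C)) : linRaw V A C ψ ∈ FnD V A C := by
  induction hψ using Submodule.span_induction with
  | mem ψ hψ =>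
    obtain ⟨p, hp⟩ := hψ
    have : linRaw V A C ψ = ∑ k, (fun v : V.Total => linFib V A C v k (ψ v.proj k)) := by
      funext v; simp [linRaw]
    rw [this]
    refine sum_mem fun k _ => mem_Fn_of_homog (i := p.toNat)
      ⟨fun v₀ => ?_, fun v => linFib_part V A C v k (hp.2 v.proj k)⟩
    obtain ⟨u, hu, h⟩ := hp.1 k v₀.proj
    refine ⟨_, linFib_poly V A C k hu, ?_⟩
    filter_upwards [continuous_proj.continuousAt.eventually h] with v hv
    rw [hv]
  | zero => simp
  | add x y _ _ h1 h2 => simpa using add_mem h1 h2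
  | smul f x _ h =>
    have : linRaw V A C (f • x) = pullRaw V A C f.1 * linRaw V A C x := by
      funext v
      simp only [linRaw, LinearMap.coe_mk, AddHom.coe_mk, Pi.mul_apply, pullRaw_apply,
        Finset.mul_sum]
      exact Finset.sum_congr rfl fun k _ => linFib_smul V A C v k _ _
    rw [this]
    exact mul_mem (pullRaw_mem f.2) h

/-- The identification of `Γ(S(A^*)) ⊗ Γ(E^*)` with the linear functions of the vector bundle
`D → A`; sections `ψ` of `V^*` are mapped to `ℓ_ψ` and sections of `C_i^*` to themselves. -/
def lin : DualMod A totDeg (tot V C) →ₗ[ℝ] FnD V A C where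
  toFun ψ := ⟨linRaw V A C ψ.1, linRaw_mem V A C ψ.2⟩
  map_add' _ _ := Subtype.ext (map_add (linRaw V A C) _ _)
  map_smul' r ψ := Subtype.ext (map_smul (linRaw V A C) r ψ.1)

/-- Products of generators, with their bidegrees: `q_V^* f` has bidegree `(0, 0)`, sections of
`A_i^*` have bidegree `(0, i)`, `ℓ_ψ` with `ψ` a section of `V^*` has bidegree `(1, -1)`, sections
of `C_i^*` have bidegree `(1, i - 1)`. -/
inductive Monomial : ℕ → ℤ → Raw V.proj dgD (coframe A C) → Prop
  | one : Monomial 0 0 1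
  | base {a : ℕ} {b : ℤ} {t : Raw V.proj dgD (coframe A C)} (f : M → ℝ)
      (hf : ContMDiff (𝓡 d) 𝓘(ℝ, ℝ) ∞ f) :
      Monomial a b t → Monomial a b (Raw.ofFun dgD (f ∘ V.proj) * t)
  | side {a : ℕ} {b : ℤ} {t : Raw V.proj dgD (coframe A C)} (i : Fin n) (α : (A i).dual.Sec) :
      Monomial a b t → Monomial a (b + dg i) (Raw.ofSec dgD (Sum.inl i) α * t)
  | linear {a : ℕ} {b : ℤ} {t : Raw V.proj dgD (coframe A C)} (ψ : V.dual.Sec) :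
      Monomial a b t → Monomial (a + 1) (b - 1) (Raw.ofFun dgD (V.linFun ψ) * t)
  | core {a : ℕ} {b : ℤ} {t : Raw V.proj dgD (coframe A C)} (i : Fin n) (γ : (C i).dual.Sec) :
      Monomial a b t → Monomial (a + 1) (b + (dg i - 1)) (Raw.ofSec dgD (Sum.inr i) γ * t)

/-- The functions of bidegree `(a, b)` of the vector bundle `D → A`: locally, linear combinations
of products of generators of total bidegree `(a, b)`. -/
def Bideg (a : ℕ) (b : ℤ) : Set (FnD V A C) :=
  {s | ∀ v₀, ∃ t ∈ Submodule.span ℝ {t | Monomial V A C a b t}, ∀ᶠ v in 𝓝 v₀, s.1 v = t v}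

variable {A}

/-- The VB-Lie `n`-algebroid structures on the decomposed double vector bundle with sides `V` and
`A` and core `C` that induce the Lie `n`-algebroid structure `QA` on `A`: the homological vector
fields on `D → V` that are linear with respect to `D → A` (they preserve the linear functions and
the basic functions) and restrict to `QA` on the basic functions. -/
structure VBStr (QA : LieStr A) extends HomVF V.model V.proj dgD (coframe A C) where
  linear : ∀ ψ, ∃ χ, op (lin V A C ψ) = lin V A C χ
  basic : ∀ α, op (pull V A C α) = pull V A C (QA.op α)

variable {V C} {V' : VB d M} {C' : Fin n → VB d M} {QA : LieStr A}

/-- The morphisms of VB-Lie `n`-algebroids with the same side `A` that act trivially on basic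
functions: morphisms of graded manifolds over a smooth map `V → V'` that have bidegree `(0, 0)`,
are the identity on basic functions and commute with the homological vector fields. -/
structure VBHom (QD : VBStr V C QA) (QD' : VBStr V' C' QA) where
  base : C^∞⟮V.model, V.Total; V'.model, V'.Total⟯
  comap : FnD V' A C' →ₐ[ℝ] FnD V A C
  comap_ofFun : ∀ f, comap (Fn.ofFun V'.proj dgD (coframe A C') f) =
    Fn.ofFun V.proj dgD (coframe A C) (f.comp base)
  comap_part : ∀ i, ∀ s ∈ Fn.part V'.model V'.proj dgD (coframe A C') i,
    comap s ∈ Fn.part V.model V.proj dgD (coframe A C) i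
  comap_bideg : ∀ a b, ∀ s ∈ Bideg V' A C' a b, comap s ∈ Bideg V A C a b
  comap_pull : ∀ α, comap (pull V' A C' α) = pull V A C α
  comm : ∀ s, comap (QD'.op s) = QD.op (comap s)

/-- The representation up to homotopy `D` on `E = V[0] ⊕ C₁[1] ⊕ ⋯ ⊕ Cₙ[n]` is the one given by the
VB-Lie `n`-algebroid structure `QD`: the dual differential `D^*` on `E^*`, determined by
`QA⟨ψ, η⟩ = ⟨D^* ψ, η⟩ + (-1) ^ |ψ| ⟨ψ, D η⟩`, is the restriction of `QD` to linear functions. -/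
def IsAssociated (QD : VBStr V C QA) (D : Rep totDeg (tot V C) QA) : Prop :=
  ∀ p, ∀ ψ ∈ Mod.part A (fun k => - totDeg k) (fun k => (tot V C k).dual) p,
    ∃ χ, QD.op (lin V A C ψ) = lin V A C χ ∧
      ∀ η, QA.op (pair ψ η) = pair χ η + (-1 : ℝ) ^ p • pair ψ (D.op η)

/-- The morphism `μ : E → E'` corresponds to the morphism `G`: the restriction of `G^⋆` to linear
functions is the dual `μ^⋆`, that is, `G^⋆ ℓ_ψ = ℓ_{μ^⋆ ψ}` with `⟨μ^⋆ ψ, η⟩ = ⟨ψ, μ η⟩`. -/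
def Corresponds {QD : VBStr V C QA} {QD' : VBStr V' C' QA} {D : Rep totDeg (tot V C) QA}
    {D' : Rep totDeg (tot V' C') QA} (G : VBHom QD QD') (μ : RepHom D D') : Prop :=
  ∀ ψ, ∃ χ, G.comap (lin V' A C' ψ) = lin V A C χ ∧ ∀ η, pair χ η = pair ψ (μ.map η)

end Decomposed
end VBLie

end

/-! Everything is governed by the linear functions. The map `lin` identifies Γ(S(A^*)) ⊗ Γ(E^*) with
the linear functions of D → A, and it is injective (`lin_injective`): setting the core generators to
zero recovers the V^*-component, and the first-order part in the core (`theta`) recovers the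
C_j^*-components. On the other side, the pairing of E^* with E is nondegenerate already on sections
(`eq_of_pair_left`, `eq_of_pair_right`).

Representations. The restriction of Q_D to linear functions is an A-representation S on E^*, because
Q_D restricts to Q_A on basic functions (`exists_rep_dual`). The duality relation can be solved for
⟨β, D η⟩ with β a section of E^*; the solution is tensorial in β, so it prescribes the coefficients
of D η (`exists_dual_rep`). Nondegeneracy gives uniqueness.

From G to μ. The functions of bidegree (1, p - 1) are linear functions of degree p
(`exists_lin_of_bideg`): local expressions on V glue because the fibres of V are connected. Hence
G^⋆ restricts to a Γ(S(A^*))-linear map ν of dual modules, and μ is its predual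
(`exists_predual_map`). Commutation of G^⋆ with the vector fields becomes commutation of μ with D
and D'.

From μ to G. Let ν be the dual of μ (`exists_dual_map`). For a section ψ of V'^*, the function
ν(ℓ_ψ) has degree 0, so it is a function on V; these functions define the side map V → V'. The
images under ν of the sections of C'_i^*, with the generators from A_i^* kept fixed, define
homomorphisms of the fibre algebras (`fibHom`), which assemble to G^⋆ (`fnHom`). The defect of G^⋆
with respect to the two vector fields is a derivation along G^⋆ and vanishes on basic and linear
functions. It vanishes on C^∞(V') as well: at each point it is a point derivation, determined by
coordinates through Hadamard's lemma (`pointDerivation_eq_zero`), and coordinates of V' are built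
from basic functions and the ℓ_ψ (`VB.exists_coordinate`). Then `comm_of_generators` applies.
Finally G is determined by its linear part, since acting trivially on basic functions forces the
side map to cover the identity of M (`VBHom.eq_of_lin`). -/

noncomputable section

namespace VBLie

/-! ### Complements on the graded symmetric algebra -/

namespace GSym

variable {κ : Type*} {deg : κ → ℕ} {W : κ → Type*}
  [∀ k, AddCommGroup (W k)] [∀ k, Module ℝ (W k)]

lemma induction {P : GSym deg W → Prop} (algebraMap : ∀ r : ℝ, P (algebraMap ℝ _ r))
    (gen : ∀ k v, P (gen deg W k v)) (add : ∀ x y, P x → P y → P (x + y))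
    (mul : ∀ x y, P x → P y → P (x * y)) (x : GSym deg W) : P x := by
  obtain ⟨y, rfl⟩ := RingQuot.mkAlgHom_surjective ℝ (GSym.Rel deg W) x
  induction y using FreeAlgebra.induction with
  | grade0 r =>
    rw [AlgHom.commutes]
    exact algebraMap r
  | grade1 s => exact gen s.1 s.2
  | mul a b ha hb => rw [map_mul]; exact mul _ _ ha hb
  | add a b ha hb => rw [map_add]; exact add _ _ ha hb

lemma algHom_ext {B : Type*} [Semiring B] [Algebra ℝ B] {φ χ : GSym deg W →ₐ[ℝ] B}
    (h : ∀ k v, φ (gen deg W k v) = χ (gen deg W k v)) : φ = χ := by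
  ext x
  induction x using induction with
  | algebraMap r => simp
  | gen k v => exact h k v
  | add x y h1 h2 => simp [h1, h2]
  | mul x y h1 h2 => simp [h1, h2]

lemma part_induction {i : ℕ} {P : ∀ x, x ∈ part deg W i → Prop}
    (mon : ∀ (l : List (Σ k, W k)) (hl : (l.map fun s => deg s.1).sum = i),
      P (l.map fun s => gen deg W s.1 s.2).prod (Submodule.subset_span ⟨l, hl, rfl⟩))
    (zero : P 0 (zero_mem _)) (add : ∀ x y hx hy, P x hx → P y hy → P (x + y) (add_mem hx hy))
    (smul : ∀ (r : ℝ) x hx, P x hx → P (r • x) (Submodule.smul_mem _ r hx))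
    {x : GSym deg W} (hx : x ∈ part deg W i) : P x hx := by
  induction hx using Submodule.span_induction with
  | mem x hx => obtain ⟨l, hl, rfl⟩ := hx; exact mon l hl
  | zero => exact zero
  | add x y _ _ h1 h2 => exact add x y _ _ h1 h2
  | smul r x _ h => exact smul r x _ h

lemma parity_apply_gen (k : κ) (v : W k) :
    parity deg W (gen deg W k v) = (-1 : ℝ) ^ deg k • gen deg W k v := by
  simp [parity]

lemma parity_of_mem_part {i : ℕ} {x : GSym deg W} (hx : x ∈ part deg W i) :
    parity deg W x = (-1 : ℝ) ^ i • x := by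
  induction hx using part_induction with
  | mon l hl =>
    subst hl
    induction l with
    | nil => simp
    | cons s l ih =>
      simp only [List.map_cons, List.prod_cons, map_mul, ih, List.sum_cons, pow_add,
        parity_apply_gen, smul_mul_smul_comm]
  | zero => simp
  | add x y _ _ h1 h2 => simp [h1, h2]
  | smul r x _ h => rw [map_smul, h, smul_comm]

lemma parity_pow_of_mem_part (a : ℕ) {i : ℕ} {x : GSym deg W} (hx : x ∈ part deg W i) :
    (parity deg W ^ a) x = (-1 : ℝ) ^ (a * i) • x := by
  induction a with
  | zero => simp
  | succ a ih =>
    rw [pow_succ', AlgHom.mul_apply, ih, map_smul, parity_of_mem_part hx, smul_smul]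
    congr 1; ring

lemma parity_parity (x : GSym deg W) : parity deg W (parity deg W x) = x := by
  have : (parity deg W).comp (parity deg W) = AlgHom.id ℝ _ := by
    refine algHom_ext fun k v => ?_
    simp [parity_apply_gen, smul_smul, ← pow_add, Even.neg_one_pow ⟨deg k, rfl⟩]
  exact DFunLike.congr_fun this x

lemma parity_pow_parity_pow (a : ℕ) (x : GSym deg W) :
    (parity deg W ^ a) ((parity deg W ^ a) x) = x := by
  induction a generalizing x with
  | zero => simp
  | succ a ih =>
    rw [pow_succ', AlgHom.mul_apply, AlgHom.mul_apply, ← AlgHom.mul_apply (_ ^ a),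
      ← pow_succ, pow_succ', AlgHom.mul_apply, ih, parity_parity]

/-- Induction on words, twice: a single generator moves through a word letter by letter, collecting
one sign per letter, and then a word moves one letter at a time. -/
lemma mul_comm_of_mem_part {i j : ℕ} {x y : GSym deg W} (hx : x ∈ part deg W i)
    (hy : y ∈ part deg W j) : x * y = (-1 : ℝ) ^ (i * j) • (y * x) := by
  have key : ∀ (k : κ) (v : W k) {j : ℕ} {y : GSym deg W}, y ∈ part deg W j →
      gen deg W k v * y = (-1 : ℝ) ^ (deg k * j) • (y * gen deg W k v) := by
    intro k v j y hy
    induction hy using part_induction with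
    | mon l hl =>
      subst hl
      induction l with
      | nil => simp
      | cons s l ih =>
        simp only [List.map_cons, List.prod_cons, List.sum_cons]
        rw [← mul_assoc, gen_mul_gen, smul_mul_assoc, mul_assoc, ih, mul_smul_comm, smul_smul,
          ← mul_assoc, mul_add, pow_add]
    | zero => simp
    | add x y _ _ h1 h2 => rw [mul_add, h1, h2, add_mul, smul_add]
    | smul r x _ h => rw [mul_smul_comm, h, smul_mul_assoc, smul_comm]
  induction hx using part_induction with
  | mon l hl =>
    subst hl
    induction l with
    | nil => simp
    | cons s l ih =>
      simp only [List.map_cons, List.prod_cons, List.sum_cons]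
      rw [mul_assoc, ih, mul_smul_comm, ← mul_assoc, key s.1 s.2 hy, smul_mul_assoc, smul_smul,
        mul_assoc, ← pow_add]
      congr 2; ring
  | zero => simp
  | add x y _ _ h1 h2 => rw [mul_add, add_mul, h1, h2, smul_add]
  | smul r x _ h => rw [mul_smul_comm, smul_mul_assoc, h, smul_comm]

/-- Elements of degree `i` commute with all others up to the `i`-th power of the parity. -/
lemma mul_comm_parity {i : ℕ} {x : GSym deg W} (hx : x ∈ part deg W i) (y : GSym deg W) :
    x * y = (parity deg W ^ i) y * x := by
  induction y using induction generalizing i x with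
  | algebraMap r => rw [AlgHom.commutes, Algebra.commutes]
  | gen k v =>
    rw [mul_comm_of_mem_part hx (gen_mem_part deg W k v),
      parity_pow_of_mem_part i (gen_mem_part deg W k v), smul_mul_assoc]
  | add y z h1 h2 => rw [mul_add, map_add, add_mul, h1 hx, h2 hx]
  | mul y z h1 h2 => rw [map_mul, ← mul_assoc, h1 hx, mul_assoc, h2 hx, mul_assoc]

variable (deg W) in
/-- The homogeneous parts, indexed by the integers. -/
def partZ : ℤ → Submodule ℝ (GSym deg W)
  | .ofNat i => part deg W i
  | .negSucc _ => ⊥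

@[simp] lemma partZ_natCast (i : ℕ) : partZ deg W (i : ℤ) = part deg W i := rfl

lemma mem_partZ_of_eq {i : ℕ} {p : ℤ} (h : (i : ℤ) = p) {x : GSym deg W}
    (hx : x ∈ part deg W i) : x ∈ partZ deg W p := by
  subst h; exact hx

/-- Negative degrees contain only `0`. The coefficients of an element of degree `p` have degree `p -
e k`, which may be negative, so degrees are kept in `ℤ` instead of being truncated. -/
lemma partZ_induction {p : ℤ} {P : ∀ x, x ∈ partZ deg W p → Prop} (zero : P 0 (zero_mem _))
    (nat : ∀ (i : ℕ) (hi : (i : ℤ) = p), ∀ x (hx : x ∈ part deg W i), P x (mem_partZ_of_eq hi hx))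
    {x : GSym deg W} (hx : x ∈ partZ deg W p) : P x hx := by
  cases p with
  | ofNat i => exact nat i rfl x hx
  | negSucc i =>
    obtain rfl := (Submodule.mem_bot ℝ).1 hx
    exact zero

lemma partZ_mul {p q : ℤ} {x y : GSym deg W} (hx : x ∈ partZ deg W p)
    (hy : y ∈ partZ deg W q) : x * y ∈ partZ deg W (p + q) := by
  induction hx using partZ_induction with
  | zero => simp
  | nat i hi x hx =>
    induction hy using partZ_induction with
    | zero => simp
    | nat j hj y hy => exact mem_partZ_of_eq (by push_cast; omega) (part_mul hx hy)

lemma parity_pow_mem_partZ (a : ℕ) {p : ℤ} {x : GSym deg W} (hx : x ∈ partZ deg W p) :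
    (parity deg W ^ a) x ∈ partZ deg W p := by
  induction hx using partZ_induction with
  | zero => simp
  | nat i hi x hx => exact mem_partZ_of_eq hi (parity_pow_mem_part _ _ _ hx)

/-- The augmentation, which maps the generators to `0`. -/
def aug : GSym deg W →ₐ[ℝ] ℝ := lift deg W (fun _ => 0) (by simp)

@[simp] lemma aug_gen (k : κ) (v : W k) : aug (gen deg W k v) = 0 := by simp [aug]

/-- All generators have positive degree, so the empty word is the only word of degree `0`. This
turns a degree-`0` function on D into an ordinary function on V. -/
lemma eq_aug_of_mem_part_zero (hdeg : ∀ k, deg k ≠ 0) {x : GSym deg W}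
    (hx : x ∈ part deg W 0) : x = algebraMap ℝ _ (aug x) := by
  induction hx using part_induction with
  | mon l hl =>
    cases l with
    | nil => simp
    | cons s l => simp [hdeg s.1] at hl
  | zero => simp
  | add x y _ _ h1 h2 => rw [map_add, map_add, ← h1, ← h2]
  | smul r x _ h =>
    rw [map_smul, smul_eq_mul, map_mul, ← h, Algebra.smul_def]

end GSym
/-! ### Bump functions, local frames -/

section Bump

variable {EN HN : Type*} [NormedAddCommGroup EN] [NormedSpace ℝ EN] [FiniteDimensional ℝ EN]
  [TopologicalSpace HN] (J : ModelWithCorners ℝ EN HN) {N : Type*} [TopologicalSpace N]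
  [ChartedSpace HN N] [IsManifold J ∞ N] [T2Space N]

lemma exists_bump {c : N} {s : Set N} (hs : s ∈ 𝓝 c) :
    ∃ ρ : C^∞⟮J, N; 𝓘(ℝ, ℝ), ℝ⟯, (∀ᶠ x in 𝓝 c, ρ x = 1) ∧ tsupport ρ ⊆ s := by
  obtain ⟨f, -, hf⟩ := (SmoothBumpFunction.nhds_basis_tsupport (I := J) c).mem_iff.1 hs
  exact ⟨⟨f, f.contMDiff⟩, f.eventuallyEq_one, hf⟩

-- Multiplication by a cut-off supported in `s` extends `f` by zero, and the germ at `c` is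
-- unchanged because the cut-off is `1` on a neighbourhood.
variable {J} in
lemma exists_smooth_eventuallyEq {c : N} {s : Set N} (hs : IsOpen s) (hc : c ∈ s) {f : N → ℝ}
    (hf : ContMDiffOn J 𝓘(ℝ, ℝ) ∞ f s) :
    ∃ g : C^∞⟮J, N; 𝓘(ℝ, ℝ), ℝ⟯, ∀ᶠ x in 𝓝 c, g x = f x := by
  obtain ⟨ρ, h1, h2⟩ := exists_bump J (hs.mem_nhds hc)
  refine ⟨⟨fun x => ρ x * f x, contMDiff_of_tsupport fun x hx => ?_⟩, ?_⟩
  · have hx' : x ∈ s := h2 (tsupport_mul_subset_left hx)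
    exact ρ.contMDiff.contMDiffAt.mul (hf.contMDiffAt (hs.mem_nhds hx'))
  · filter_upwards [h1] with x hx
    simp [hx]

variable {J} in
lemma exists_section_eventuallyEq {F : Type*} [NormedAddCommGroup F] [NormedSpace ℝ F]
    {E : N → Type*} [TopologicalSpace (Bundle.TotalSpace F E)] [∀ x, AddCommGroup (E x)]
    [∀ x, Module ℝ (E x)] [∀ x, TopologicalSpace (E x)] [FiberBundle F E] [VectorBundle ℝ F E]
    {c : N} {s : Set N} (hs : IsOpen s) (hc : c ∈ s)
    {f : ∀ x, E x} (hf : ContMDiffOn J (J.prod 𝓘(ℝ, F)) ∞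
      (fun x => Bundle.TotalSpace.mk' F x (f x)) s) :
    ∃ g : ContMDiffSection J F ∞ E, ∀ᶠ x in 𝓝 c, g x = f x := by
  obtain ⟨ρ, h1, h2⟩ := exists_bump J (hs.mem_nhds hc)
  refine ⟨⟨fun x => ρ x • f x,
    ContMDiffOn.smul_section_of_tsupport ρ.contMDiff.contMDiffOn hs h2 hf⟩, ?_⟩
  filter_upwards [h1] with x hx
  change ρ x • f x = f x
  simp [hx]

end Bump

namespace VB

variable {d : ℕ} {M : Type u} [TopologicalSpace M] [ChartedSpace (EuclideanSpace ℝ (Fin d)) M]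

/-- Points over different base points are separated in `M`; points over the same base point lie in
the source of one trivialization, which is injective into a Hausdorff space. Bump functions on the
sides V and V' depend on this. -/
instance [T2Space M] (B : VB d M) : T2Space B.Total := by
  refine ⟨fun x y hxy => ?_⟩
  by_cases h : x.proj = y.proj
  · let e := trivializationAt B.F B.fiber x.proj
    have hx : x ∈ e.source := by
      rw [e.mem_source]; exact FiberBundle.mem_baseSet_trivializationAt' _
    have hy : y ∈ e.source := by
      rw [e.mem_source, ← h]; exact FiberBundle.mem_baseSet_trivializationAt' _
    obtain ⟨U, U', hU, hU', h1, h2, h3⟩ := t2_separation fun h' => hxy (e.injOn hx hy h')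
    exact ⟨_, _, e.continuousOn_toFun.isOpen_inter_preimage e.open_source hU,
      e.continuousOn_toFun.isOpen_inter_preimage e.open_source hU', ⟨hx, h1⟩, ⟨hy, h2⟩,
      Set.disjoint_left.2 fun z hz hz' => Set.disjoint_left.1 h3 hz.2 hz'.2⟩
  · exact separated_by_continuous (FiberBundle.continuous_proj B.F B.fiber) h

variable [IsManifold (𝓡 d) ∞ M] [T2Space M]

lemma exists_frame (B : VB d M) (m₀ : M) : ∃ (r : ℕ) (b : Fin r → B.Sec) (β : Fin r → B.dual.Sec),
    ∀ᶠ m in 𝓝 m₀, ∀ x : B.fiber m, x = ∑ j, B.ev m (β j m) x • b j m := by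
  let e := trivializationAt B.F B.fiber m₀
  let c := Module.finBasis ℝ B.F
  have hm₀ : m₀ ∈ e.baseSet := FiberBundle.mem_baseSet_trivializationAt' m₀
  have hb (j) := exists_section_eventuallyEq (J := 𝓡 d) e.open_baseSet hm₀
    (e.contMDiffOn_localFrame_baseSet (I := 𝓡 d) ∞ c j)
  let e' := trivializationAt B.dual.F B.dual.fiber m₀
  -- The trivialization of a bundle of homomorphisms lives over the intersection of two base sets;
  -- for the trivial line bundle the second one is everything.
  have he' : e'.baseSet = e.baseSet := by
    change e.baseSet ∩ Set.univ = _
    simp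
  -- The dual frame: coordinate functionals of the model fibre, transported by the trivialization.
  let β (j) : ∀ m, B.dual.fiber m := fun m =>
    ((c.coord j).toContinuousLinearMap.comp (e.continuousLinearMapAt ℝ m) : B.fiber m →L[ℝ] ℝ)
  have hβ' (j) : ContMDiffOn (𝓡 d) B.dual.model ∞
      (fun m => Bundle.TotalSpace.mk' B.dual.F m (β j m)) e'.baseSet := by
    rw [e'.contMDiffOn_section_baseSet_iff]
    let c' : B.dual.F := ((c.coord j).toContinuousLinearMap : B.F →L[ℝ] ℝ)
    refine (contMDiffOn_const (c := c')).congr ?_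
    intro m hm
    rw [he'] at hm
    refine ContinuousLinearMap.ext (M₁ := B.F) (M₂ := ℝ) fun y => ?_
    change (trivializationAt ℝ (Bundle.Trivial M ℝ) m₀).continuousLinearMapAt ℝ m
      (c.coord j (e.continuousLinearMapAt ℝ m (e.symmL ℝ m y))) = _
    rw [e.continuousLinearMapAt_symmL hm]
    exact DFunLike.congr_fun (Bundle.Trivial.continuousLinearMapAt_trivialization ℝ M ℝ m) _
  have hβ (j) := exists_section_eventuallyEq (J := 𝓡 d) e'.open_baseSet (by rwa [he']) (hβ' j)
  choose b hb using hb
  choose β' hβ using hβ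
  refine ⟨_, b, β', ?_⟩
  filter_upwards [Filter.eventually_all.2 hb, Filter.eventually_all.2 hβ,
    e.open_baseSet.mem_nhds hm₀] with m h1 h2 hm x
  have h3 : ∀ j, B.ev m (β' j m) x = (e.basisAt c hm).repr x j := by
    intro j
    rw [h2]
    change c.repr (e.continuousLinearMapAt ℝ m x) j = c.repr (e.linearEquivAt ℝ m hm x) j
    rw [Bundle.Trivialization.continuousLinearMapAt_apply_of_mem ℝ e hm]
    rfl
  conv_lhs => rw [← (e.basisAt c hm).sum_repr x]
  refine Finset.sum_congr rfl fun j _ => ?_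
  rw [h3, h1, e.localFrame_apply_of_mem_baseSet c hm]

end VB

/-! ### Hadamard's lemma -/

section Hadamard

/-- Induction on the order: differentiation under the integral sign produces an integral of the same
kind, with a smooth integrand. -/
lemma contDiff_integral {Y : Type*} [NormedAddCommGroup Y] [NormedSpace ℝ Y]
    [FiniteDimensional ℝ Y] (n : ℕ) {G : Y × ℝ → ℝ} (hG : ContDiff ℝ ∞ G) :
    ContDiff ℝ n (fun y => ∫ t in (0 : ℝ)..1, G (y, t)) := by
  induction n generalizing G with
  | zero =>
    rw [Nat.cast_zero, contDiff_zero]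
    exact intervalIntegral.continuous_parametric_intervalIntegral_of_continuous'
      (f := fun y t => G (y, t)) hG.continuous 0 1
  | succ n ih =>
    have hd : ContDiff ℝ ∞ (fderiv ℝ G) := hG.fderiv_right (by simp)
    have hc : Continuous fun z : Y × ℝ => (fderiv ℝ G z).comp (ContinuousLinearMap.inl ℝ Y ℝ) :=
      hd.continuous.clm_comp continuous_const
    have key : ∀ y, HasFDerivAt (fun y => ∫ t in (0 : ℝ)..1, G (y, t))
        (∫ t in (0 : ℝ)..1, (fderiv ℝ G (y, t)).comp (ContinuousLinearMap.inl ℝ Y ℝ)) y := by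
      intro y
      -- The partial derivative is bounded on the compact set `closedBall y 1 × [0, 1]`; this bound
      -- is the dominating constant.
      obtain ⟨C, hC⟩ := ((isCompact_closedBall y 1).prod (isCompact_Icc (a := (0 : ℝ)) (b := 1))
        ).exists_bound_of_continuousOn hc.continuousOn
      refine intervalIntegral.hasFDerivAt_integral_of_dominated_of_fderiv_le
        (F := fun y t => G (y, t)) (bound := fun _ => C)
        (F' := fun y t => (fderiv ℝ G (y, t)).comp (ContinuousLinearMap.inl ℝ Y ℝ))
        (Metric.ball_mem_nhds y one_pos) ?_ ?_ ?_ ?_ ?_ ?_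
      · exact Filter.Eventually.of_forall fun y' =>
          (hG.continuous.comp (by fun_prop : Continuous fun t : ℝ => (y', t))).aestronglyMeasurable
      · exact (hG.continuous.comp
          (by fun_prop : Continuous fun t : ℝ => (y, t))).intervalIntegrable _ _
      · exact (hc.comp (by fun_prop : Continuous fun t : ℝ => (y, t))).aestronglyMeasurable
      · refine Filter.Eventually.of_forall fun t ht y' hy' => hC (y', t) ⟨?_, ?_⟩
        · exact Metric.ball_subset_closedBall hy'
        · rw [Set.uIoc_of_le zero_le_one] at ht
          exact Set.Ioc_subset_Icc_self ht
      · exact intervalIntegrable_const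
      · refine Filter.Eventually.of_forall fun t _ y' _ => ?_
        have h1 : HasFDerivAt G (fderiv ℝ G (y', t)) (y', t) :=
          (hG.differentiable (by simp) _).hasFDerivAt
        have h2 : HasFDerivAt (fun y : Y => (y, t)) (ContinuousLinearMap.inl ℝ Y ℝ) y' :=
          hasFDerivAt_prodMk_left y' t
        exact h1.comp y' h2
    -- Passing to directional derivatives keeps the integrand real-valued, so the induction
    -- hypothesis applies.
    rw [Nat.cast_add, Nat.cast_one, contDiff_succ_iff_fderiv_apply]
    refine ⟨fun y => (key y).differentiableAt, by simp, fun y => ?_⟩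
    have h3 : (fun x => fderiv ℝ (fun y => ∫ t in (0 : ℝ)..1, G (y, t)) x y) =
        fun x => ∫ t in (0 : ℝ)..1, fderiv ℝ G (x, t) (y, 0) := by
      funext x
      rw [(key x).fderiv, ContinuousLinearMap.intervalIntegral_apply]
      · rfl
      · exact (hc.comp (by fun_prop : Continuous fun t : ℝ => (x, t))).intervalIntegrable _ _
    rw [h3]
    exact ih (G := fun z => fderiv ℝ G z (y, 0)) (hd.clm_apply contDiff_const)

/-- The fundamental theorem of calculus along the segment from `y₀` to `y`: `g i` is the integral
over the segment of the derivative in the direction `c i`. -/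
lemma exists_hadamard {Y : Type*} [NormedAddCommGroup Y] [NormedSpace ℝ Y]
    {ι : Type*} [Fintype ι] (c : Module.Basis ι ℝ Y) {f : Y → ℝ} (hf : ContDiff ℝ ∞ f) (y₀ : Y) :
    ∃ g : ι → Y → ℝ, (∀ i, ContDiff ℝ ∞ (g i)) ∧
      ∀ y, f y = f y₀ + ∑ i, c.coord i (y - y₀) * g i y := by
  have : FiniteDimensional ℝ Y := Module.Basis.finiteDimensional_of_finite c
  have hd : ContDiff ℝ ∞ (fderiv ℝ f) := hf.fderiv_right (by simp)
  refine ⟨fun i y => ∫ t in (0 : ℝ)..1, fderiv ℝ f (y₀ + t • (y - y₀)) (c i), fun i => ?_,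
    fun y => ?_⟩
  · refine contDiff_infty.2 fun n => contDiff_integral n
      (G := fun z : Y × ℝ => fderiv ℝ f (y₀ + z.2 • (z.1 - y₀)) (c i)) ?_
    exact (hd.comp (by fun_prop : ContDiff ℝ ∞ fun z : Y × ℝ => y₀ + z.2 • (z.1 - y₀))).clm_apply
      contDiff_const
  · have hcont : ∀ v, Continuous fun t : ℝ => fderiv ℝ f (y₀ + t • (y - y₀)) v := fun v =>
      (hd.continuous.comp (by fun_prop)).clm_apply continuous_const
    have h1 : ∀ t : ℝ, HasDerivAt (fun t : ℝ => f (y₀ + t • (y - y₀)))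
        (fderiv ℝ f (y₀ + t • (y - y₀)) (y - y₀)) t := fun t => by
      have h2 : HasDerivAt (fun t : ℝ => y₀ + t • (y - y₀)) ((1 : ℝ) • (y - y₀)) t :=
        ((hasDerivAt_id t).smul_const (y - y₀)).const_add y₀
      rw [one_smul] at h2
      exact (hf.differentiable (by simp) _).hasFDerivAt.comp_hasDerivAt t h2
    have h3 := intervalIntegral.integral_eq_sub_of_hasDerivAt (a := 0) (b := 1)
      (fun t _ => h1 t) ((hcont _).intervalIntegrable _ _)
    simp only [one_smul, zero_smul, add_zero, add_sub_cancel] at h3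
    rw [← sub_eq_iff_eq_add', ← h3]
    simp_rw [← intervalIntegral.integral_const_mul]
    rw [← intervalIntegral.integral_finsetSum]
    · congr 1
      funext t
      generalize fderiv ℝ f (y₀ + t • (y - y₀)) = L
      conv_lhs => rw [← c.sum_repr (y - y₀)]
      simp
    · exact fun i _ => ((hcont _).const_mul _).intervalIntegrable _ _

variable {EN HN : Type*} [NormedAddCommGroup EN] [NormedSpace ℝ EN] [FiniteDimensional ℝ EN]
  [TopologicalSpace HN] {J : ModelWithCorners ℝ EN HN} [J.Boundaryless]
  {N : Type*} [TopologicalSpace N] [ChartedSpace HN N] [IsManifold J ∞ N] [T2Space N]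

/-- The segment used in `exists_hadamard` may leave the target of the chart. The function in the
chart is therefore first replaced by a function on the whole model space with the same germ, and the
resulting identity holds near `x₀` only. -/
lemma exists_hadamard_manifold {ι : Type*} [Fintype ι] (c : Module.Basis ι ℝ EN)
    (f : C^∞⟮J, N; 𝓘(ℝ, ℝ), ℝ⟯) (x₀ : N) : ∃ g : ι → C^∞⟮J, N; 𝓘(ℝ, ℝ), ℝ⟯,
      ∀ᶠ x in 𝓝 x₀, f x =
        f x₀ + ∑ i, c.coord i (extChartAt J x₀ x - extChartAt J x₀ x₀) * g i x := by
  have ht : IsOpen (extChartAt J x₀).target := isOpen_extChartAt_target x₀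
  have h1 : ContMDiffOn 𝓘(ℝ, EN) 𝓘(ℝ, ℝ) ∞ (f ∘ (extChartAt J x₀).symm)
      (extChartAt J x₀).target :=
    f.contMDiff.comp_contMDiffOn (contMDiffOn_extChartAt_symm x₀)
  obtain ⟨F, hF⟩ := exists_smooth_eventuallyEq (J := 𝓘(ℝ, EN)) ht (mem_extChartAt_target x₀) h1
  obtain ⟨g, hg, h2⟩ := exists_hadamard c F.contMDiff.contDiff (extChartAt J x₀ x₀)
  have h3 (i) : ∃ g' : C^∞⟮J, N; 𝓘(ℝ, ℝ), ℝ⟯, ∀ᶠ x in 𝓝 x₀, g' x = g i (extChartAt J x₀ x) :=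
    exists_smooth_eventuallyEq (J := J) (chartAt HN x₀).open_source (mem_chart_source HN x₀)
      ((hg i).contMDiff.comp_contMDiffOn contMDiffOn_extChartAt)
  choose g' hg' using h3
  refine ⟨g', ?_⟩
  have h4 : ∀ᶠ x in 𝓝 x₀, F (extChartAt J x₀ x) = f x := by
    filter_upwards [(continuousAt_extChartAt x₀).eventually hF, extChartAt_source_mem_nhds (I := J) x₀]
      with x hx hx'
    rw [hx, Function.comp_apply, (extChartAt J x₀).left_inv hx']
  filter_upwards [h4, Filter.eventually_all.2 hg'] with x hx hx'
  rw [← hx, h2, ← h4.self_of_nhds]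
  simp only [hx']

end Hadamard
/-! ### Integer degrees of functions -/

section HomogZ

variable {d : ℕ} {M : Type u} [TopologicalSpace M] [ChartedSpace (EuclideanSpace ℝ (Fin d)) M]
  {EN HN : Type*} [NormedAddCommGroup EN] [NormedSpace ℝ EN] [TopologicalSpace HN]
  (J : ModelWithCorners ℝ EN HN) {N : Type u} [TopologicalSpace N] [ChartedSpace HN N]
  (q : N → M) {κ : Type} (deg : κ → ℕ) (W : κ → VB d M)

/-- Smooth sections of the bundle of graded symmetric algebras of a degree in `ℤ`. -/
def HomogZ (p : ℤ) : Submodule ℝ (Raw q deg W) where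
  carrier := {s | s ∈ Smooth J q deg W ∧
    ∀ x, s x ∈ GSym.partZ deg (fun k => (W k).fiber (q x)) p}
  add_mem' := fun ha hb => ⟨add_mem ha.1 hb.1, fun x => add_mem (ha.2 x) (hb.2 x)⟩
  zero_mem' := ⟨zero_mem _, fun _ => zero_mem _⟩
  smul_mem' := fun r _ ha =>
    ⟨Subalgebra.smul_mem _ ha.1 r, fun x => Submodule.smul_mem _ r (ha.2 x)⟩

variable {J q deg W}

lemma homogZ_cases {p : ℤ} {s : Raw q deg W} (hs : s ∈ HomogZ J q deg W p) :
    s = 0 ∨ ∃ i : ℕ, (i : ℤ) = p ∧ s ∈ Homog J q deg W i := by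
  cases p with
  | ofNat i => exact Or.inr ⟨i, rfl, hs⟩
  | negSucc i => exact Or.inl (funext fun x => (Submodule.mem_bot ℝ).1 (hs.2 x))

lemma mem_homogZ_of_eq {i : ℕ} {p : ℤ} (h : (i : ℤ) = p) {s : Raw q deg W}
    (hs : s ∈ Homog J q deg W i) : s ∈ HomogZ J q deg W p := by
  subst h; exact hs

lemma mem_Fn_of_homogZ {p : ℤ} {s : Raw q deg W} (hs : s ∈ HomogZ J q deg W p) :
    s ∈ Fn J q deg W := by
  rcases homogZ_cases hs with rfl | ⟨i, -, h⟩
  · exact zero_mem _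
  · exact mem_Fn_of_homog h

lemma smooth_of_mem_Fn {s : Raw q deg W} (hs : s ∈ Fn J q deg W) : s ∈ Smooth J q deg W :=
  Algebra.adjoin_le (S := Smooth J q deg W) (by rintro _ ⟨_, hi⟩; exact hi.1) hs

lemma poly_le_Fn {s : Raw q deg W} (hs : s ∈ Poly J q deg W) : s ∈ Fn J q deg W := by
  refine Algebra.adjoin_le (S := Fn J q deg W) ?_ hs
  rintro _ (⟨f, hf, rfl⟩ | ⟨k, a, rfl⟩)
  · exact mem_Fn_of_homog (ofFun_mem_homog hf)
  · exact mem_Fn_of_homog (ofSec_mem_homog k a)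

lemma Fn_induction {P : Fn J q deg W → Prop}
    (homog : ∀ i, ∀ s ∈ Fn.part J q deg W i, P s) (zero : P 0)
    (add : ∀ s t, P s → P t → P (s + t)) (smul : ∀ (r : ℝ) s, P s → P (r • s))
    (s : Fn J q deg W) : P s := by
  obtain ⟨s, hs⟩ := s
  suffices ∃ h, P ⟨s, h⟩ from this.2
  have h := mem_span_of_mem_Fn hs
  clear hs
  induction h using Submodule.span_induction with
  | mem x hx =>
    obtain ⟨i, hi⟩ := hx
    exact ⟨mem_Fn_of_homog hi, homog i _ hi⟩
  | zero => exact ⟨zero_mem _, zero⟩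
  | add x y _ _ h1 h2 => exact ⟨add_mem h1.1 h2.1, add _ _ h1.2 h2.2⟩
  | smul r x _ h => exact ⟨Subalgebra.smul_mem _ h.1 r, smul r _ h.2⟩

end HomogZ

/-! ### Vector bundles in duality -/

namespace VB

variable {d : ℕ} {M : Type u} [TopologicalSpace M] [ChartedSpace (EuclideanSpace ℝ (Fin d)) M]

/-- A smooth pairing of two vector bundles with dual local frames. -/
structure DualPair (W W' : VB d M) where
  p : ∀ m, W'.fiber m →ₗ[ℝ] W.fiber m →ₗ[ℝ] ℝ
  smooth : ∀ (w' : W'.Sec) (w : W.Sec), ContMDiff (𝓡 d) 𝓘(ℝ, ℝ) ∞ (fun m => p m (w' m) (w m))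
  frame : ∀ m₀, ∃ (r : ℕ) (w : Fin r → W.Sec) (w' : Fin r → W'.Sec), ∀ᶠ m in 𝓝 m₀,
    (∀ x, x = ∑ j, p m (w' j m) x • w j m) ∧ (∀ y, y = ∑ j, p m y (w j m) • w' j m)

/-- The product of a section with a smooth function. -/
def fmul (W : VB d M) (f : C^∞⟮𝓡 d, M; 𝓘(ℝ, ℝ), ℝ⟯) (w : W.Sec) : W.Sec :=
  ⟨fun m => f m • w m, f.contMDiff.smul_section w.contMDiff⟩

lemma fmul_apply (W : VB d M) (f : C^∞⟮𝓡 d, M; 𝓘(ℝ, ℝ), ℝ⟯) (w : W.Sec) (m : M) :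
    W.fmul f w m = f m • w m := rfl

lemma sum_sec_apply (W : VB d M) {ι : Type*} (s : Finset ι) (w : ι → W.Sec) (m : M) :
    (∑ j ∈ s, w j) m = ∑ j ∈ s, w j m := by
  change ContMDiffSection.coeAddHom (𝓡 d) W.F ∞ W.fiber (∑ j ∈ s, w j) m = _
  rw [map_sum, Finset.sum_apply]
  rfl

namespace DualPair

variable {W W' : VB d M} (P : DualPair W W')

/-- The pairing with exchanged roles. -/
def flip : DualPair W' W where
  p m := (P.p m).flip
  smooth w w' := P.smooth w' w
  frame m₀ := by
    obtain ⟨r, w, w', h⟩ := P.frame m₀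
    exact ⟨r, w', w, h.mono fun m h => ⟨h.2, h.1⟩⟩

@[simp] lemma flip_p (m : M) : P.flip.p m = (P.p m).flip := rfl

/-- The rank of the chosen frame near `m`. -/
def rk (m : M) : ℕ := (P.frame m).choose

/-- The chosen frame near `m`. -/
def fr (m : M) : Fin (P.rk m) → W.Sec := (P.frame m).choose_spec.choose

/-- The chosen dual frame near `m`. -/
def cofr (m : M) : Fin (P.rk m) → W'.Sec := (P.frame m).choose_spec.choose_spec.choose

lemma eventually_frame (m₀ : M) : ∀ᶠ m in 𝓝 m₀,
    (∀ x, x = ∑ j, P.p m (P.cofr m₀ j m) x • P.fr m₀ j m) ∧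
      (∀ y, y = ∑ j, P.p m y (P.fr m₀ j m) • P.cofr m₀ j m) :=
  (P.frame m₀).choose_spec.choose_spec.choose_spec

lemma frame_eq (m : M) (x : W.fiber m) : x = ∑ j, P.p m (P.cofr m j m) x • P.fr m j m :=
  (P.eventually_frame m).self_of_nhds.1 x

include P in
lemma exists_section (m : M) (x : W.fiber m) : ∃ w : W.Sec, w m = x := by
  refine ⟨∑ j, P.p m (P.cofr m j m) x • P.fr m j, ?_⟩
  conv_rhs => rw [P.frame_eq m x]
  exact sum_sec_apply _ _ _ _

/-- A map on sections that is linear over the functions at `m` is determined by its values on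
the frame. -/
lemma apply_eq_sum [T2Space M] [IsManifold (𝓡 d) ∞ M] {Z : Type*} [AddCommGroup Z] [Module ℝ Z]
    (m : M) (T : W.Sec →ₗ[ℝ] Z) (hT : ∀ f w, T (W.fmul f w) = f m • T w)
    {ι : Type*} [Fintype ι] {b : ι → W.Sec} {b' : ι → W'.Sec}
    (hm : ∀ᶠ m' in 𝓝 m, ∀ x, x = ∑ j, P.p m' (b' j m') x • b j m') (w : W.Sec) :
    T w = ∑ j, P.p m (b' j m) (w m) • T (b j) := by
  -- The frame expansion of `w` as a global section: it agrees with `w` near `m`.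
  let w₁ : W.Sec := ∑ j, W.fmul ⟨_, P.smooth (b' j) w⟩ (b j)
  have h : ∀ᶠ m' in 𝓝 m, w m' = w₁ m' := by
    filter_upwards [hm] with m' hm'
    rw [hm' (w m'), sum_sec_apply]
    rfl
  obtain ⟨ρ, h1, h2⟩ := exists_bump (𝓡 d) h
  -- After the cut-off the two sections agree everywhere, and `T` sees only the value `ρ m = 1` of
  -- the cut-off.
  have h3 : W.fmul ρ w = W.fmul ρ w₁ := by
    ext m'
    by_cases hm' : m' ∈ tsupport ρ
    · rw [fmul_apply, fmul_apply, h2 hm']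
    · rw [fmul_apply, fmul_apply, image_eq_zero_of_notMem_tsupport hm', zero_smul, zero_smul]
  have h4 := congrArg T h3
  rw [hT, hT, h1.self_of_nhds, one_smul, one_smul] at h4
  rw [h4, map_sum]
  exact Finset.sum_congr rfl fun j _ => hT _ _

end DualPair

variable [T2Space M] [IsManifold (𝓡 d) ∞ M]

/-- The duality of a vector bundle and its dual bundle. -/
def dp (B : VB d M) : DualPair B B.dual where
  p := B.ev
  smooth := B.contMDiff_ev
  frame m₀ := by
    obtain ⟨r, b, β, h⟩ := B.exists_frame m₀
    refine ⟨r, b, β, h.mono fun m h => ⟨h, fun ψ => ?_⟩⟩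
    refine ContinuousLinearMap.ext (M₁ := B.fiber m) (M₂ := ℝ) fun x => ?_
    change B.ev m ψ x = B.ev m (∑ j, B.ev m ψ (b j m) • β j m) x
    conv_lhs => rw [h x]
    simp [mul_comm]

end VB

/-! ### Sections of tensor products -/

section Contraction

variable {d : ℕ} {M : Type u} [TopologicalSpace M] [ChartedSpace (EuclideanSpace ℝ (Fin d)) M]
  {n : ℕ} (A : Fin n → VB d M)

/-- The functions of degree `p ∈ ℤ` on `A`. -/
abbrev HomogA (p : ℤ) : Submodule ℝ (Raw (fun m : M => m) dg (fun i => (A i).dual)) :=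
  HomogZ (𝓡 d) (fun m : M => m) dg (fun i => (A i).dual) p

/-- Smooth functions on `M` as functions on `A`. -/
abbrev cf (f : C^∞⟮𝓡 d, M; 𝓘(ℝ, ℝ), ℝ⟯) : FnA A :=
  Fn.ofFun (fun m : M => m) dg (fun i => (A i).dual) f

lemma cf_mem (f : C^∞⟮𝓡 d, M; 𝓘(ℝ, ℝ), ℝ⟯) :
    cf A f ∈ Fn.part (𝓡 d) (fun m : M => m) dg (fun i => (A i).dual) 0 :=
  ofFun_mem_homog f.contMDiff

variable {A}

lemma cf_smul_apply {κ : Type} {B : κ → VB d M} (f : C^∞⟮𝓡 d, M; 𝓘(ℝ, ℝ), ℝ⟯)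
    (η : RawMod A B) (m : M) (k : κ) : (cf A f • η) m k = f m • η m k := by
  rw [fn_smul_apply]
  exact algebraMap_smul (SA A m) (f m) (η m k)

/-- Contraction of `S(A^*) ⊗ W` with an element of `W'`. -/
def ct {W W' : VB d M} (P : VB.DualPair W W') (m : M) (y : W'.fiber m) :
    SA A m ⊗[ℝ] W.fiber m →ₗ[ℝ] SA A m :=
  (TensorProduct.rid ℝ (SA A m)).toLinearMap ∘ₗ (P.p m y).lTensor (SA A m)

section

variable {W W' : VB d M} (P : VB.DualPair W W')

@[simp] lemma ct_tmul (m : M) (y : W'.fiber m) (ξ : SA A m) (x : W.fiber m) :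
    ct P m y (ξ ⊗ₜ x) = P.p m y x • ξ := by
  simp [ct]

lemma ct_sum_left {ι : Type*} (s : Finset ι) (m : M) (c : ι → ℝ) (y : ι → W'.fiber m)
    (x : SA A m ⊗[ℝ] W.fiber m) :
    ct P m (∑ j ∈ s, c j • y j) x = ∑ j ∈ s, c j • ct P m (y j) x := by
  induction x using TensorProduct.induction_on with
  | zero => simp
  | add x x' h h' => simp only [map_add, h, h', smul_add, Finset.sum_add_distrib]
  | tmul ζ b => simp [Finset.sum_smul, mul_smul]

lemma eq_sum_ct {ι : Type*} [Fintype ι] {m : M} {w : ι → W.fiber m} {w' : ι → W'.fiber m}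
    (h : ∀ x, x = ∑ j, P.p m (w' j) x • w j) (x : SA A m ⊗[ℝ] W.fiber m) :
    x = ∑ j, ct P m (w' j) x ⊗ₜ w j := by
  induction x using TensorProduct.induction_on with
  | zero => simp
  | add x x' h h' =>
    simp only [map_add, TensorProduct.add_tmul, Finset.sum_add_distrib]
    rw [← h, ← h']
  | tmul ζ b =>
    simp only [ct_tmul, TensorProduct.smul_tmul, ← TensorProduct.tmul_sum]
    rw [← h]

include P in
lemma eq_of_ct_eq {m : M} {x x' : SA A m ⊗[ℝ] W.fiber m}
    (h : ∀ y, ct P m y x = ct P m y x') : x = x' := by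
  rw [eq_sum_ct P (P.frame_eq m) x, eq_sum_ct P (P.frame_eq m) x']
  simp only [h]

end

variable {κ : Type} {e : κ → ℤ} {B B' : κ → VB d M} (P : ∀ k, VB.DualPair (B k) (B' k))

/-- The coefficient of an element of the module with respect to a section of the dual bundle. -/
def coef (k : κ) (w' : (B' k).Sec) :
    RawMod A B →ₗ[ℝ] Raw (fun m : M => m) dg (fun i => (A i).dual) where
  toFun η m := ct (P k) m (w' m) (η m k)
  map_add' _ _ := by funext m; simp
  map_smul' _ _ := by funext m; simp

lemma coef_apply (k : κ) (w' : (B' k).Sec) (η : RawMod A B) (m : M) :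
    coef P k w' η m = ct (P k) m (w' m) (η m k) := rfl

lemma ct_partMod {p : ℤ} {m : M} {k : κ} {x : SA A m ⊗[ℝ] (B k).fiber m}
    (hx : x ∈ partMod A e B p m k) (y : (B' k).fiber m) :
    ct (P k) m y x ∈ GSym.partZ dg (fun i => (A i).dual.fiber m) (p - e k) := by
  induction hx using Submodule.span_induction with
  | mem x hx =>
    obtain ⟨i, ξ, b, hξ, hi, rfl⟩ := hx
    rw [ct_tmul]
    exact Submodule.smul_mem _ _ (GSym.mem_partZ_of_eq (by omega) hξ)
  | zero => simp
  | add x y _ _ h1 h2 => rw [map_add]; exact add_mem h1 h2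
  | smul r x _ h => rw [map_smul]; exact Submodule.smul_mem _ r h

lemma tmul_mem_partMod {p : ℤ} {m : M} {k : κ} {ξ : SA A m}
    (hξ : ξ ∈ GSym.partZ dg (fun i => (A i).dual.fiber m) (p - e k)) (b : (B k).fiber m) :
    ξ ⊗ₜ b ∈ partMod A e B p m k := by
  induction hξ using GSym.partZ_induction with
  | zero => simp
  | nat i hi x hx => exact Submodule.subset_span ⟨i, x, b, hx, by omega, rfl⟩

lemma coef_smooth {η : RawMod A B} (hη : η ∈ SmoothMod A B) (k : κ) (w' : (B' k).Sec) :
    coef P k w' η ∈ Smooth (𝓡 d) (fun m : M => m) dg (fun i => (A i).dual) := by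
  intro m₀
  obtain ⟨u, hu, h⟩ := hη k m₀
  refine ⟨fun m => ct (P k) m (w' m) (u m), ?_, h.mono fun m hm => by rw [coef_apply, hm]⟩
  clear h
  induction hu using Submodule.span_induction with
  | mem x hx =>
    obtain ⟨t, ht, b, rfl⟩ := hx
    have h : (Raw.ofFun dg (fun m => (P k).p m (w' m) (b m)) :
        Raw (fun m : M => m) dg (fun i => (A i).dual)) ∈
        Poly (𝓡 d) (fun m : M => m) dg (fun i => (A i).dual) :=
      Algebra.subset_adjoin (Or.inl ⟨_, (P k).smooth w' b, rfl⟩)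
    convert mul_mem h ht using 1
    funext m
    simp only [ct_tmul, Pi.mul_apply, Raw.ofFun, Algebra.smul_def]
  | zero =>
    convert zero_mem (Poly (𝓡 d) (fun m : M => m) dg (fun i => (A i).dual)) using 1
    funext m; simp
  | add x y _ _ h1 h2 =>
    convert add_mem h1 h2 using 1
    funext m; simp
  | smul r x _ h =>
    convert Subalgebra.smul_mem _ h r using 1
    funext m; simp

lemma coef_homog {p : ℤ} {η : RawMod A B} (hη : η ∈ HomogMod A e B p) (k : κ)
    (w' : (B' k).Sec) : coef P k w' η ∈ HomogA A (p - e k) :=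
  ⟨coef_smooth P hη.1 k w', fun m => ct_partMod P (hη.2 m k) _⟩

/-- Near `m₀` the family is the sum over a frame of coefficients tensored with frame sections, so
smoothness can be tested on coefficients. -/
lemma mem_smoothMod_of_coef {η : RawMod A B}
    (h : ∀ k w', coef P k w' η ∈ Smooth (𝓡 d) (fun m : M => m) dg (fun i => (A i).dual)) :
    η ∈ SmoothMod A B := by
  intro k m₀
  choose t ht h' using fun j => h k ((P k).cofr m₀ j) m₀
  refine ⟨∑ j, fun m => t j m ⊗ₜ (P k).fr m₀ j m,
    sum_mem fun j _ => Submodule.subset_span ⟨t j, ht j, _, rfl⟩, ?_⟩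
  filter_upwards [(P k).eventually_frame m₀, Filter.eventually_all.2 h'] with m h1 h2
  rw [eq_sum_ct (P k) h1.1 (η m k), Finset.sum_apply]
  exact Finset.sum_congr rfl fun j _ => by rw [← h2]; rfl

lemma mem_homogMod_of_coef {p : ℤ} {η : RawMod A B}
    (h : ∀ k w', coef P k w' η ∈ HomogA A (p - e k)) : η ∈ HomogMod A e B p := by
  refine ⟨mem_smoothMod_of_coef P fun k w' => (h k w').1, fun m k => ?_⟩
  rw [eq_sum_ct (P k) ((P k).frame_eq m) (η m k)]
  exact sum_mem fun j _ => tmul_mem_partMod ((h k _).2 m) _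

-- Every vector of the dual fibre is the value of a smooth section, so contractions with sections
-- separate elements.
include P in
lemma eq_of_coef_eq {η η' : RawMod A B} (h : ∀ k w', coef P k w' η = coef P k w' η') :
    η = η' := by
  funext m k
  refine eq_of_ct_eq (P k) fun y => ?_
  obtain ⟨w', rfl⟩ := (P k).flip.exists_section m y
  exact congrFun (h k w') m

lemma mem_smoothMod_of_mem_Mod {η : RawMod A B} (hη : η ∈ Mod A e B) : η ∈ SmoothMod A B :=
  Submodule.span_le (p := SmoothMod A B).2 (by rintro _ ⟨_, hp⟩; exact hp.1)
    (mem_span_of_mem_Mod hη)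

lemma mem_Mod_of_homog {p : ℤ} {η : RawMod A B} (hη : η ∈ HomogMod A e B p) : η ∈ Mod A e B :=
  Submodule.subset_span ⟨p, hη⟩

lemma Mod_induction {P : Mod A e B → Prop}
    (homog : ∀ p, ∀ η ∈ Mod.part A e B p, P η) (zero : P 0)
    (add : ∀ η η', P η → P η' → P (η + η')) (smul : ∀ (r : ℝ) η, P η → P (r • η))
    (η : Mod A e B) : P η := by
  obtain ⟨η, hη⟩ := η
  suffices ∃ h, P ⟨η, h⟩ from this.2
  have h := mem_span_of_mem_Mod hη
  clear hη
  induction h using Submodule.span_induction with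
  | mem x hx =>
    obtain ⟨i, hi⟩ := hx
    exact ⟨mem_Mod_of_homog hi, homog i _ hi⟩
  | zero => exact ⟨zero_mem _, zero⟩
  | add x y _ _ h1 h2 => exact ⟨add_mem h1.1 h2.1, add _ _ h1.2 h2.2⟩
  | smul r x _ h =>
    exact ⟨((Mod A e B).restrictScalars ℝ).smul_mem r h.1, smul r _ h.2⟩

end Contraction
/-! ### Sections as elements of the module, locality -/

section Locality

variable {d : ℕ} {M : Type u} [TopologicalSpace M] [ChartedSpace (EuclideanSpace ℝ (Fin d)) M]
  {n : ℕ} (A : Fin n → VB d M) {κ : Type} [DecidableEq κ] (e : κ → ℤ) (B : κ → VB d M)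

lemma single_mem_homogMod (k : κ) (b : (B k).Sec) :
    (fun m => Pi.single k (1 ⊗ₜ b m) : RawMod A B) ∈ HomogMod A e B (e k) := by
  refine ⟨fun k' m₀ => ?_, fun m k' => ?_⟩
  · by_cases h : k' = k
    · subst h
      exact ⟨fun m => (1 : SA A m) ⊗ₜ b m, Submodule.subset_span ⟨1, one_mem _, b, rfl⟩, by simp⟩
    · exact ⟨0, zero_mem _, by simp [h]⟩
  · by_cases h : k' = k
    · subst h
      change (Pi.single k' (1 ⊗ₜ b m) : ∀ k, SA A m ⊗[ℝ] (B k).fiber m) k' ∈ _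
      rw [Pi.single_eq_same]
      exact Submodule.subset_span ⟨0, 1, b m, GSym.one_mem_part _ _, by simp, rfl⟩
    · change (Pi.single k (1 ⊗ₜ b m) : ∀ k, SA A m ⊗[ℝ] (B k).fiber m) k' ∈ _
      rw [Pi.single_eq_of_ne h]
      exact zero_mem _

variable {A B e} in
/-- The value of an element of the module at a point. -/
def Mod.at (m : M) (k : κ) : Mod A e B →ₗ[ℝ] SA A m ⊗[ℝ] (B k).fiber m where
  toFun η := η.1 m k
  map_add' _ _ := rfl
  map_smul' _ _ := rfl

variable {A B e} in
lemma Mod.at_smul (m : M) (k : κ) (f : FnA A) (η : Mod A e B) :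
    Mod.at m k (f • η) = f.1 m • Mod.at m k η := rfl

/-- Sections of the summands as elements of the module. -/
def sec (k : κ) : (B k).Sec →ₗ[ℝ] Mod A e B where
  toFun b := ⟨fun m => Pi.single k (1 ⊗ₜ b m), mem_Mod_of_homog (single_mem_homogMod A e B k b)⟩
  map_add' b b' := by
    refine Subtype.ext (funext fun m => ?_)
    refine Eq.trans ?_ (Pi.single_add (f := fun k => SA A m ⊗[ℝ] (B k).fiber m) k _ _)
    rw [← TensorProduct.tmul_add]
    rfl
  map_smul' r b := by
    refine Subtype.ext (funext fun m => ?_)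
    refine Eq.trans ?_ (Pi.single_smul (f := fun k => SA A m ⊗[ℝ] (B k).fiber m) k r _)
    rw [← TensorProduct.tmul_smul]
    rfl

variable {A B}

lemma sec_apply (k : κ) (b : (B k).Sec) (m : M) :
    (sec A e B k b).1 m = Pi.single k (1 ⊗ₜ b m) := rfl

variable {e} in
lemma Mod.at_sec_same (k : κ) (b : (B k).Sec) (m : M) :
    Mod.at m k (sec A e B k b) = 1 ⊗ₜ b m :=
  Pi.single_eq_same (M := fun k => SA A m ⊗[ℝ] (B k).fiber m) _ _

variable {e} in
lemma Mod.at_sec_of_ne {k k' : κ} (h : k' ≠ k) (b : (B k).Sec) (m : M) :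
    Mod.at m k' (sec A e B k b) = 0 :=
  Pi.single_eq_of_ne (M := fun k => SA A m ⊗[ℝ] (B k).fiber m) h _

lemma sec_mem (k : κ) (b : (B k).Sec) : sec A e B k b ∈ Mod.part A e B (e k) :=
  single_mem_homogMod A e B k b

lemma sec_fmul (k : κ) (f : C^∞⟮𝓡 d, M; 𝓘(ℝ, ℝ), ℝ⟯) (b : (B k).Sec) :
    sec A e B k ((B k).fmul f b) = cf A f • sec A e B k b := by
  refine Subtype.ext (funext₂ fun m k' => ?_)
  refine Eq.trans ?_ (cf_smul_apply f _ m k').symm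
  rw [sec_apply, sec_apply, VB.fmul_apply, TensorProduct.tmul_smul, Pi.single_smul, Pi.smul_apply]

variable {e}

lemma smul_mem_part {i : ℕ} {p q : ℤ} {f : FnA A} {η : Mod A e B}
    (hf : f ∈ Fn.part (𝓡 d) (fun m : M => m) dg (fun i => (A i).dual) i)
    (hη : η ∈ Mod.part A e B p) (h : i + p = q) : f • η ∈ Mod.part A e B q := by
  subst h
  exact smul_homogMod hf hη

variable [T2Space M] [IsManifold (𝓡 d) ∞ M] {Z : Type*} [AddCommGroup Z] [Module ℝ Z]

/-- A cut-off supported where the two elements agree makes them equal, and its value `1` at `m₀`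
makes it invisible to `T`. -/
lemma apply_congr {m₀ : M} {T : Mod A e B →ₗ[ℝ] Z} (hT : ∀ f η, T (cf A f • η) = f m₀ • T η)
    {η η' : Mod A e B} (h : ∀ᶠ m in 𝓝 m₀, η.1 m = η'.1 m) : T η = T η' := by
  obtain ⟨ρ, h1, h2⟩ := exists_bump (𝓡 d) h
  have h3 : cf A ρ • η = cf A ρ • η' := by
    refine Subtype.ext (funext₂ fun m k => ?_)
    refine (cf_smul_apply ρ η.1 m k).trans (Eq.trans ?_ (cf_smul_apply ρ η'.1 m k).symm)
    by_cases hm' : m ∈ tsupport ρ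
    · rw [h2 hm']
    · rw [image_eq_zero_of_notMem_tsupport hm', zero_smul, zero_smul]
  have h4 := congrArg T h3
  rwa [hT, hT, h1.self_of_nhds, one_smul, one_smul] at h4

variable [Fintype κ]

/-- A map on the module that is linear over the functions at a point vanishes on the elements of
degree `p` if it does so on multiples of sections. -/
lemma ext_part {m₀ : M} {T : Mod A e B →ₗ[ℝ] Z} (hT : ∀ f η, T (cf A f • η) = f m₀ • T η) {p : ℤ}
    (h : ∀ k b i, ∀ f ∈ Fn.part (𝓡 d) (fun m : M => m) dg (fun i => (A i).dual) i,
      (i : ℤ) + e k = p → T (f • sec A e B k b) = 0) {η : Mod A e B}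
    (hη : η ∈ Mod.part A e B p) : T η = 0 := by
  let P := fun k => (B k).dp
  -- The frame sections and these coefficients are global objects, so the expansion of `η` is an
  -- element of the module with the same germ at `m₀`.
  let c : ∀ k, Fin ((P k).rk m₀) → FnA A := fun k j =>
    ⟨coef P k ((P k).cofr m₀ j) η.1, mem_Fn_of_homogZ (coef_homog P hη k _)⟩
  have h1 : T η = T (∑ k, ∑ j, c k j • sec A e B k ((P k).fr m₀ j)) := by
    refine apply_congr hT ?_
    have h2 := Filter.eventually_all.2 fun k => (P k).eventually_frame m₀
    filter_upwards [h2] with m hm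
    funext k
    rw [eq_sum_ct (P k) (hm k).1 (η.1 m k)]
    change _ = Mod.at m k (∑ k, ∑ j, c k j • sec A e B k ((P k).fr m₀ j))
    rw [map_sum, Finset.sum_eq_single k]
    · rw [map_sum]
      refine Finset.sum_congr rfl fun j _ => ?_
      rw [Mod.at_smul, Mod.at_sec_same, TensorProduct.smul_tmul', smul_eq_mul, mul_one]
      rfl
    · intro k' _ hk'
      rw [map_sum]
      refine Finset.sum_eq_zero fun j _ => ?_
      rw [Mod.at_smul, Mod.at_sec_of_ne hk'.symm, smul_zero]
    · simp
  rw [h1, map_sum]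
  refine Finset.sum_eq_zero fun k _ => ?_
  rw [map_sum]
  refine Finset.sum_eq_zero fun j _ => ?_
  -- A coefficient of negative degree is zero; any other has a natural degree `i` with `i + e k =
  -- p`, as the hypothesis requires.
  rcases homogZ_cases (coef_homog P hη k ((P k).cofr m₀ j)) with h3 | ⟨i, hi, h3⟩
  · have : c k j = 0 := Subtype.ext h3
    rw [this, zero_smul, map_zero]
  · exact h k _ i (c k j) h3 (by omega)

lemma ext_mod {m₀ : M} {T : Mod A e B →ₗ[ℝ] Z} (hT : ∀ f η, T (cf A f • η) = f m₀ • T η)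
    (h : ∀ k b i, ∀ f ∈ Fn.part (𝓡 d) (fun m : M => m) dg (fun i => (A i).dual) i,
      T (f • sec A e B k b) = 0) (η : Mod A e B) : T η = 0 := by
  induction η using Mod_induction with
  | homog p η hη => exact ext_part hT (fun k b i f hf _ => h k b i f hf) hη
  | zero => exact map_zero T
  | add η η' h1 h2 => rw [map_add, h1, h2, add_zero]
  | smul r η h => rw [map_smul, h, smul_zero]

end Locality

/-! ### Elements of the module given by their coefficients -/

section Representation

variable {d : ℕ} {M : Type u} [TopologicalSpace M] [ChartedSpace (EuclideanSpace ℝ (Fin d)) M]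
  {n : ℕ} {A : Fin n → VB d M} {κ : Type} {B B' : κ → VB d M}
  (P : ∀ k, VB.DualPair (B k) (B' k))

/-- The family with prescribed coefficients. -/
def ofCoef (L : ∀ k, (B' k).Sec → Raw (fun m : M => m) dg (fun i => (A i).dual)) : RawMod A B :=
  fun m k => ∑ j, L k ((P k).cofr m j) m ⊗ₜ (P k).fr m j m

/-- `ofCoef` uses at `m` the frame chosen for `m`, with no compatibility between different points.
Tensoriality of `L` makes the result independent of these choices. -/
lemma coef_ofCoef [T2Space M] [IsManifold (𝓡 d) ∞ M]
    (L : ∀ k, (B' k).Sec →ₗ[ℝ] Raw (fun m : M => m) dg (fun i => (A i).dual))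
    (hL : ∀ k f w m, L k ((B' k).fmul f w) m = f m • L k w m) (k : κ) (w' : (B' k).Sec) :
    coef P k w' (ofCoef P fun k => L k) = L k w' := by
  funext m
  have h := (P k).flip.apply_eq_sum m ((LinearMap.proj m).comp (L k)) (fun f w => hL k f w m)
    (((P k).eventually_frame m).mono fun _ h => h.2) w'
  rw [LinearMap.comp_apply, LinearMap.proj_apply] at h
  rw [h, coef_apply, ofCoef, map_sum]
  simp

/-! ### Pairing with sections; nondegeneracy -/

section Pairing

variable [T2Space M] [IsManifold (𝓡 d) ∞ M] [DecidableEq κ] [Fintype κ] {e : κ → ℤ}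

lemma pair_sec_right (ψ : DualMod A e B) (k : κ) (b : (B k).Sec) :
    (pair ψ (sec A e B k b)).1 = coef (fun k => (B k).dp.flip) k b ψ.1 := by
  funext m
  change ∑ k', pairFib A e B m k' (ψ.1 m k') (Mod.at m k' (sec A e B k b)) = _
  rw [Finset.sum_eq_single k]
  · rw [Mod.at_sec_same, coef_apply]
    induction ψ.1 m k using TensorProduct.induction_on with
    | zero => simp
    | add x x' h h' => rw [map_add, LinearMap.add_apply, h, h', map_add]
    | tmul ξ β =>
      rw [pairFib_tmul, map_one, mul_one]
      exact (ct_tmul (B k).dp.flip m (b m) ξ β).symm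
  · intro k' _ hk'
    rw [Mod.at_sec_of_ne hk', map_zero]
  · simp

/-- The sign `(-1) ^ (|ψ| |ζ|)` of the pairing, with `ψ` of degree `- e k`, becomes a power of the
parity applied to the coefficient. On the other side, in `pair_sec_right`, the section contributes a
factor of degree `0` in S(A^*) and there is no sign. -/
lemma pair_sec_left (k : κ) (β : (B k).dual.Sec) (η : Mod A e B) (m : M) :
    (pair (sec A (fun k => - e k) (fun k => (B k).dual) k β) η).1 m =
      (GSym.parity dg (fun i => (A i).dual.fiber m) ^ (e k).natAbs)
        (coef (fun k => (B k).dp) k β η.1 m) := by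
  change ∑ k', pairFib A e B m k' (Mod.at m k' (sec A (fun k => - e k)
    (fun k => (B k).dual) k β)) (η.1 m k') = _
  rw [Finset.sum_eq_single k]
  · rw [Mod.at_sec_same, coef_apply]
    induction η.1 m k using TensorProduct.induction_on with
    | zero => simp
    | add x x' h h' => rw [map_add, h, h', map_add, map_add]
    | tmul ξ b =>
      rw [pairFib_tmul, one_mul, ct_tmul, map_smul]
      rfl
  · intro k' _ hk'
    rw [Mod.at_sec_of_ne hk', map_zero, LinearMap.zero_apply]
  · simp

lemma eq_of_pair_right {ψ ψ' : DualMod A e B}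
    (h : ∀ k b, pair ψ (sec A e B k b) = pair ψ' (sec A e B k b)) : ψ = ψ' := by
  refine Subtype.ext (eq_of_coef_eq (fun k => (B k).dp.flip) fun k b => ?_)
  rw [← pair_sec_right, ← pair_sec_right, h]

/-- Pairings with sections are the coefficients up to a power of the parity, which is its own
inverse. -/
lemma eq_of_pair_left {η η' : Mod A e B}
    (h : ∀ k β, pair (sec A (fun k => - e k) (fun k => (B k).dual) k β) η =
      pair (sec A (fun k => - e k) (fun k => (B k).dual) k β) η') : η = η' := by
  refine Subtype.ext (eq_of_coef_eq (fun k => (B k).dp) fun k β => funext fun m => ?_)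
  have h1 := congrFun (congrArg Subtype.val (h k β)) m
  rw [pair_sec_left, pair_sec_left] at h1
  have h2 := congrArg (GSym.parity dg (fun i => (A i).dual.fiber m) ^ (e k).natAbs) h1
  rwa [GSym.parity_pow_parity_pow, GSym.parity_pow_parity_pow] at h2

end Pairing

end Representation
/-! ### The pairing -/

lemma GSym.parity_pow_congr {κ : Type*} {deg : κ → ℕ} {W : κ → Type*}
    [∀ k, AddCommGroup (W k)] [∀ k, Module ℝ (W k)] {a b : ℕ} (h : Even ((a : ℤ) + b)) :
    GSym.parity deg W ^ a = GSym.parity deg W ^ b := by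
  have h2 : GSym.parity deg W ^ 2 = 1 := by
    ext x
    rw [pow_two, AlgHom.mul_apply, GSym.parity_parity, AlgHom.one_apply]
  have h3 : a % 2 = b % 2 := by
    have : Even (a + b) := by exact_mod_cast h
    rw [Nat.even_iff] at this
    omega
  rw [pow_eq_pow_mod a h2, pow_eq_pow_mod b h2, h3]

lemma neg_one_zpow_natAbs (p : ℤ) : (-1 : ℝ) ^ p.natAbs = (-1 : ℝ) ^ p := by
  rcases Int.even_or_odd p with h | h
  · rw [(Int.natAbs_even.2 h).neg_one_pow, h.neg_one_zpow]
  · rw [(Int.natAbs_odd.2 h).neg_one_pow, h.neg_one_zpow]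

lemma neg_one_zpow_mul_self (p : ℤ) : (-1 : ℝ) ^ p * (-1 : ℝ) ^ p = 1 := by
  rw [← zpow_add₀ (by norm_num), Even.neg_one_zpow ⟨p, rfl⟩]

/-- The sign bookkeeping of `pair_leibniz` in isolation: `c` plays the role of `(-1) ^ |ψ|`, and `w`
that of the pairing of `ψ` with the operator applied to `ξ • η`. -/
lemma sign_calc {Z : Type*} [AddCommGroup Z] [Module ℝ Z] {c s t : ℝ} (hc : c * c = 1)
    {x y z w : Z} (h : s • (x + t • (y + c • z)) = (s * t) • y + c • w) :
    w = (s * c) • x + t • s • z := by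
  calc w = c • c • w := by rw [smul_smul, hc, one_smul]
    _ = c • (s • (x + t • (y + c • z)) - (s * t) • y) := by rw [h, add_sub_cancel_left]
    _ = (s * c) • x + (c * c) • t • s • z := by module
    _ = _ := by rw [hc, one_smul]

section PairingLemmas

variable {d : ℕ} {M : Type u} [TopologicalSpace M] [ChartedSpace (EuclideanSpace ℝ (Fin d)) M]
  {n : ℕ} {A : Fin n → VB d M} {κ : Type} {e : κ → ℤ} {B : κ → VB d M}

/-- Moving `f` to the front crosses `ξ`, of degree `i`, and the sign of the pairing contributes `|e
k|` more powers of the parity. Since `i - e k = p`, the total exponent has the parity of `p`. -/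
lemma pairFib_smul_right {p : ℤ} {m : M} {k : κ} {x : SA A m ⊗[ℝ] (B k).dual.fiber m}
    (hx : x ∈ partMod A (fun k => - e k) (fun k => (B k).dual) p m k) (f : SA A m)
    (y : SA A m ⊗[ℝ] (B k).fiber m) :
    pairFib A e B m k x (f • y) =
      (GSym.parity dg (fun i => (A i).dual.fiber m) ^ p.natAbs) f * pairFib A e B m k x y := by
  induction hx using Submodule.span_induction with
  | mem x hx =>
    obtain ⟨i, ξ, β, hξ, hi, rfl⟩ := hx
    induction y using TensorProduct.induction_on with
    | zero => simp
    | add y y' h h' => simp only [smul_add, map_add, h, h', mul_add]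
    | tmul ζ b =>
      rw [TensorProduct.smul_tmul', pairFib_tmul, pairFib_tmul, smul_eq_mul, map_mul, ← mul_assoc,
        GSym.mul_comm_parity hξ, ← AlgHom.mul_apply, ← pow_add, mul_smul_comm, mul_assoc]
      have h : GSym.parity dg (fun i => (A i).dual.fiber m) ^ (i + (e k).natAbs) =
          GSym.parity dg (fun i => (A i).dual.fiber m) ^ p.natAbs := by
        apply GSym.parity_pow_congr
        dsimp only at hi
        rw [Int.even_iff]
        omega
      rw [h]
  | zero => simp
  | add x x' _ _ h h' => simp only [map_add, LinearMap.add_apply, h, h', mul_add]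
  | smul r x _ h => simp only [map_smul, LinearMap.smul_apply, h, mul_smul_comm]

/-- In contrast to `pairFib_part`, integer degrees record that a pairing of negative total degree
vanishes. -/
lemma pairFib_partZ {p p' : ℤ} {m : M} {k : κ} {x : SA A m ⊗[ℝ] (B k).dual.fiber m}
    {y : SA A m ⊗[ℝ] (B k).fiber m}
    (hx : x ∈ partMod A (fun k => - e k) (fun k => (B k).dual) p m k)
    (hy : y ∈ partMod A e B p' m k) :
    pairFib A e B m k x y ∈ GSym.partZ dg (fun i => (A i).dual.fiber m) (p + p') := by
  induction hx, hy using Submodule.span_induction₂ with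
  | mem_mem x y hx hy =>
    obtain ⟨i, ξ, ψ, hξ, hi, rfl⟩ := hx
    obtain ⟨j, ζ, b, hζ, hj, rfl⟩ := hy
    dsimp only at hi
    rw [pairFib_tmul]
    exact Submodule.smul_mem _ _ (GSym.mem_partZ_of_eq (by push_cast; omega)
      (GSym.part_mul hξ (GSym.parity_pow_mem_part _ _ _ hζ)))
  | zero_left y hy => simp
  | zero_right x hx => simp
  | add_left x y z _ _ _ h1 h2 => simpa using add_mem h1 h2
  | add_right x y z _ _ _ h1 h2 => simpa using add_mem h1 h2
  | smul_left r x y _ _ h => simpa using Submodule.smul_mem _ r h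
  | smul_right r x y _ _ h => simpa using Submodule.smul_mem _ r h

/-- The parity of families. -/
def parRaw (A : Fin n → VB d M) (a : ℕ) : Raw (fun m : M => m) dg (fun i => (A i).dual) →ₗ[ℝ]
    Raw (fun m : M => m) dg (fun i => (A i).dual) where
  toFun s m := (GSym.parity dg (fun i => (A i).dual.fiber m) ^ a) (s m)
  map_add' _ _ := by funext m; simp
  map_smul' _ _ := by funext m; simp

lemma parRaw_apply (a : ℕ) (s : Raw (fun m : M => m) dg (fun i => (A i).dual)) (m : M) :
    parRaw A a s m = (GSym.parity dg (fun i => (A i).dual.fiber m) ^ a) (s m) := rfl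

lemma parRaw_homogA (a : ℕ) {p : ℤ} {s : Raw (fun m : M => m) dg (fun i => (A i).dual)}
    (hs : s ∈ HomogA A p) : parRaw A a s ∈ HomogA A p := by
  refine ⟨fun m₀ => ?_, fun m => GSym.parity_pow_mem_partZ a (hs.2 m)⟩
  obtain ⟨t, ht, h⟩ := hs.1 m₀
  exact ⟨_, parity_poly a ht, h.mono fun m hm => by rw [parRaw_apply, hm]⟩

lemma HomVF.op_homogA (QA : LieStr A) {p : ℤ} {s : FnA A} (hs : s.1 ∈ HomogA A p) :
    (QA.op s).1 ∈ HomogA A (p + 1) := by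
  rcases homogZ_cases hs with h | ⟨i, hi, h⟩
  · have : s = 0 := Subtype.ext h
    rw [this, map_zero]
    exact zero_mem _
  · exact mem_homogZ_of_eq (by push_cast; omega) (QA.map_deg i s h)

lemma HomVF.op_cf_mul (QA : LieStr A) (f : C^∞⟮𝓡 d, M; 𝓘(ℝ, ℝ), ℝ⟯) (s : FnA A) :
    QA.op (cf A f * s) = QA.op (cf A f) * s + cf A f * QA.op s := by
  simpa using QA.leibniz 0 (cf A f) (cf_mem A f) s

lemma Rep.op_cf_smul {QA : LieStr A} (D : Rep e B QA) (f : C^∞⟮𝓡 d, M; 𝓘(ℝ, ℝ), ℝ⟯)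
    (η : Mod A e B) : D.op (cf A f • η) = QA.op (cf A f) • η + cf A f • D.op η := by
  simpa using D.leibniz 0 (cf A f) (cf_mem A f) η

lemma cf_mul_apply (f : C^∞⟮𝓡 d, M; 𝓘(ℝ, ℝ), ℝ⟯) (s : FnA A) (m : M) :
    (cf A f * s).1 m = f m • s.1 m :=
  (Algebra.smul_def (f m) (s.1 m)).symm

variable [Fintype κ]

variable (A e B) in
/-- The pairing as a bilinear map. -/
def pairL : DualMod A e B →ₗ[ℝ] Mod A e B →ₗ[ℝ] FnA A :=
  LinearMap.mk₂ ℝ pair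
    (fun _ _ _ => Subtype.ext (LinearMap.map_add₂ (pairRaw A e B) _ _ _))
    (fun _ _ _ => Subtype.ext (LinearMap.map_smul₂ (pairRaw A e B) _ _ _))
    (fun _ _ _ => Subtype.ext (map_add (pairRaw A e B _) _ _))
    (fun _ _ _ => Subtype.ext (map_smul (pairRaw A e B _) _ _))

lemma pairL_apply (ψ : DualMod A e B) (η : Mod A e B) : pairL A e B ψ η = pair ψ η := rfl

lemma pair_add_left (ψ ψ' : DualMod A e B) (η : Mod A e B) :
    pair (ψ + ψ') η = pair ψ η + pair ψ' η := LinearMap.map_add₂ (pairL A e B) _ _ _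

lemma pair_add_right (ψ : DualMod A e B) (η η' : Mod A e B) :
    pair ψ (η + η') = pair ψ η + pair ψ η' := map_add (pairL A e B ψ) _ _

lemma pair_rsmul_left (r : ℝ) (ψ : DualMod A e B) (η : Mod A e B) :
    pair (r • ψ) η = r • pair ψ η := LinearMap.map_smul₂ (pairL A e B) _ _ _

lemma pair_rsmul_right (r : ℝ) (ψ : DualMod A e B) (η : Mod A e B) :
    pair ψ (r • η) = r • pair ψ η := map_smul (pairL A e B ψ) _ _

lemma pair_smul_left (f : FnA A) (ψ : DualMod A e B) (η : Mod A e B) :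
    pair (f • ψ) η = f * pair ψ η := by
  refine Subtype.ext (funext fun m => ?_)
  change ∑ k, pairFib A e B m k (f.1 m • ψ.1 m k) (η.1 m k) =
    f.1 m * ∑ k, pairFib A e B m k (ψ.1 m k) (η.1 m k)
  simp only [pairFib_smul, Finset.mul_sum]

lemma pair_smul_right_apply {p : ℤ} {ψ : DualMod A e B}
    (hψ : ψ ∈ Mod.part A (fun k => - e k) (fun k => (B k).dual) p) (f : FnA A) (η : Mod A e B)
    (m : M) : (pair ψ (f • η)).1 m = parRaw A p.natAbs f.1 m * (pair ψ η).1 m := by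
  change ∑ k, pairFib A e B m k (ψ.1 m k) (f.1 m • η.1 m k) =
    _ * ∑ k, pairFib A e B m k (ψ.1 m k) (η.1 m k)
  rw [Finset.mul_sum]
  exact Finset.sum_congr rfl fun k _ => pairFib_smul_right (hψ.2 m k) _ _

lemma pair_smul_right {p : ℤ} {ψ : DualMod A e B}
    (hψ : ψ ∈ Mod.part A (fun k => - e k) (fun k => (B k).dual) p) {i : ℕ} {f : FnA A}
    (hf : f ∈ Fn.part (𝓡 d) (fun m : M => m) dg (fun i => (A i).dual) i) (η : Mod A e B) :
    pair ψ (f • η) = (-1 : ℝ) ^ (p.natAbs * i) • (f * pair ψ η) := by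
  refine Subtype.ext (funext fun m => ?_)
  have h : (GSym.parity dg (fun i => (A i).dual.fiber m) ^ p.natAbs) (f.1 m) = _ :=
    GSym.parity_pow_of_mem_part _ (hf.2 m)
  rw [pair_smul_right_apply hψ, parRaw_apply, h, smul_mul_assoc]
  rfl

lemma pair_cf_smul_right (ψ : DualMod A e B) (f : C^∞⟮𝓡 d, M; 𝓘(ℝ, ℝ), ℝ⟯) (η : Mod A e B) :
    pair ψ (cf A f • η) = cf A f * pair ψ η := by
  induction ψ using Mod_induction with
  | homog p ψ hψ => simpa using pair_smul_right hψ (cf_mem A f) η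
  | zero => simp only [← pairL_apply, map_zero, LinearMap.zero_apply, mul_zero]
  | add ψ ψ' h h' =>
    simp only [← pairL_apply, map_add, LinearMap.add_apply] at h h' ⊢
    rw [h, h', mul_add]
  | smul r ψ h =>
    simp only [← pairL_apply, map_smul, LinearMap.smul_apply] at h ⊢
    rw [h, mul_smul_comm]

lemma pair_homogA {p p' : ℤ} {ψ : DualMod A e B} {η : Mod A e B}
    (hψ : ψ ∈ Mod.part A (fun k => - e k) (fun k => (B k).dual) p)
    (hη : η ∈ Mod.part A e B p') : (pair ψ η).1 ∈ HomogA A (p + p') :=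
  ⟨smooth_of_mem_Fn (pair ψ η).2, fun m => sum_mem fun k _ =>
    pairFib_partZ (hψ.2 m k) (hη.2 m k)⟩

/-- The defect of the duality relation is linear over functions up to sign: the two terms containing
`QA.op f`, one from each Leibniz rule, cancel. Here `η'` stands for the candidate value of the dual
operator at `η`. -/
lemma rep_defect_smul {QA : LieStr A} (S : Rep (fun k => - e k) (fun k => (B k).dual) QA)
    (η η' : Mod A e B) (p : ℤ) {i : ℕ} {f : FnA A}
    (hf : f ∈ Fn.part (𝓡 d) (fun m : M => m) dg (fun i => (A i).dual) i) (ψ : DualMod A e B) :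
    QA.op (pair (f • ψ) η) - pair (S.op (f • ψ)) η -
        (-1 : ℝ) ^ (i + p) • pair (f • ψ) η' =
      (-1 : ℝ) ^ i • (f * (QA.op (pair ψ η) - pair (S.op ψ) η - (-1 : ℝ) ^ p • pair ψ η')) := by
  rw [pair_smul_left, QA.leibniz i f hf, S.leibniz i f hf, pair_add_left,
    pair_smul_left, pair_rsmul_left, pair_smul_left, pair_smul_left, mul_sub, mul_sub,
    mul_smul_comm, zpow_add₀ (by norm_num), zpow_natCast, mul_smul, smul_sub, smul_sub]
  abel

end PairingLemmas

/-! ### Duals of representations and of morphisms -/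

section Duals

variable {d : ℕ} {M : Type u} [TopologicalSpace M] [ChartedSpace (EuclideanSpace ℝ (Fin d)) M]
  [T2Space M] [IsManifold (𝓡 d) ∞ M]
  {n : ℕ} {A : Fin n → VB d M} {κ : Type} [DecidableEq κ] [Fintype κ] {e : κ → ℤ} {B : κ → VB d M}

variable (A e) in
/-- Sections of the dual bundles as elements of the dual module. -/
abbrev dsec (k : κ) : (B k).dual.Sec →ₗ[ℝ] DualMod A e B :=
  sec A (fun k => - e k) (fun k => (B k).dual) k

omit [T2Space M] [IsManifold (𝓡 d) ∞ M] [Fintype κ] in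
lemma dsec_fmul (k : κ) (f : C^∞⟮𝓡 d, M; 𝓘(ℝ, ℝ), ℝ⟯) (β : (B k).dual.Sec) :
    dsec A e k ((B k).dual.fmul f β) = cf A f • dsec A e k β :=
  sec_fmul (B := fun k => (B k).dual) (fun k => - e k) k f β

omit [T2Space M] [IsManifold (𝓡 d) ∞ M] [Fintype κ] in
lemma dsec_mem (k : κ) (β : (B k).dual.Sec) :
    dsec A e k β ∈ Mod.part A (fun k => - e k) (fun k => (B k).dual) (- e k) :=
  sec_mem (B := fun k => (B k).dual) (fun k => - e k) k β

omit [DecidableEq κ] [Fintype κ] in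
/-- Homogeneous elements of the module are defined by their coefficients. -/
lemma exists_homogMod_of_coef {B' : κ → VB d M} (P : ∀ k, VB.DualPair (B k) (B' k)) {p : ℤ}
    (L : ∀ k, (B' k).Sec →ₗ[ℝ] Raw (fun m : M => m) dg (fun i => (A i).dual))
    (hL : ∀ k f w m, L k ((B' k).fmul f w) m = f m • L k w m)
    (hp : ∀ k w, L k w ∈ HomogA A (p - e k)) :
    ∃ η ∈ HomogMod A e B p, ∀ k w, coef P k w η = L k w := by
  have h := coef_ofCoef P L hL
  exact ⟨_, mem_homogMod_of_coef P fun k w => by rw [h]; exact hp k w, h⟩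

omit [DecidableEq κ] [Fintype κ] [T2Space M] [IsManifold (𝓡 d) ∞ M] in
/-- Linear maps into the module are defined by their coefficients. -/
lemma exists_map_of_coef {B' : κ → VB d M} (P : ∀ k, VB.DualPair (B k) (B' k))
    {X : Type*} [AddCommMonoid X] [Module ℝ X]
    (L : ∀ k, X →ₗ[ℝ] (B' k).Sec →ₗ[ℝ] Raw (fun m : M => m) dg (fun i => (A i).dual))
    (hX : ∀ x, ∃ η : Mod A e B, ∀ k w, coef P k w η.1 = L k x w) :
    ∃ T : X →ₗ[ℝ] Mod A e B, ∀ x k w, coef P k w (T x).1 = L k x w := by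
  choose T h using hX
  refine ⟨{ toFun := T
            map_add' := fun x y => ?_
            map_smul' := fun r x => ?_ }, h⟩
  · refine Subtype.ext (eq_of_coef_eq P fun k w => ?_)
    rw [h]
    refine Eq.trans ?_ (map_add (coef P k w) _ _).symm
    rw [h, h, map_add]
    rfl
  · refine Subtype.ext (eq_of_coef_eq P fun k w => ?_)
    rw [h]
    refine Eq.trans ?_ (map_smul (coef P k w) r _).symm
    rw [h, map_smul]
    rfl

omit [DecidableEq κ] [Fintype κ] [T2Space M] [IsManifold (𝓡 d) ∞ M] in
/-- Linear maps between modules are defined by their coefficients on homogeneous elements. -/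
lemma exists_map_of_coef_homog {B' : κ → VB d M} (P : ∀ k, VB.DualPair (B k) (B' k))
    {κ' : Type} {e' : κ' → ℤ} {B₁ : κ' → VB d M}
    (L : ∀ k, Mod A e' B₁ →ₗ[ℝ] (B' k).Sec →ₗ[ℝ]
      Raw (fun m : M => m) dg (fun i => (A i).dual))
    (hX : ∀ p, ∀ x ∈ Mod.part A e' B₁ p, ∃ η : Mod A e B, ∀ k w, coef P k w η.1 = L k x w) :
    ∃ T : Mod A e' B₁ →ₗ[ℝ] Mod A e B, ∀ x k w, coef P k w (T x).1 = L k x w := by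
  refine exists_map_of_coef P L fun x => ?_
  induction x using Mod_induction with
  | homog p x hx => exact hX p x hx
  | zero => exact ⟨0, fun k w => by
      rw [map_zero]
      exact map_zero (coef P k w)⟩
  | add x y hx hy =>
    obtain ⟨η, h⟩ := hx
    obtain ⟨η', h'⟩ := hy
    refine ⟨η + η', fun k w => ?_⟩
    rw [map_add, LinearMap.add_apply, ← h, ← h']
    exact map_add (coef P k w) _ _
  | smul r x hx =>
    obtain ⟨η, h⟩ := hx
    refine ⟨r • η, fun k w => ?_⟩
    rw [map_smul, LinearMap.smul_apply, ← h]
    exact map_smul (coef P k w) r _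

/-- Translates a prescribed pairing with a section into a prescribed coefficient, the parity being
an involution. -/
lemma pair_dsec_eq_iff {η : Mod A e B} {k : κ} {β : (B k).dual.Sec} {s : FnA A} :
    pair (dsec A e k β) η = s ↔
      coef (fun k => (B k).dp) k β η.1 = parRaw A (e k).natAbs s.1 := by
  rw [Subtype.ext_iff, funext_iff, funext_iff]
  refine forall_congr' fun m => ?_
  rw [pair_sec_left, parRaw_apply]
  constructor
  · intro h; rw [← h, GSym.parity_pow_parity_pow]
  · intro h; rw [h, GSym.parity_pow_parity_pow]

/-- By `rep_defect_smul` the defect of the duality relation is tensorial in `ψ`, so it vanishes on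
all homogeneous `ψ` once it vanishes on sections. -/
lemma pair_eq_of_dsec {QA : LieStr A} (S : Rep (fun k => - e k) (fun k => (B k).dual) QA)
    (T : Mod A e B →ₗ[ℝ] Mod A e B)
    (hsec : ∀ k β η, pair (dsec A e k β) (T η) = (-1 : ℝ) ^ (-e k) •
      (QA.op (pair (dsec A e k β) η) - pair (S.op (dsec A e k β)) η)) (p : ℤ)
    (ψ : DualMod A e B) (hψ : ψ ∈ Mod.part A (fun k => - e k) (fun k => (B k).dual) p)
    (η : Mod A e B) :
    QA.op (pair ψ η) = pair (S.op ψ) η + (-1 : ℝ) ^ p • pair ψ (T η) := by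
  -- The sign in the relation depends on the degree of `ψ`, so there is one linear defect map for
  -- each degree; multiplication by `f` of degree `i` relates `U p` to `U (i + p)`.
  let U : ℤ → DualMod A e B →ₗ[ℝ] FnA A := fun p =>
    { toFun := fun ψ => QA.op (pair ψ η) - pair (S.op ψ) η - (-1 : ℝ) ^ p • pair ψ (T η)
      map_add' := fun ψ ψ' => by
        simp only [pair_add_left, map_add, smul_add]
        abel
      map_smul' := fun r ψ => by
        simp only [pair_rsmul_left, map_smul, RingHom.id_apply, smul_sub]
        rw [smul_comm] }
  have hU : ∀ p ψ, U p ψ =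
    QA.op (pair ψ η) - pair (S.op ψ) η - (-1 : ℝ) ^ p • pair ψ (T η) := fun _ _ => rfl
  have hUmul : ∀ (p : ℤ) (i : ℕ), ∀ f ∈ Fn.part (𝓡 d) (fun m : M => m) dg
      (fun i => (A i).dual) i, ∀ ψ, U (i + p) (f • ψ) = (-1 : ℝ) ^ i • (f * U p ψ) :=
    fun p i f hf ψ => rep_defect_smul S η (T η) p hf ψ
  suffices h : U p ψ = 0 by
    rw [hU, sub_sub] at h
    exact sub_eq_zero.1 h
  refine Subtype.ext (funext fun m₀ => ?_)
  let V : DualMod A e B →ₗ[ℝ] SA A m₀ := LinearMap.proj m₀ ∘ₗ (FnA A).val.toLinearMap ∘ₗ U p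
  have hV : ∀ ψ, V ψ = (U p ψ).1 m₀ := fun _ => rfl
  change V ψ = 0
  refine ext_part (m₀ := m₀) (T := V) (fun f ψ => ?_) (fun k β i f hf' hi => ?_) hψ
  · have := hUmul p 0 (cf A f) (cf_mem A f) ψ
    rw [Nat.cast_zero, zero_add, pow_zero, one_smul] at this
    rw [hV, this, cf_mul_apply, hV]
  · have h1 : U (-e k) (dsec A e k β) = 0 := by
      rw [hU, hsec, smul_smul, neg_one_zpow_mul_self, one_smul, sub_self]
    have h2 := hUmul (-e k) i f hf' (dsec A e k β)
    rw [hi, h1, mul_zero, smul_zero] at h2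
    rw [hV, h2]
    rfl

-- The Leibniz rule for the dual operator follows from the duality relation at `ξ • η`, expanded
-- with the Leibniz rule of `QA` and compared with the relation at `η`.
omit [T2Space M] [IsManifold (𝓡 d) ∞ M] [DecidableEq κ] in
lemma pair_leibniz {QA : LieStr A} (S : Rep (fun k => - e k) (fun k => (B k).dual) QA)
    (T : Mod A e B →ₗ[ℝ] Mod A e B)
    (key : ∀ p, ∀ ψ ∈ Mod.part A (fun k => - e k) (fun k => (B k).dual) p, ∀ η,
      QA.op (pair ψ η) = pair (S.op ψ) η + (-1 : ℝ) ^ p • pair ψ (T η)) {p : ℤ}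
    {ψ : DualMod A e B} (hψ : ψ ∈ Mod.part A (fun k => - e k) (fun k => (B k).dual) p) {i : ℕ}
    {ξ : FnA A} (hξ : ξ ∈ Fn.part (𝓡 d) (fun m : M => m) dg (fun i => (A i).dual) i)
    (η : Mod A e B) :
    pair ψ (T (ξ • η)) = pair ψ (QA.op ξ • η + (-1 : ℝ) ^ i • (ξ • T η)) := by
  have h1 := key p ψ hψ (ξ • η)
  rw [pair_smul_right hψ hξ, pair_smul_right (S.map_part p ψ hψ) hξ, map_smul,
    QA.leibniz i ξ hξ, key p ψ hψ η] at h1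
  rw [pair_add_right, pair_rsmul_right, pair_smul_right hψ hξ,
    pair_smul_right hψ (QA.map_deg i ξ hξ)]
  -- `S` raises the degree of `ψ` by one, and `QA` raises that of `ξ` by one; these are the two
  -- extra signs.
  have e1 : (-1 : ℝ) ^ ((p + 1).natAbs * i) = (-1) ^ (p.natAbs * i) * (-1) ^ i := by
    rw [pow_mul, neg_one_zpow_natAbs, zpow_add₀ (by norm_num), pow_mul, neg_one_zpow_natAbs,
      zpow_one, mul_pow]
  have e2 : (-1 : ℝ) ^ (p.natAbs * (i + 1)) = (-1) ^ (p.natAbs * i) * (-1) ^ p := by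
    rw [mul_add, mul_one, pow_add, neg_one_zpow_natAbs]
  rw [e1, mul_add, mul_smul_comm] at h1
  rw [e2]
  exact sign_calc (neg_one_zpow_mul_self p) h1

-- Apply `QA` to the duality relation: both squares vanish, and the mixed terms cancel because they
-- carry the signs for degrees `p` and `p + 1`.
omit [T2Space M] [IsManifold (𝓡 d) ∞ M] [DecidableEq κ] in
lemma pair_sq_zero {QA : LieStr A} (S : Rep (fun k => - e k) (fun k => (B k).dual) QA)
    (T : Mod A e B →ₗ[ℝ] Mod A e B)
    (key : ∀ p, ∀ ψ ∈ Mod.part A (fun k => - e k) (fun k => (B k).dual) p, ∀ η,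
      QA.op (pair ψ η) = pair (S.op ψ) η + (-1 : ℝ) ^ p • pair ψ (T η)) {p : ℤ}
    {ψ : DualMod A e B} (hψ : ψ ∈ Mod.part A (fun k => - e k) (fun k => (B k).dual) p)
    (η : Mod A e B) : pair ψ (T (T η)) = 0 := by
  have h1 := congrArg QA.op (key p ψ hψ η)
  rw [QA.sq_zero, map_add, map_smul, key p ψ hψ (T η),
    key _ _ (S.map_part p ψ hψ) η, S.sq_zero] at h1
  have h2 : pair (0 : DualMod A e B) η = 0 := LinearMap.map_zero₂ (pairL A e B) η
  rw [h2, zpow_add₀ (by norm_num), zpow_one, smul_add, smul_smul, neg_one_zpow_mul_self,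
    one_smul] at h1
  rw [mul_neg_one, zero_add, neg_smul, neg_add_cancel_left] at h1
  exact h1.symm

/-- The dual of a representation on the dual module. -/
lemma exists_dual_rep {QA : LieStr A} (S : Rep (fun k => - e k) (fun k => (B k).dual) QA) :
    ∃ D : Rep e B QA, ∀ p, ∀ ψ ∈ Mod.part A (fun k => - e k) (fun k => (B k).dual) p, ∀ η,
      QA.op (pair ψ η) = pair (S.op ψ) η + (-1 : ℝ) ^ p • pair ψ (D.op η) := by
  -- The duality relation solved for the pairing of `β` with the image of `η`; `β` has degree `- e
  -- k` and the sign is its own inverse.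
  let L₀ : ∀ k, Mod A e B →ₗ[ℝ] (B k).dual.Sec →ₗ[ℝ] FnA A := fun k =>
    LinearMap.mk₂ ℝ (fun η β => (-1 : ℝ) ^ (-e k) •
      (QA.op (pair (dsec A e k β) η) - pair (S.op (dsec A e k β)) η))
      (fun η η' β => by simp only [pair_add_right, map_add]; module)
      (fun r η β => by simp only [pair_rsmul_right, map_smul]; module)
      (fun η β β' => by simp only [pair_add_left, map_add]; module)
      (fun r η β => by simp only [pair_rsmul_left, map_smul]; module)
  have hL₀ : ∀ k η β, L₀ k η β = (-1 : ℝ) ^ (-e k) •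
      (QA.op (pair (dsec A e k β) η) - pair (S.op (dsec A e k β)) η) := fun _ _ _ => rfl
  -- Tensoriality in `β`: the derivative of `f` enters twice, with opposite signs.
  have hf : ∀ k η f β, L₀ k η ((B k).dual.fmul f β) = cf A f * L₀ k η β := by
    intro k η f β
    rw [hL₀, hL₀, dsec_fmul, pair_smul_left, QA.op_cf_mul, S.op_cf_smul, mul_smul_comm,
      pair_add_left, pair_smul_left, pair_smul_left, mul_sub]
    congr 1
    abel
  have hdeg : ∀ k p, ∀ η ∈ Mod.part A e B p, ∀ β, (L₀ k η β).1 ∈ HomogA A (p + 1 - e k) := by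
    intro k p η hη β
    have h1 := QA.op_homogA (pair_homogA (dsec_mem k β) hη)
    have h2 := pair_homogA (S.map_part _ _ (dsec_mem k β)) hη
    have e1 : -e k + p + 1 = p + 1 - e k := by ring
    have e2 : -e k + 1 + p = p + 1 - e k := by ring
    rw [e1] at h1
    rw [e2] at h2
    exact Submodule.smul_mem _ _ (sub_mem h1 h2)
  -- The power of the parity converts prescribed pairings into prescribed coefficients.
  let L : ∀ k, Mod A e B →ₗ[ℝ] (B k).dual.Sec →ₗ[ℝ]
      Raw (fun m : M => m) dg (fun i => (A i).dual) := fun k =>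
    (L₀ k).compr₂ (parRaw A (e k).natAbs ∘ₗ (FnA A).val.toLinearMap)
  have hhom : ∀ p, ∀ η ∈ Mod.part A e B p, ∃ η' ∈ HomogMod A e B (p + 1),
      ∀ k w, coef (fun k => (B k).dp) k w η' = L k η w := fun p η hη =>
    exists_homogMod_of_coef (fun k => (B k).dp) (fun k => L k η)
      (fun k f β m => by
        change parRaw A (e k).natAbs (L₀ k η ((B k).dual.fmul f β)).1 m = _
        rw [hf, parRaw_apply, cf_mul_apply, map_smul]
        rfl)
      (fun k β => parRaw_homogA _ (hdeg k p η hη β))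
  obtain ⟨T, hT⟩ := exists_map_of_coef_homog (e := e) (fun k => (B k).dp) L fun p η hη => by
    obtain ⟨η', h, h'⟩ := hhom p η hη
    exact ⟨⟨η', mem_Mod_of_homog h⟩, h'⟩
  have hpart : ∀ p, ∀ η ∈ Mod.part A e B p, T η ∈ Mod.part A e B (p + 1) := by
    intro p η hη
    obtain ⟨η', h, h'⟩ := hhom p η hη
    have : (T η).1 = η' := eq_of_coef_eq (fun k => (B k).dp) fun k w => by rw [hT, h']
    change (T η).1 ∈ HomogMod A e B (p + 1)
    rwa [this]
  have hsec : ∀ k β η, pair (dsec A e k β) (T η) = (-1 : ℝ) ^ (-e k) •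
      (QA.op (pair (dsec A e k β) η) - pair (S.op (dsec A e k β)) η) := fun k β η =>
    pair_dsec_eq_iff.2 (hT η k β)
  have key := pair_eq_of_dsec S T hsec
  refine ⟨⟨T, hpart, fun i ξ hξ η => eq_of_pair_left fun k β => ?_, fun η =>
    eq_of_pair_left fun k β => ?_⟩, key⟩
  · exact pair_leibniz S T key (dsec_mem k β) hξ η
  · rw [pair_sq_zero S T key (dsec_mem k β) η]
    exact (map_zero (pairL A e B _)).symm

end Duals
-- Duals and preduals of morphisms
section DualMaps

variable {d : ℕ} {M : Type u} [TopologicalSpace M] [ChartedSpace (EuclideanSpace ℝ (Fin d)) M]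
  {n : ℕ} {A : Fin n → VB d M} {κ κ' : Type} {e : κ → ℤ} {B : κ → VB d M}
  {e' : κ' → ℤ} {B' : κ' → VB d M}

instance : IsScalarTower ℝ (FnA A) (Mod A e B) where
  smul_assoc r f η := Subtype.ext (smul_assoc r f η.1)

/-- Linear maps over the functions on `A` from real-linear ones. -/
def linMapOfReal (T : Mod A e B →ₗ[ℝ] Mod A e' B')
    (hT : ∀ i, ∀ f ∈ Fn.part (𝓡 d) (fun m : M => m) dg (fun i => (A i).dual) i,
      ∀ η, T (f • η) = f • T η) : Mod A e B →ₗ[FnA A] Mod A e' B' where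
  toFun := T
  map_add' := map_add T
  map_smul' f η := by
    induction f using Fn_induction with
    | homog i f hf => exact hT i f hf η
    | zero => rw [zero_smul, map_zero, RingHom.id_apply, zero_smul]
    | add f g hf hg => rw [add_smul, map_add, hf, hg]; exact (add_smul f g (T η)).symm
    | smul r f hf => rw [smul_assoc, map_smul, hf]; exact (smul_assoc r f (T η)).symm

variable [T2Space M] [IsManifold (𝓡 d) ∞ M] [DecidableEq κ] [Fintype κ]
  [DecidableEq κ'] [Fintype κ']

/-- The dual of a morphism of modules. -/
lemma exists_dual_map (μ : Mod A e B →ₗ[FnA A] Mod A e' B')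
    (hμ : ∀ p, ∀ η ∈ Mod.part A e B p, μ η ∈ Mod.part A e' B' p) :
    ∃ ν : DualMod A e' B' →ₗ[FnA A] DualMod A e B,
      (∀ p, ∀ ψ ∈ Mod.part A (fun k => - e' k) (fun k => (B' k).dual) p,
        ν ψ ∈ Mod.part A (fun k => - e k) (fun k => (B k).dual) p) ∧
      ∀ ψ η, pair (ν ψ) η = pair ψ (μ η) := by
  let P := fun k => (B k).dp.flip
  -- The adjunction relation at a section `b` prescribes the coefficient of `ν ψ` along `b` as the
  -- pairing of `ψ` with `μ b`.
  let L : ∀ k, DualMod A e' B' →ₗ[ℝ] (B k).Sec →ₗ[ℝ]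
      Raw (fun m : M => m) dg (fun i => (A i).dual) := fun k =>
    ((pairL A e' B').compl₂ (μ.restrictScalars ℝ ∘ₗ sec A e B k)).compr₂
      (FnA A).val.toLinearMap
  have hL : ∀ k ψ b, L k ψ b = (pair ψ (μ (sec A e B k b))).1 := fun _ _ _ => rfl
  have hhom : ∀ p, ∀ ψ ∈ Mod.part A (fun k => - e' k) (fun k => (B' k).dual) p,
      ∃ χ ∈ HomogMod A (fun k => - e k) (fun k => (B k).dual) p,
      ∀ k w, coef P k w χ = L k ψ w := fun p ψ hψ =>
    exists_homogMod_of_coef P (fun k => L k ψ)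
      (fun k f b m => by rw [hL, hL, sec_fmul, map_smul, pair_cf_smul_right, cf_mul_apply])
      (fun k b => by
        have := pair_homogA hψ (hμ _ _ (sec_mem e k b))
        rwa [sub_neg_eq_add])
  obtain ⟨T, hT⟩ := exists_map_of_coef_homog (e := fun k => - e k) P L fun p ψ hψ => by
    obtain ⟨χ, h, h'⟩ := hhom p ψ hψ
    exact ⟨⟨χ, mem_Mod_of_homog h⟩, h'⟩
  have hpart : ∀ p, ∀ ψ ∈ Mod.part A (fun k => - e' k) (fun k => (B' k).dual) p,
      T ψ ∈ Mod.part A (fun k => - e k) (fun k => (B k).dual) p := by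
    intro p ψ hψ
    obtain ⟨χ, h, h'⟩ := hhom p ψ hψ
    have : (T ψ).1 = χ := eq_of_coef_eq P fun k w => by rw [hT, h']
    change (T ψ).1 ∈ HomogMod A _ _ p
    rwa [this]
  have hsec : ∀ ψ k b, pair (T ψ) (sec A e B k b) = pair ψ (μ (sec A e B k b)) := fun ψ k b =>
    Subtype.ext (by rw [pair_sec_right]; exact hT ψ k b)
  refine ⟨linMapOfReal T fun i f hf ψ => eq_of_pair_right fun k b => ?_, hpart, fun ψ η => ?_⟩
  · rw [hsec, pair_smul_left, pair_smul_left, hsec]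
  · change pair (T ψ) η = pair ψ (μ η)
    -- A factor in the right slot comes out with a sign depending on the degree of `ψ`. Hence `ψ` is
    -- taken homogeneous; its image has the same degree, so both sides receive the same sign.
    induction ψ using Mod_induction with
    | homog p ψ hψ =>
      let U : Mod A e B →ₗ[ℝ] FnA A :=
        pairL A e B (T ψ) - pairL A e' B' ψ ∘ₗ μ.restrictScalars ℝ
      have hU : ∀ η, U η = pair (T ψ) η - pair ψ (μ η) := fun _ => rfl
      refine sub_eq_zero.1 (Subtype.ext (funext fun m₀ => ?_) : U η = 0)
      let V : Mod A e B →ₗ[ℝ] SA A m₀ := LinearMap.proj m₀ ∘ₗ (FnA A).val.toLinearMap ∘ₗ U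
      have hV : ∀ η, V η = (U η).1 m₀ := fun _ => rfl
      refine ext_mod (m₀ := m₀) (T := V) (fun f η => ?_) (fun k b i f hf => ?_) η
      · rw [hV, hU, map_smul, pair_cf_smul_right, pair_cf_smul_right, ← mul_sub, cf_mul_apply]
        rfl
      · rw [hV, hU, map_smul, pair_smul_right (hpart p ψ hψ) hf, pair_smul_right hψ hf, hsec,
          sub_self]
        rfl
    | zero =>
      rw [map_zero]
      exact (LinearMap.map_zero₂ (pairL A e B) _).trans
        (LinearMap.map_zero₂ (pairL A e' B') _).symm
    | add ψ ψ' h h' => rw [map_add, pair_add_left, pair_add_left, h, h']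
    | smul r ψ h => rw [map_smul, pair_rsmul_left, pair_rsmul_left, h]

/-- A morphism of dual modules is the dual of a morphism. -/
lemma exists_predual_map (ν : DualMod A e' B' →ₗ[FnA A] DualMod A e B)
    (hν : ∀ p, ∀ ψ ∈ Mod.part A (fun k => - e' k) (fun k => (B' k).dual) p,
        ν ψ ∈ Mod.part A (fun k => - e k) (fun k => (B k).dual) p) :
    ∃ μ : Mod A e B →ₗ[FnA A] Mod A e' B',
      (∀ p, ∀ η ∈ Mod.part A e B p, μ η ∈ Mod.part A e' B' p) ∧
      ∀ ψ η, pair (ν ψ) η = pair ψ (μ η) := by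
  let P := fun k => (B' k).dp
  -- The adjunction relation at sections of the dual bundle prescribes the pairings with `μ η`.
  let L₀ : ∀ k, Mod A e B →ₗ[ℝ] (B' k).dual.Sec →ₗ[ℝ] FnA A := fun k =>
    (pairL A e B).flip.compl₂ (ν.restrictScalars ℝ ∘ₗ dsec A e' k)
  have hL₀ : ∀ k η β, L₀ k η β = pair (ν (dsec A e' k β)) η := fun _ _ _ => rfl
  let L : ∀ k, Mod A e B →ₗ[ℝ] (B' k).dual.Sec →ₗ[ℝ]
      Raw (fun m : M => m) dg (fun i => (A i).dual) := fun k =>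
    (L₀ k).compr₂ (parRaw A (e' k).natAbs ∘ₗ (FnA A).val.toLinearMap)
  have hL : ∀ k η β, L k η β = parRaw A (e' k).natAbs (L₀ k η β).1 := fun _ _ _ => rfl
  have hhom : ∀ p, ∀ η ∈ Mod.part A e B p, ∃ η' ∈ HomogMod A e' B' p,
      ∀ k w, coef P k w η' = L k η w := fun p η hη =>
    exists_homogMod_of_coef P (fun k => L k η)
      (fun k f β m => by
        rw [hL, hL, hL₀, dsec_fmul, map_smul, pair_smul_left, parRaw_apply, cf_mul_apply,
          map_smul]
        rfl)
      (fun k β => by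
        refine parRaw_homogA _ ?_
        have := pair_homogA (hν _ _ (dsec_mem k β)) hη
        rwa [neg_add_eq_sub] at this)
  obtain ⟨T, hT⟩ := exists_map_of_coef_homog (e := e') P L fun p η hη => by
    obtain ⟨η', h, h'⟩ := hhom p η hη
    exact ⟨⟨η', mem_Mod_of_homog h⟩, h'⟩
  have hpart : ∀ p, ∀ η ∈ Mod.part A e B p, T η ∈ Mod.part A e' B' p := by
    intro p η hη
    obtain ⟨χ, h, h'⟩ := hhom p η hη
    have : (T η).1 = χ := eq_of_coef_eq P fun k w => by rw [hT, h']
    change (T η).1 ∈ HomogMod A _ _ p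
    rwa [this]
  have hsec : ∀ η k β, pair (dsec A e' k β) (T η) = pair (ν (dsec A e' k β)) η := fun η k β =>
    pair_dsec_eq_iff.2 (hT η k β)
  refine ⟨linMapOfReal T fun i f hf η => eq_of_pair_left fun k β => ?_, hpart, fun ψ η => ?_⟩
  · change pair (dsec A e' k β) _ = pair (dsec A e' k β) _
    rw [hsec, pair_smul_right (hν _ _ (dsec_mem k β)) hf, pair_smul_right (dsec_mem k β) hf,
      hsec]
  · change pair (ν ψ) η = pair ψ (T η)
    let U : DualMod A e' B' →ₗ[ℝ] FnA A :=
      (pairL A e B).flip η ∘ₗ ν.restrictScalars ℝ - (pairL A e' B').flip (T η)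
    have hU : ∀ ψ, U ψ = pair (ν ψ) η - pair ψ (T η) := fun _ => rfl
    refine sub_eq_zero.1 (Subtype.ext (funext fun m₀ => ?_) : U ψ = 0)
    let V : DualMod A e' B' →ₗ[ℝ] SA A m₀ := LinearMap.proj m₀ ∘ₗ (FnA A).val.toLinearMap ∘ₗ U
    have hV : ∀ ψ, V ψ = (U ψ).1 m₀ := fun _ => rfl
    refine ext_mod (m₀ := m₀) (T := V) (fun f ψ => ?_) (fun k b i f hf => ?_) ψ
    · rw [hV, hU, map_smul, pair_smul_left, pair_smul_left, ← mul_sub, cf_mul_apply]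
      rfl
    · rw [hV, hU, map_smul, pair_smul_left, pair_smul_left]
      change (f * pair (ν (dsec A e' k b)) η - f * pair (dsec A e' k b) (T η)).1 m₀ = 0
      rw [hsec, sub_self]
      rfl

end DualMaps
/-! ### Projection to homogeneous parts -/

namespace GSym

variable {κ : Type*} {deg : κ → ℕ} {W : κ → Type*}
  [∀ k, AddCommGroup (W k)] [∀ k, Module ℝ (W k)]

/-- The homomorphism to polynomials that records the degrees. -/
def toPoly : GSym deg W →ₐ[ℝ] Polynomial (GSym deg W) :=
  lift deg W (fun k => ((Polynomial.monomial (deg k)).restrictScalars ℝ).comp (gen deg W k)) (by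
    intro k l v w
    simp only [LinearMap.comp_apply, LinearMap.restrictScalars_apply,
      Polynomial.monomial_mul_monomial]
    rw [gen_mul_gen deg W k l v w, add_comm, Polynomial.smul_monomial])

lemma toPoly_of_mem_part {i : ℕ} {x : GSym deg W} (hx : x ∈ part deg W i) :
    toPoly x = Polynomial.monomial i x := by
  induction hx using part_induction with
  | mon l hl =>
    subst hl
    induction l with
    | nil => simp
    | cons s l ih =>
      simp only [List.map_cons, List.prod_cons, map_mul, ih, List.sum_cons]
      simp [toPoly, Polynomial.monomial_mul_monomial]
  | zero => simp
  | add x y _ _ h1 h2 => simp [h1, h2]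
  | smul r x _ h => rw [map_smul, h, Polynomial.smul_monomial]

/-- The projection to the part of degree `i`. -/
def projPart (i : ℕ) : GSym deg W →ₗ[ℝ] GSym deg W :=
  ((Polynomial.lcoeff (GSym deg W) i).restrictScalars ℝ).comp toPoly.toLinearMap

lemma projPart_of_mem {i j : ℕ} {x : GSym deg W} (hx : x ∈ part deg W j) :
    projPart i x = if j = i then x else 0 := by
  change (toPoly x).coeff i = _
  rw [toPoly_of_mem_part hx, Polynomial.coeff_monomial]

end GSym

/-! ### Local monomial form of homogeneous functions -/

section Monomials

variable {d : ℕ} {M : Type u} [TopologicalSpace M] [ChartedSpace (EuclideanSpace ℝ (Fin d)) M]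
  {n : ℕ} {A : Fin n → VB d M}

/-- Products of smooth functions and sections, with their degrees. -/
inductive AMonomial : ℕ → Raw (fun m : M => m) dg (fun i => (A i).dual) → Prop
  | one : AMonomial 0 1
  | base {b : ℕ} {t : Raw (fun m : M => m) dg (fun i => (A i).dual)} (f : M → ℝ)
      (hf : ContMDiff (𝓡 d) 𝓘(ℝ, ℝ) ∞ f) : AMonomial b t → AMonomial b (Raw.ofFun dg f * t)
  | side {b : ℕ} {t : Raw (fun m : M => m) dg (fun i => (A i).dual)} (i : Fin n)
      (α : (A i).dual.Sec) : AMonomial b t → AMonomial (b + dg i) (Raw.ofSec dg i α * t)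

lemma AMonomial.mul {b c : ℕ} {s t : Raw (fun m : M => m) dg (fun i => (A i).dual)}
    (hs : AMonomial b s) (ht : AMonomial c t) : AMonomial (b + c) (s * t) := by
  induction hs with
  | one => simpa using ht
  | base f hf _ ih => rw [mul_assoc]; exact .base f hf ih
  | side i α _ ih =>
    rw [mul_assoc, add_right_comm]
    exact .side i α ih

lemma AMonomial.mem_part {b : ℕ} {s : Raw (fun m : M => m) dg (fun i => (A i).dual)}
    (hs : AMonomial b s) (m : M) : s m ∈ GSym.part dg (fun i => (A i).dual.fiber m) b := by
  induction hs with
  | one => exact GSym.one_mem_part _ _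
  | base f hf _ ih =>
    have := GSym.part_mul ((ofFun_mem_homog (W := fun i => (A i).dual) (q := fun m : M => m)
      (deg := dg) hf).2 m) ih
    rwa [zero_add] at this
  | side i α _ ih =>
    have := GSym.part_mul ((ofSec_mem_homog (J := 𝓡 d) (W := fun i => (A i).dual)
      (q := fun m : M => m) (deg := dg) i α).2 m) ih
    rwa [add_comm] at this

lemma mem_span_aMonomial_of_poly {t : Raw (fun m : M => m) dg (fun i => (A i).dual)}
    (ht : t ∈ Poly (𝓡 d) (fun m : M => m) dg (fun i => (A i).dual)) :
    t ∈ Submodule.span ℝ {t | ∃ b, AMonomial (A := A) b t} := by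
  have h1 : (1 : Raw (fun m : M => m) dg (fun i => (A i).dual)) ∈
      Submodule.span ℝ {t | ∃ b, AMonomial (A := A) b t} := Submodule.subset_span ⟨0, .one⟩
  induction ht using Algebra.adjoin_induction with
  | mem x hx =>
    rcases hx with ⟨f, hf, rfl⟩ | ⟨k, a, rfl⟩
    · exact Submodule.subset_span ⟨0, by simpa using AMonomial.base f hf .one⟩
    · exact Submodule.subset_span ⟨_, by simpa using AMonomial.side k a .one⟩
  | algebraMap r =>
    rw [Algebra.algebraMap_eq_smul_one]
    exact Submodule.smul_mem _ _ h1
  | add x y _ _ h h' => exact add_mem h h'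
  | mul x y hx hy h h' =>
    clear hx hy
    induction h, h' using Submodule.span_induction₂ with
    | mem_mem x y hx hy =>
      obtain ⟨i, hi⟩ := hx
      obtain ⟨j, hj⟩ := hy
      exact Submodule.subset_span ⟨i + j, hi.mul hj⟩
    | zero_left y hy => simp
    | zero_right x hx => simp
    | add_left x y z _ _ _ h1 h2 => rw [add_mul]; exact add_mem h1 h2
    | add_right x y z _ _ _ h1 h2 => rw [mul_add]; exact add_mem h1 h2
    | smul_left r x y _ _ h => rw [smul_mul_assoc]; exact Submodule.smul_mem _ r h
    | smul_right r x y _ _ h => rw [mul_smul_comm]; exact Submodule.smul_mem _ r h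

/-- Each monomial is homogeneous, so the projection keeps or kills it. -/
lemma exists_projPart_eq {t : Raw (fun m : M => m) dg (fun i => (A i).dual)} (i : ℕ)
    (ht : t ∈ Submodule.span ℝ {t | ∃ b, AMonomial (A := A) b t}) :
    (fun m => GSym.projPart i (t m)) ∈ Submodule.span ℝ {t | AMonomial (A := A) i t} := by
  induction ht using Submodule.span_induction with
  | mem x hx =>
    obtain ⟨b, hb⟩ := hx
    by_cases h : b = i
    · subst h
      have : (fun m => GSym.projPart b (x m)) = x := funext fun m => by
        rw [GSym.projPart_of_mem (hb.mem_part m), if_pos rfl]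
      rw [this]
      exact Submodule.subset_span hb
    · have : (fun m => GSym.projPart i (x m)) = 0 := funext fun m => by
        rw [GSym.projPart_of_mem (hb.mem_part m), if_neg h]
        rfl
      rw [this]
      exact Submodule.zero_mem _
  | zero =>
    convert Submodule.zero_mem _ using 1
    funext m
    exact (GSym.projPart i).map_zero
  | add x y _ _ h1 h2 =>
    convert add_mem h1 h2 using 1
    funext m
    exact (GSym.projPart i).map_add (x m) (y m)
  | smul r x _ h =>
    convert Submodule.smul_mem _ r h using 1
    funext m
    exact (GSym.projPart i).map_smul r (x m)

/-- Homogeneous functions are locally sums of monomials of the same degree. -/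
lemma exists_aMonomial_of_homog {i : ℕ} {s : Raw (fun m : M => m) dg (fun i => (A i).dual)}
    (hs : s ∈ Homog (𝓡 d) (fun m : M => m) dg (fun i => (A i).dual) i) (m₀ : M) :
    ∃ t ∈ Submodule.span ℝ {t | AMonomial (A := A) i t}, ∀ᶠ m in 𝓝 m₀, s m = t m := by
  obtain ⟨t, ht, h⟩ := hs.1 m₀
  refine ⟨_, exists_projPart_eq i (mem_span_aMonomial_of_poly ht), h.mono fun m hm => ?_⟩
  -- The value `s m` has degree `i` and is fixed by the projection, so the projected polynomial
  -- still agrees with `s` near `m₀`.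
  have := GSym.projPart_of_mem (i := i) (hs.2 m)
  rw [if_pos rfl] at this
  rw [← hm, this]

end Monomials
/-! ### Linear functions -/

section Linear

variable {d : ℕ} {M : Type u} [TopologicalSpace M] [ChartedSpace (EuclideanSpace ℝ (Fin d)) M]
  {n : ℕ} {V : VB d M} {A C : Fin n → VB d M}

/-- Diagonal matrices with an entry and its image under a power of the parity automorphism. -/
def twist (m : M) (a : ℕ) : SA A m →ₐ[ℝ] Matrix (Fin 2) (Fin 2) (SA A m) :=
  (Matrix.diagonalAlgHom ℝ).comp
    (AlgHom.pi fun i : Fin 2 => GSym.parity dg (fun i => (A i).dual.fiber m) ^ (a * i))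

lemma twist_apply (m : M) (a : ℕ) (ξ : SA A m) (i j : Fin 2) :
    twist m a ξ i j = if i = j then
      (GSym.parity dg (fun i => (A i).dual.fiber m) ^ (a * i)) ξ else 0 := by
  simp [twist, Matrix.diagonal_apply]

/-- The values of `theta` on generators. -/
def thetaGen (m : M) (j : Fin n) (c : (C j).fiber m) : (k : Fin n ⊕ Fin n) →
    (coframe A C k).fiber m →ₗ[ℝ] Matrix (Fin 2) (Fin 2) (SA A m)
  | .inl i => (twist m (dg j)).toLinearMap.comp (GSym.gen dg (fun i => (A i).dual.fiber m) i)
  | .inr k => ((Matrix.singleLinearMap ℝ (0 : Fin 2) (1 : Fin 2)).comp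
      (Algebra.linearMap ℝ (SA A m))).comp
        (((C k).ev m).flip (Pi.single (M := fun k => (C k).fiber m) j c k))

lemma thetaGen_inl (m : M) (j : Fin n) (c : (C j).fiber m) (i : Fin n) (α : (A i).dual.fiber m) :
    thetaGen (A := A) m j c (.inl i) α =
      twist m (dg j) (GSym.gen dg (fun i => (A i).dual.fiber m) i α) := rfl

lemma thetaGen_inr (m : M) (j : Fin n) (c : (C j).fiber m) (k : Fin n) (γ : (C k).dual.fiber m) :
    thetaGen (A := A) m j c (.inr k) γ = Matrix.single 0 1 (algebraMap ℝ (SA A m)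
      ((C k).ev m γ (Pi.single (M := fun k => (C k).fiber m) j c k))) := rfl

lemma thetaGen_inr_of_ne (m : M) {j : Fin n} (c : (C j).fiber m) {k : Fin n} (hk : k ≠ j)
    (γ : (C k).dual.fiber m) : thetaGen (A := A) m j c (.inr k) γ = 0 := by
  rw [thetaGen_inr, Pi.single_eq_of_ne hk, map_zero, map_zero, Matrix.single_zero]

lemma thetaGen_inr_same (m : M) {j : Fin n} (c : (C j).fiber m) (γ : (C j).dual.fiber m) :
    thetaGen (A := A) m j c (.inr j) γ =
      Matrix.single 0 1 (algebraMap ℝ (SA A m) ((C j).ev m γ c)) := by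
  rw [thetaGen_inr, Pi.single_eq_same]

lemma twist_mul_single (m : M) (a : ℕ) (ξ : SA A m) (r : ℝ) :
    twist m a ξ * Matrix.single 0 1 (algebraMap ℝ (SA A m) r) = Matrix.single 0 1 (r • ξ) := by
  ext i j
  fin_cases i <;> fin_cases j <;>
    simp [Matrix.mul_apply, twist_apply, Matrix.single_apply, Algebra.smul_def, Algebra.commutes]

lemma single_mul_twist (m : M) (a : ℕ) (ξ : SA A m) (r : ℝ) :
    Matrix.single 0 1 (algebraMap ℝ (SA A m) r) * twist m a ξ = Matrix.single 0 1
      (r • (GSym.parity dg (fun i => (A i).dual.fiber m) ^ a) ξ) := by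
  ext i j
  fin_cases i <;> fin_cases j <;>
    simp [Matrix.mul_apply, twist_apply, Matrix.single_apply, Algebra.smul_def]

/-- The lower diagonal entry of `twist` carries the parity to the power `dg j`; this is exactly the
sign needed for an element of A_i^* to pass the off-diagonal matrix unit that represents C_j^*. -/
lemma thetaGen_comm (m : M) (j : Fin n) (c : (C j).fiber m) (i k : Fin n)
    (α : (A i).dual.fiber m) (γ : (C k).dual.fiber m) :
    thetaGen (A := A) m j c (.inl i) α * thetaGen (A := A) m j c (.inr k) γ =
      (-1 : ℝ) ^ (dg i * dg k) •
        (thetaGen (A := A) m j c (.inr k) γ * thetaGen (A := A) m j c (.inl i) α) := by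
  by_cases hk : k = j
  · subst hk
    rw [thetaGen_inl, thetaGen_inr_same, twist_mul_single, single_mul_twist,
      GSym.parity_pow_of_mem_part (dg k) (GSym.gen_mem_part _ _ _ _), Matrix.smul_single]
    congr 1
    rw [mul_comm (dg k), smul_comm _ ((C k).ev m γ c), smul_smul, smul_smul, mul_assoc, ← mul_pow]
    simp
  · rw [thetaGen_inr_of_ne m c hk, mul_zero, zero_mul, smul_zero]

/-- The evaluation of the part of degree at most one in the generators `C_j^*` at an element
of `C_j`. -/
def theta (m : M) (j : Fin n) (c : (C j).fiber m) :
    GSym dgD (fun k => (coframe A C k).fiber m) →ₐ[ℝ] Matrix (Fin 2) (Fin 2) (SA A m) :=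
  GSym.lift dgD (fun k => (coframe A C k).fiber m) (thetaGen m j c) (by
    rintro (i | i) (k | k) v w
    · change twist m _ _ * twist m _ _ = _ • (twist m _ _ * twist m _ _)
      rw [← map_mul, ← map_mul]
      erw [GSym.gen_mul_gen]
      rw [map_smul]
      rfl
    · exact thetaGen_comm m j c i k v w
    · rw [thetaGen_comm m j c k i w v, smul_smul]
      change _ = ((-1 : ℝ) ^ (dg i * dg k) * _) • _
      rw [mul_comm (dg k), ← mul_pow]
      simp
    -- The off-diagonal matrix unit has square zero, so products of two core generators are sent to
    -- `0`: the matrices record only the first order in the core.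
    · change Matrix.single 0 1 _ * Matrix.single 0 1 _ =
        _ • (Matrix.single 0 1 _ * Matrix.single 0 1 _)
      rw [Matrix.single_mul_single_of_ne _ _ _ _ (by decide),
        Matrix.single_mul_single_of_ne _ _ _ _ (by decide), smul_zero])

lemma theta_gen (m : M) (j : Fin n) (c : (C j).fiber m) (k : Fin n ⊕ Fin n)
    (w : (coframe A C k).fiber m) :
    theta m j c (GSym.gen dgD (fun k => (coframe A C k).fiber m) k w) = thetaGen m j c k w :=
  GSym.lift_gen _ _ _ _ _ _

lemma theta_incl (m : M) (j : Fin n) (c : (C j).fiber m) (ξ : SA A m) :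
    theta m j c (incl A C m ξ) = twist m (dg j) ξ := by
  have : (theta m j c).comp (incl A C m) = twist m (dg j) := GSym.algHom_ext fun i α => by
    change theta m j c (incl A C m _) = _
    rw [incl_gen]
    exact theta_gen m j c (.inl i) α
  exact congrArg (fun φ => φ ξ) this

/-- The two entries must be treated together: a generator of C_j^* turns the `(1, 1)` entry of the
remaining product into its `(0, 1)` entry, at the cost of `dg j` degrees. -/
lemma theta_part {m : M} (j : Fin n) (c : (C j).fiber m) {i : ℕ}
    {x : GSym dgD (fun k => (coframe A C k).fiber m)}
    (hx : x ∈ GSym.part dgD (fun k => (coframe A C k).fiber m) i) :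
    theta m j c x 0 1 ∈ GSym.partZ dg (fun i => (A i).dual.fiber m) (i - dg j) ∧
    theta m j c x 1 1 ∈ GSym.part dg (fun i => (A i).dual.fiber m) i := by
  induction hx using GSym.part_induction with
  | mon l hl =>
    subst hl
    induction l with
    | nil => simp [GSym.one_mem_part]
    | cons s l ih =>
      obtain ⟨h2, h4⟩ := ih
      obtain ⟨s, w⟩ := s
      simp only [List.map_cons, List.prod_cons, map_mul, List.sum_cons, theta_gen,
        Matrix.mul_apply, Fin.sum_univ_two]
      rcases s with i | k
      · have hg := GSym.gen_mem_part dg (fun i => (A i).dual.fiber m) i w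
        rw [show thetaGen m j c (.inl i) w = _ from thetaGen_inl m j c i w]
        rw [show dgD (Sum.inl i : Fin n ⊕ Fin n) = dg i from rfl]
        simp only [twist_apply]
        refine ⟨?_, ?_⟩
        · have := GSym.partZ_mul (GSym.mem_partZ_of_eq rfl hg) h2
          simpa [add_sub_assoc] using this
        · simpa using GSym.part_mul (GSym.parity_pow_mem_part _ _ (dg j) hg) h4
      · by_cases hk : k = j
        · subst hk
          rw [show thetaGen m k c (.inr k) w = _ from thetaGen_inr_same m c w]
          simp only [Matrix.single_apply]
          refine ⟨?_, by simp⟩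
          have : ((dgD (Sum.inr k : Fin n ⊕ Fin n) + (l.map fun s => dgD s.1).sum : ℕ) : ℤ) - dg k
              = ((l.map fun s => dgD s.1).sum : ℕ) := by
            simp [dgD]
          rw [this, GSym.partZ_natCast]
          simpa [Algebra.smul_def] using Submodule.smul_mem _ ((C k).ev m w c) h4
        · rw [show thetaGen m j c (.inr k) w = _ from thetaGen_inr_of_ne m c hk w]
          simp
  | zero => simp
  | add x y _ _ h1 h2 =>
    simp only [map_add, Matrix.add_apply]
    exact ⟨add_mem h1.1 h2.1, add_mem h1.2 h2.2⟩
  | smul r x _ h =>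
    simp only [map_smul, Matrix.smul_apply]
    exact ⟨Submodule.smul_mem _ r h.1, Submodule.smul_mem _ r h.2⟩

variable (A C) in
/-- The restriction to the zero section of the bundles `C_j`. -/
def thetaZero (m : M) : GSym dgD (fun k => (coframe A C k).fiber m) →ₐ[ℝ] SA A m :=
  GSym.lift dgD (fun k => (coframe A C k).fiber m)
    (fun k => match k with
      | .inl i => GSym.gen dg (fun i => (A i).dual.fiber m) i
      | .inr _ => 0) (by
    rintro (i | i) (k | k) v w
    · exact GSym.gen_mul_gen dg (fun i => (A i).dual.fiber m) i k v w
    all_goals simp)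

lemma thetaZero_incl (m : M) (ξ : SA A m) : thetaZero A C m (incl A C m ξ) = ξ := by
  have : (thetaZero A C m).comp (incl A C m) = AlgHom.id ℝ _ := GSym.algHom_ext fun i α => by
    change thetaZero A C m (incl A C m _) = _
    rw [incl_gen]
    exact GSym.lift_gen dgD (fun k => (coframe A C k).fiber m) _ _ (Sum.inl i) α
  exact congrArg (fun φ => φ ξ) this

lemma thetaZero_part {m : M} {i : ℕ} {x : GSym dgD (fun k => (coframe A C k).fiber m)}
    (hx : x ∈ GSym.part dgD (fun k => (coframe A C k).fiber m) i) :
    thetaZero A C m x ∈ GSym.part dg (fun i => (A i).dual.fiber m) i := by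
  refine GSym.map_mem_part _ _ _ (fun k v => ?_) hx
  rw [thetaZero, GSym.lift_gen]
  rcases k with k | k
  · exact GSym.gen_mem_part dg (fun i => (A i).dual.fiber m) k v
  · exact zero_mem _

/-- The value of the linear function defined by an element of the fibre of `S(A^*) ⊗ E^*`. -/
def linPt (v : V.Total) : (∀ k, SA A v.proj ⊗[ℝ] (tot V C k).dual.fiber v.proj) →ₗ[ℝ]
    GSym dgD (fun k => (coframe A C k).fiber v.proj) :=
  ∑ k, (linFib V A C v k).comp (LinearMap.proj k)

lemma linPt_apply (v : V.Total) (x : ∀ k, SA A v.proj ⊗[ℝ] (tot V C k).dual.fiber v.proj) :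
    linPt v x = ∑ k, linFib V A C v k (x k) := by
  simp [linPt]

lemma lin_apply (χ : DualMod A totDeg (tot V C)) (v : V.Total) :
    (lin V A C χ).1 v = linPt v (χ.1 v.proj) := (linPt_apply _ _).symm

variable [T2Space M] [IsManifold (𝓡 d) ∞ M]

lemma ct_zero_left {W W' : VB d M} (P : VB.DualPair W W') (m : M) (x : SA A m ⊗[ℝ] W.fiber m) :
    ct P m 0 x = 0 := by
  simpa using ct_sum_left P (∅ : Finset ℕ) m (fun _ => 0) (fun _ => 0) x

lemma thetaZero_linFib_none (v : V.Total)
    (x : SA A v.proj ⊗[ℝ] (tot V C none).dual.fiber v.proj) :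
    thetaZero A C v.proj (linFib V A C v none x) = ct (tot V C none).dp.flip v.proj v.2 x := by
  induction x using TensorProduct.induction_on with
  | zero => simp
  | add x x' h h' => simp only [map_add, h, h']
  | tmul ξ ψ =>
    rw [linFib_tmul, map_mul, thetaZero_incl]
    refine Eq.trans ?_ (ct_tmul (tot V C none).dp.flip v.proj v.2 ξ ψ).symm
    change _ * thetaZero A C v.proj (algebraMap ℝ _ (V.ev v.proj ψ v.2)) = V.ev v.proj ψ v.2 • _
    rw [AlgHom.commutes, ← Algebra.commutes, Algebra.smul_def]

lemma thetaZero_linFib_some (v : V.Total) (k : Fin n)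
    (x : SA A v.proj ⊗[ℝ] (tot V C (some k)).dual.fiber v.proj) :
    thetaZero A C v.proj (linFib V A C v (some k) x) = 0 := by
  induction x using TensorProduct.induction_on with
  | zero => simp
  | add x x' h h' => simp only [map_add, h, h', add_zero]
  | tmul ξ ψ =>
    rw [linFib_tmul, map_mul]
    refine mul_eq_zero_of_right _ ?_
    exact GSym.lift_gen dgD (fun k => (coframe A C k).fiber v.proj) _ _ (.inr k) ψ

lemma theta_linFib_none (v : V.Total) (j : Fin n) (c : (C j).fiber v.proj)
    (x : SA A v.proj ⊗[ℝ] (tot V C none).dual.fiber v.proj) :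
    theta v.proj j c (linFib V A C v none x) 0 1 = 0 := by
  induction x using TensorProduct.induction_on with
  | zero => simp
  | add x x' h h' => simp only [map_add, h, h', Matrix.add_apply, add_zero]
  | tmul ξ ψ =>
    rw [linFib_tmul, map_mul, theta_incl]
    change (twist v.proj (dg j) ξ * theta v.proj j c (algebraMap ℝ _ (V.ev v.proj ψ v.2)) :
      Matrix (Fin 2) (Fin 2) (SA A v.proj)) 0 1 = 0
    rw [AlgHom.commutes, ← Algebra.commutes, ← Algebra.smul_def, Matrix.smul_apply, twist_apply,
      if_neg (by decide), smul_zero]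

lemma theta_linFib_some (v : V.Total) (j : Fin n) (c : (C j).fiber v.proj) (k : Fin n)
    (x : SA A v.proj ⊗[ℝ] (tot V C (some k)).dual.fiber v.proj) :
    theta v.proj j c (linFib V A C v (some k) x) 0 1 = ct (tot V C (some k)).dp.flip v.proj
      (Pi.single (M := fun k => (C k).fiber v.proj) j c k) x := by
  induction x using TensorProduct.induction_on with
  | zero => simp
  | add x x' h h' => simp only [map_add, h, h', Matrix.add_apply]
  | tmul ξ ψ =>
    rw [linFib_tmul, map_mul, theta_incl]
    refine Eq.trans ?_ (ct_tmul (tot V C (some k)).dp.flip v.proj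
      (Pi.single (M := fun k => (C k).fiber v.proj) j c k) ξ ψ).symm
    refine Eq.trans (congrArg (fun X : Matrix (Fin 2) (Fin 2) (SA A v.proj) =>
        (twist v.proj (dg j) ξ * X) 0 1)
      (theta_gen v.proj j c (.inr k) ψ)) ?_
    exact (congrFun (congrFun (twist_mul_single _ _ _ _) 0) 1).trans (by simp; rfl)

/-- Terms with a core generator disappear, and `ℓ_ψ` takes its scalar value at `v`; what remains is
the V^*-component contracted with `v`. -/
lemma thetaZero_linPt (v : V.Total)
    (x : ∀ k, SA A v.proj ⊗[ℝ] (tot V C k).dual.fiber v.proj) :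
    thetaZero A C v.proj (linPt v x) = ct (tot V C none).dp.flip v.proj v.2 (x none) := by
  rw [linPt_apply, Fintype.sum_option, map_add, map_sum]
  simp [thetaZero_linFib_none, thetaZero_linFib_some]

/-- The first-order entry isolates the C_j^*-component, and it does not depend on where `v` lies in
its fibre. -/
lemma theta_linPt (v : V.Total) (j : Fin n) (c : (C j).fiber v.proj)
    (x : ∀ k, SA A v.proj ⊗[ℝ] (tot V C k).dual.fiber v.proj) :
    theta v.proj j c (linPt v x) 0 1 = ct (tot V C (some j)).dp.flip v.proj c (x (some j)) := by
  rw [linPt_apply, Fintype.sum_option, map_add, map_sum]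
  simp only [theta_linFib_none, theta_linFib_some, Matrix.add_apply, Matrix.sum_apply, zero_add]
  rw [Finset.sum_eq_single j]
  · simp
  · intro k _ hk
    exact (congrArg (fun y => ct (tot V C (some k)).dp.flip v.proj y (x (some k)))
      (Pi.single_eq_of_ne (M := fun k => (C k).fiber v.proj) hk c)).trans (ct_zero_left _ _ _)
  · simp

/-- Elements of a fibre of `S(A^*) ⊗ E^*` are determined by the associated linear functions at
enough points of the fibre of `V`. -/
lemma eq_zero_of_linPt_eq_zero {m : M} (y₀ : V.fiber m)
    {x : ∀ k, SA A m ⊗[ℝ] (tot V C k).dual.fiber m} (h₀ : linPt ⟨m, y₀⟩ x = 0)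
    (h : ∀ w, ∃ ε : ℝ, ε ≠ 0 ∧ linPt (C := C) ⟨m, y₀ + ε • w⟩ x = 0) : x = 0 := by
  funext k
  refine eq_of_ct_eq (tot V C k).dp.flip fun y => ?_
  rw [Pi.zero_apply, map_zero]
  cases k with
  | none =>
    -- The contraction is linear in the vector. It vanishes at `y₀` and at `y₀ + ε • y` with `ε ≠
    -- 0`, hence at `y`.
    have key : ∀ y : V.fiber m, ct (tot V C none).dp.flip m y (x none) = 0 := by
      intro y
      obtain ⟨ε, hε, h1⟩ := h y
      have h2 := thetaZero_linPt (C := C) ⟨m, y₀⟩ x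
      have h3 := thetaZero_linPt (C := C) ⟨m, y₀ + ε • y⟩ x
      rw [h₀, map_zero] at h2
      rw [h1, map_zero] at h3
      have h4 : ∀ y y' : (tot V C none).fiber m,
          ct (tot V C none).dp.flip m (y + ε • y') (x none) =
          ct (tot V C none).dp.flip m y (x none) +
            ε • ct (tot V C none).dp.flip m y' (x none) := by
        intro y y'
        simpa using ct_sum_left (tot V C none).dp.flip Finset.univ m ![1, ε] ![y, y'] (x none)
      have h5 := h4 y₀ y
      have h6 : ε • ct (tot V C none).dp.flip m y (x none) = 0 := by
        refine Eq.trans ?_ (h5.symm.trans h3.symm)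
        refine Eq.trans (zero_add _).symm ?_
        exact congrArg (· + ε • ct (tot V C none).dp.flip m y (x none)) h2
      exact (smul_eq_zero.1 h6).resolve_left hε
    exact key y
  -- The core components are already visible at the single point `y₀`.
  | some j =>
    have := theta_linPt (C := C) ⟨m, y₀⟩ j y x
    rw [h₀, map_zero] at this
    exact this.symm

/-- A linear function determines the section that defines it. -/
lemma lin_injective : Function.Injective (lin V A C) := by
  rw [injective_iff_map_eq_zero]
  intro χ hχ
  have h0 : ∀ v, linPt v (χ.1 v.proj) = 0 := fun v => by
    rw [← lin_apply, hχ]; rfl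
  refine Subtype.ext (funext fun m => ?_)
  exact eq_zero_of_linPt_eq_zero 0 (h0 ⟨m, 0⟩) fun w => ⟨1, one_ne_zero, h0 ⟨m, _⟩⟩

/-- The degree of a linear function is the degree of the section that defines it. -/
lemma mem_part_of_lin {χ : DualMod A totDeg (tot V C)} {i : ℕ}
    (h : lin V A C χ ∈ Fn.part V.model V.proj dgD (coframe A C) i) :
    χ ∈ Mod.part A (fun k => - totDeg k) (fun k => (tot V C k).dual) i := by
  have h0 : ∀ v : V.Total, linPt v (χ.1 v.proj) ∈
      GSym.part dgD (fun k => (coframe A C k).fiber v.proj) i := fun v => by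
    rw [← lin_apply]
    exact h.2 v
  refine mem_homogMod_of_coef (fun k => (tot V C k).dp.flip) fun k w => ?_
  refine ⟨coef_smooth _ (mem_smoothMod_of_mem_Mod χ.2) k w, fun m => ?_⟩
  rw [coef_apply]
  cases k with
  | none =>
    -- At the point `w m` of V the restriction to the zero section of the core, which preserves
    -- degrees, returns the coefficient along `w`.
    have h1 := thetaZero_part (h0 ⟨m, w m⟩)
    rw [thetaZero_linPt] at h1
    rw [show (i : ℤ) - -totDeg (none : Option (Fin n)) = i by simp [totDeg]]
    exact h1
  | some j =>
    have h1 := (theta_part j (w m) (h0 ⟨m, 0⟩)).1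
    have h2 := theta_linPt ⟨m, 0⟩ j (w m) (χ.1 m)
    rw [show (i : ℤ) - -totDeg (some j) = i - dg j by simp [totDeg]]
    exact h2 ▸ h1

end Linear
/-! ### The representation associated to a VB-Lie algebroid -/

section Associated

variable {d : ℕ} {M : Type u} [TopologicalSpace M] [ChartedSpace (EuclideanSpace ℝ (Fin d)) M]
  {n : ℕ} {V V' : VB d M} {A C C' : Fin n → VB d M}

lemma lin_smul (f : FnA A) (χ : DualMod A totDeg (tot V C)) :
    lin V A C (f • χ) = pull V A C f * lin V A C χ := by
  refine Subtype.ext (funext fun v => ?_)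
  rw [lin_apply]
  change _ = incl A C v.proj (f.1 v.proj) * (lin V A C χ).1 v
  rw [lin_apply, linPt_apply, linPt_apply, Finset.mul_sum]
  exact Finset.sum_congr rfl fun k _ => linFib_smul V A C v k _ _

lemma lin_mem_part {χ : DualMod A totDeg (tot V C)} {p : ℤ}
    (h : χ ∈ Mod.part A (fun k => - totDeg k) (fun k => (tot V C k).dual) p) :
    lin V A C χ ∈ Fn.part V.model V.proj dgD (coframe A C) p.toNat := by
  refine ⟨smooth_of_mem_Fn (lin V A C χ).2, fun v => ?_⟩
  change (lin V A C χ).1 v ∈ _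
  rw [lin_apply, linPt_apply]
  exact sum_mem fun k _ => linFib_part V A C v k (h.2 v.proj k)

lemma pull_mem_part {f : FnA A} {i : ℕ}
    (hf : f ∈ Fn.part (𝓡 d) (fun m : M => m) dg (fun i => (A i).dual) i) :
    pull V A C f ∈ Fn.part V.model V.proj dgD (coframe A C) i := pullRaw_homog hf

variable [T2Space M] [IsManifold (𝓡 d) ∞ M]

/-- E^* sits in degrees `0, …, n` and S(A^*) in nonnegative degrees, so every coefficient has
negative degree and vanishes. -/
lemma eq_zero_of_mem_part_neg {χ : DualMod A totDeg (tot V C)} {p : ℤ} (hp : p < 0)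
    (h : χ ∈ Mod.part A (fun k => - totDeg k) (fun k => (tot V C k).dual) p) : χ = 0 := by
  refine Subtype.ext (eq_of_coef_eq (fun k => (tot V C k).dp.flip) fun k w => ?_)
  have h1 := coef_homog (fun k => (tot V C k).dp.flip) h k w
  rcases homogZ_cases h1 with h2 | ⟨i, hi, -⟩
  · exact h2.trans (map_zero _).symm
  · cases k <;> simp [totDeg] at hi <;> omega

/-- A linear map that preserves linear functions restricts to a map of sections. -/
lemma exists_linear_restriction (T : FnD V' A C' →ₗ[ℝ] FnD V A C)
    (hT : ∀ ψ, ∃ χ, T (lin V' A C' ψ) = lin V A C χ) :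
    ∃ ν : DualMod A totDeg (tot V' C') →ₗ[ℝ] DualMod A totDeg (tot V C),
      ∀ ψ, lin V A C (ν ψ) = T (lin V' A C' ψ) := by
  choose ν hν using hT
  exact ⟨{ toFun := ν
           map_add' := fun ψ ψ' => lin_injective (by simp only [map_add, ← hν])
           map_smul' := fun r ψ => lin_injective (by
             simp only [map_smul, ← hν, RingHom.id_apply]) }, fun ψ => (hν ψ).symm⟩

/-- The restriction of the homological vector field to linear functions. -/
lemma exists_rep_dual {QA : LieStr A} (QD : VBStr V C QA) :
    ∃ S : Rep (fun k => - totDeg k) (fun k => (tot V C k).dual) QA,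
      ∀ ψ, lin V A C (S.op ψ) = QD.op (lin V A C ψ) := by
  obtain ⟨ν, hν⟩ := exists_linear_restriction QD.op QD.linear
  refine ⟨⟨ν, fun p ψ hψ => ?_, fun i ξ hξ ψ => lin_injective ?_, fun ψ => lin_injective ?_⟩, hν⟩
  -- Vector fields are graded over `ℕ`; negative degrees contain only `0` and are treated
  -- separately.
  · by_cases hp : p < 0
    · rw [eq_zero_of_mem_part_neg hp hψ, map_zero]
      exact zero_mem _
    · obtain ⟨i, rfl⟩ := Int.eq_ofNat_of_zero_le (not_lt.1 hp)
      have := QD.map_deg _ _ (lin_mem_part hψ)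
      rw [← hν] at this
      exact mem_part_of_lin this
  · rw [hν, lin_smul, QD.leibniz i _ (pull_mem_part hξ), QD.basic, map_add, lin_smul,
      (lin V A C).map_smul ((-1 : ℝ) ^ i), lin_smul, hν]
  · rw [hν, hν, QD.sq_zero, map_zero]

lemma Rep.ext_op {κ : Type} {e : κ → ℤ} {B : κ → VB d M} {QA : LieStr A} {D D' : Rep e B QA}
    (h : ∀ η, D.op η = D'.op η) : D = D' := by
  obtain ⟨op, _, _, _⟩ := D
  obtain ⟨op', _, _, _⟩ := D'
  obtain rfl : op = op' := LinearMap.ext h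
  rfl

/-- For uniqueness, injectivity of `lin` forces the element `χ` in `IsAssociated` to be `S.op ψ`.
This fixes all pairings of sections with `D.op η`, hence `D.op η` itself. -/
theorem existsUnique_isAssociated {QA : LieStr A} (QD : VBStr V C QA) :
    ∃! D : Rep totDeg (tot V C) QA, IsAssociated QD D := by
  obtain ⟨S, hS⟩ := exists_rep_dual QD
  obtain ⟨D, hD⟩ := exists_dual_rep S
  refine ⟨D, fun p ψ hψ => ⟨S.op ψ, (hS ψ).symm, hD p ψ hψ⟩, fun D' hD' => ?_⟩
  refine Rep.ext_op fun η => eq_of_pair_left fun k β => ?_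
  have hβ := sec_mem (A := A) (e := fun k => - totDeg k) (B := fun k => (tot V C k).dual) k β
  obtain ⟨χ, h1, h2⟩ := hD' _ _ hβ
  have h3 : χ = S.op _ := lin_injective (h1.symm.trans (hS _).symm)
  have h4 := hD _ _ hβ η
  rw [h2, h3] at h4
  have h5 := add_left_cancel h4
  exact smul_right_injective _ (zpow_ne_zero _ (by norm_num)) h5

end Associated
/-! ### Bidegrees -/

section Bidegree

variable {d : ℕ} {M : Type u} [TopologicalSpace M] [ChartedSpace (EuclideanSpace ℝ (Fin d)) M]
  {n : ℕ} {V : VB d M} {A C : Fin n → VB d M}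

variable (V A C) in
/-- The families of bidegree `(a, b)`. -/
def RawBideg (a : ℕ) (b : ℤ) : Submodule ℝ (Raw V.proj dgD (coframe A C)) where
  carrier := {s | ∀ v₀, ∃ t ∈ Submodule.span ℝ {t | Monomial V A C a b t}, ∀ᶠ v in 𝓝 v₀, s v = t v}
  zero_mem' := fun _ => ⟨0, zero_mem _, by simp⟩
  add_mem' := by
    intro s s' hs hs' v₀
    obtain ⟨t, ht, h⟩ := hs v₀
    obtain ⟨t', ht', h'⟩ := hs' v₀
    exact ⟨t + t', add_mem ht ht', by filter_upwards [h, h'] with v h h'; simp [h, h']⟩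
  smul_mem' := by
    intro r s hs v₀
    obtain ⟨t, ht, h⟩ := hs v₀
    exact ⟨r • t, Submodule.smul_mem _ r ht, by filter_upwards [h] with v h; simp [h]⟩

lemma Monomial.mem_rawBideg {a : ℕ} {b : ℤ} {t : Raw V.proj dgD (coframe A C)}
    (ht : Monomial V A C a b t) : t ∈ RawBideg V A C a b :=
  fun _ => ⟨t, Submodule.subset_span ht, by simp⟩

lemma Monomial.cast {a a' : ℕ} {b b' : ℤ} {t : Raw V.proj dgD (coframe A C)}
    (ht : Monomial V A C a b t) (ha : a = a') (hb : b = b') : Monomial V A C a' b' t := by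
  subst ha hb; exact ht

lemma Monomial.mul {a a' : ℕ} {b b' : ℤ} {s t : Raw V.proj dgD (coframe A C)}
    (hs : Monomial V A C a b s) (ht : Monomial V A C a' b' t) :
    Monomial V A C (a + a') (b + b') (s * t) := by
  induction hs with
  | one => simpa using ht
  | base f hf _ ih => rw [mul_assoc]; exact .base f hf ih
  | side i α _ ih => rw [mul_assoc]; exact (ih.side i α).cast rfl (by ring)
  | linear ψ _ ih => rw [mul_assoc]; exact (ih.linear ψ).cast (by ring) (by ring)
  | core i γ _ ih => rw [mul_assoc]; exact (ih.core i γ).cast (by ring) (by ring)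

lemma rawBideg_mul {a a' : ℕ} {b b' : ℤ} {s t : Raw V.proj dgD (coframe A C)}
    (hs : s ∈ RawBideg V A C a b) (ht : t ∈ RawBideg V A C a' b') :
    s * t ∈ RawBideg V A C (a + a') (b + b') := by
  intro v₀
  obtain ⟨s', hs', h⟩ := hs v₀
  obtain ⟨t', ht', h'⟩ := ht v₀
  refine ⟨s' * t', ?_, by filter_upwards [h, h'] with v h h'; simp [h, h']⟩
  clear h h'
  induction hs', ht' using Submodule.span_induction₂ with
  | mem_mem x y hx hy => exact Submodule.subset_span (hx.mul hy)
  | zero_left y hy => simp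
  | zero_right x hx => simp
  | add_left x y z _ _ _ h1 h2 => rw [add_mul]; exact add_mem h1 h2
  | add_right x y z _ _ _ h1 h2 => rw [mul_add]; exact add_mem h1 h2
  | smul_left r x y _ _ h => rw [smul_mul_assoc]; exact Submodule.smul_mem _ r h
  | smul_right r x y _ _ h => rw [mul_smul_comm]; exact Submodule.smul_mem _ r h

lemma rawBideg_congr {a : ℕ} {b : ℤ} {s t : Raw V.proj dgD (coframe A C)} {v₀ : V.Total}
    (ht : t ∈ RawBideg V A C a b) (h : ∀ᶠ v in 𝓝 v₀, s v = t v) :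
    ∃ t ∈ Submodule.span ℝ {t | Monomial V A C a b t}, ∀ᶠ v in 𝓝 v₀, s v = t v := by
  obtain ⟨t', ht', h'⟩ := ht v₀
  exact ⟨t', ht', by filter_upwards [h, h'] with v h h'; rw [h, h']⟩

lemma pullRaw_ofSec (i : Fin n) (α : (A i).dual.Sec) :
    pullRaw V A C (Raw.ofSec dg i α) = Raw.ofSec dgD (Sum.inl i) α := by
  funext v
  exact incl_gen _ _ _

lemma pullRaw_ofFun (f : M → ℝ) :
    pullRaw V A C (Raw.ofFun dg f) = Raw.ofFun dgD (f ∘ V.proj) := by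
  funext v
  exact AlgHom.commutes _ _

lemma AMonomial.pullRaw {b : ℕ} {t : Raw (fun m : M => m) dg (fun i => (A i).dual)}
    (ht : AMonomial (A := A) b t) : Monomial V A C 0 b (VBLie.pullRaw V A C t) := by
  induction ht with
  | one => rw [map_one]; exact .one
  | base f hf _ ih => rw [map_mul, pullRaw_ofFun]; exact .base f hf ih
  | side i α _ ih =>
    rw [map_mul, pullRaw_ofSec]
    exact (ih.side i α).cast rfl (by push_cast; ring)

/-- Bidegree requires local expressions by monomials of the right degree, not just pointwise
homogeneity; `exists_aMonomial_of_homog` supplies them. -/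
lemma pullRaw_mem_rawBideg {i : ℕ} {f : Raw (fun m : M => m) dg (fun i => (A i).dual)}
    (hf : f ∈ Homog (𝓡 d) (fun m : M => m) dg (fun i => (A i).dual) i) :
    pullRaw V A C f ∈ RawBideg V A C 0 i := by
  intro v₀
  obtain ⟨t, ht, h⟩ := exists_aMonomial_of_homog hf v₀.proj
  refine rawBideg_congr (t := pullRaw V A C t) ?_ ?_
  · clear h
    induction ht using Submodule.span_induction with
    | mem x hx => exact hx.pullRaw.mem_rawBideg
    | zero => simp
    | add x y _ _ h1 h2 => rw [map_add]; exact add_mem h1 h2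
    | smul r x _ h => rw [map_smul]; exact Submodule.smul_mem _ r h
  · filter_upwards [continuous_proj.continuousAt.eventually h] with v hv
    rw [pullRaw_apply, pullRaw_apply, hv]

variable (V A C) in
/-- Sections of `V^*` and `C_i^*` as elements of the dual module. -/
abbrev lsec (k : Option (Fin n)) : (tot V C k).dual.Sec →ₗ[ℝ] DualMod A totDeg (tot V C) :=
  sec A (fun k => - totDeg k) (fun k => (tot V C k).dual) k

lemma lsec_mem (k : Option (Fin n)) (β : (tot V C k).dual.Sec) :
    lsec V A C k β ∈ Mod.part A (fun k => - totDeg k) (fun k => (tot V C k).dual) (- totDeg k) :=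
  sec_mem (A := A) (e := fun k => - totDeg k) (B := fun k => (tot V C k).dual) k β

/-- Sections of `V^*` and `C_i^*` as linear functions. -/
lemma lin_sec_apply (k : Option (Fin n)) (β : (tot V C k).dual.Sec) (v : V.Total) :
    (lin V A C (lsec V A C k β)).1 v =
      linGen V A C v k (β v.proj) := by
  rw [lin_apply, linPt_apply, Finset.sum_eq_single k]
  · refine (congrArg (linFib V A C v k) (Mod.at_sec_same (A := A) (e := fun k => - totDeg k)
      (B := fun k => (tot V C k).dual) k β v.proj)).trans ?_
    rw [linFib_tmul, map_one, one_mul]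
  · intro k' _ hk'
    exact (congrArg (linFib V A C v k') (Mod.at_sec_of_ne (A := A) (e := fun k => - totDeg k)
      (B := fun k => (tot V C k).dual) hk' β v.proj)).trans (map_zero _)
  · simp

lemma lin_sec_none (ψ : V.dual.Sec) :
    (lin V A C (lsec V A C none ψ)).1 =
      Raw.ofFun dgD (V.linFun ψ) := funext fun v => lin_sec_apply none ψ v

lemma lin_sec_some (i : Fin n) (γ : (C i).dual.Sec) :
    (lin V A C (lsec V A C (some i) γ)).1 =
      Raw.ofSec dgD (Sum.inr i) γ := funext fun v => lin_sec_apply (some i) γ v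

lemma lin_sec_mem_rawBideg (k : Option (Fin n)) (β : (tot V C k).dual.Sec) :
    (lin V A C (lsec V A C k β)).1 ∈
      RawBideg V A C 1 (- totDeg k - 1) := by
  cases k with
  | none =>
    rw [show (lin V A C (lsec V A C none β)).1 = _
      from lin_sec_none β]
    have : Monomial V A C (0 + 1) (0 - 1) (Raw.ofFun dgD (V.linFun β) * 1) := .linear β .one
    rw [mul_one] at this
    exact (this.cast rfl (by simp [totDeg])).mem_rawBideg
  | some i =>
    rw [show (lin V A C (lsec V A C (some i) β)).1 = _
      from lin_sec_some i β]
    have := (Monomial.one (V := V) (A := A) (C := C)).core i β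
    rw [mul_one] at this
    exact (this.cast rfl (by simp [totDeg])).mem_rawBideg

variable [T2Space M] [IsManifold (𝓡 d) ∞ M]

/-- In local frames the function is a sum of basic coefficients of bidegree `(0, i)` times
generators of bidegree `(1, - totDeg k - 1)`, where `i - totDeg k = p`. -/
lemma lin_mem_bideg {χ : DualMod A totDeg (tot V C)} {p : ℤ}
    (h : χ ∈ Mod.part A (fun k => - totDeg k) (fun k => (tot V C k).dual) p) :
    lin V A C χ ∈ Bideg V A C 1 (p - 1) := by
  intro v₀
  let P := fun k => (tot V C k).dp.flip
  let m₀ := v₀.proj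
  let c : ∀ k, Fin ((P k).rk m₀) → FnA A := fun k j =>
    ⟨coef P k ((P k).cofr m₀ j) χ.1, mem_Fn_of_homogZ (coef_homog P h k _)⟩
  refine rawBideg_congr (t := ∑ k, ∑ j, (pull V A C (c k j) * lin V A C
    (lsec V A C k ((P k).fr m₀ j))).1) ?_ ?_
  · refine sum_mem fun k _ => sum_mem fun j _ => ?_
    rcases homogZ_cases (coef_homog P h k ((P k).cofr m₀ j)) with h0 | ⟨i, hi, h0⟩
    · have : c k j = 0 := Subtype.ext h0
      rw [this, map_zero, zero_mul]
      exact zero_mem _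
    · have := rawBideg_mul (pullRaw_mem_rawBideg (V := V) (C := C) h0)
        (lin_sec_mem_rawBideg (V := V) (A := A) (C := C) k ((P k).fr m₀ j))
      rw [show 0 + 1 = 1 from rfl, show (i : ℤ) + (-totDeg k - 1) = p - 1 by omega] at this
      exact this
  · have h1 := Filter.eventually_all.2 fun k => (P k).eventually_frame m₀
    filter_upwards [continuous_proj.continuousAt.eventually h1] with v hv
    rw [lin_apply, linPt_apply, Finset.sum_apply]
    refine Finset.sum_congr rfl fun k _ => ?_
    rw [Finset.sum_apply]
    conv_lhs => rw [eq_sum_ct (P k) (hv k).1 (χ.1 v.proj k), map_sum]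
    refine Finset.sum_congr rfl fun j _ => ?_
    rw [linFib_tmul]
    exact congrArg (_ * ·) (lin_sec_apply k _ v).symm

/-- Monomials of weight at most one. -/
lemma Monomial.eq_pull_or_lin {a : ℕ} {b : ℤ} {t : Raw V.proj dgD (coframe A C)}
    (ht : Monomial V A C a b t) :
    (a = 0 → ∃ i : ℕ, b = i ∧ ∃ f ∈ Fn.part (𝓡 d) (fun m : M => m) dg (fun i => (A i).dual) i,
      t = (pull V A C f).1) ∧
    (a = 1 → ∃ χ ∈ Mod.part A (fun k => - totDeg k) (fun k => (tot V C k).dual) (b + 1),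
      t = (lin V A C χ).1) := by
  induction ht with
  | one => exact ⟨fun _ => ⟨0, rfl, 1, ⟨one_mem _, fun _ => GSym.one_mem_part _ _⟩,
      by rw [map_one]; rfl⟩, fun h => absurd h (by decide)⟩
  | base g hg _ ih =>
    have h1 : (pull V A C (cf A ⟨g, hg⟩)).1 = Raw.ofFun dgD (g ∘ V.proj) := pullRaw_ofFun g
    refine ⟨fun ha => ?_, fun ha => ?_⟩
    · obtain ⟨i, hi, f, hf, rfl⟩ := ih.1 ha
      refine ⟨i, hi, cf A ⟨g, hg⟩ * f, ?_, by rw [map_mul, ← h1]; rfl⟩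
      have := homog_mul_mem (cf_mem A ⟨g, hg⟩) hf
      rw [zero_add] at this
      exact this
    · obtain ⟨χ, hχ, rfl⟩ := ih.2 ha
      exact ⟨cf A ⟨g, hg⟩ • χ, smul_mem_part (cf_mem A _) hχ (by simp), by
        rw [lin_smul, ← h1]; rfl⟩
  | side j α _ ih =>
    have h1 : (Raw.ofSec dg j α : Raw (fun m : M => m) dg (fun i => (A i).dual)) ∈
      Homog (𝓡 d) (fun m : M => m) dg (fun i => (A i).dual) (dg j) :=
      ofSec_mem_homog (J := 𝓡 d) (q := fun m : M => m) (deg := dg) (W := fun i => (A i).dual) j α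
    refine ⟨fun ha => ?_, fun ha => ?_⟩
    · obtain ⟨i, hi, f, hf, rfl⟩ := ih.1 ha
      refine ⟨dg j + i, by push_cast; omega, ⟨_, mem_Fn_of_homog h1⟩ * f,
        homog_mul_mem h1 hf, ?_⟩
      rw [map_mul, ← pullRaw_ofSec]
      rfl
    · obtain ⟨χ, hχ, rfl⟩ := ih.2 ha
      refine ⟨(⟨_, mem_Fn_of_homog h1⟩ : FnA A) • χ,
        smul_mem_part (i := dg j) h1 hχ (by ring), ?_⟩
      rw [lin_smul, ← pullRaw_ofSec]
      rfl
  -- This factor already carries weight one, so the remaining monomial has weight zero and is basic.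
  -- The same holds for a core factor.
  | linear ψ _ ih =>
    refine ⟨fun ha => absurd ha (by omega), fun ha => ?_⟩
    obtain ⟨i, hi, f, hf, rfl⟩ := ih.1 (by omega)
    refine ⟨f • lsec V A C none ψ, smul_mem_part hf (lsec_mem (V := V) (C := C) none ψ)
      (by simp [totDeg, hi]), ?_⟩
    rw [lin_smul]
    change _ = (pull V A C f).1 * (lin V A C (lsec V A C none ψ)).1
    rw [lin_sec_none]
    funext v
    exact Algebra.commutes (V.linFun ψ v) ((pull V A C f).1 v)
  | core j γ _ ih =>
    refine ⟨fun ha => absurd ha (by omega), fun ha => ?_⟩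
    obtain ⟨i, hi, f, hf, rfl⟩ := ih.1 (by omega)
    -- In `lin` the basic factor stands on the left; the sign comes from moving the core generator
    -- past it.
    refine ⟨(-1 : ℝ) ^ (dg j * i) • f • lsec V A C (some j) γ,
      Submodule.smul_mem _ _ (smul_mem_part hf (lsec_mem (V := V) (C := C) (some j) γ)
      (by simp [totDeg, hi]; ring)), ?_⟩
    rw [(lin V A C).map_smul ((-1 : ℝ) ^ (dg j * i)), lin_smul]
    change _ = (-1 : ℝ) ^ (dg j * i) • ((pull V A C f).1 *
      (lin V A C (lsec V A C (some j) γ)).1)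
    rw [lin_sec_some]
    funext v
    exact GSym.mul_comm_of_mem_part (GSym.gen_mem_part dgD _ (Sum.inr j) _)
      ((pull_mem_part (V := V) (C := C) hf).2 v)

lemma continuous_line {m : M} (y w : V.fiber m) :
    Continuous fun ε : ℝ => (⟨m, y + ε • w⟩ : V.Total) := by
  let e := trivializationAt V.F V.fiber m
  let L := e.continuousLinearEquivAt ℝ m (FiberBundle.mem_baseSet_trivializationAt' m)
  have h : Continuous fun ε : ℝ => L.symm (L y + ε • L w) := by fun_prop
  have h' : (fun ε : ℝ => L.symm (L y + ε • L w)) = fun ε => y + ε • w := by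
    funext ε
    simp
  rw [h'] at h
  exact (FiberBundle.continuous_totalSpaceMk V.F V.fiber m).comp h

/-- Agreement near a single point of a fibre of V determines the section over the base point: in
each direction a small nonzero step stays in the neighbourhood, and `eq_zero_of_linPt_eq_zero` needs
no more. -/
lemma eq_of_lin_eventuallyEq {χ χ' : DualMod A totDeg (tot V C)} {v : V.Total}
    (h : ∀ᶠ v' in 𝓝 v, (lin V A C χ).1 v' = (lin V A C χ').1 v') :
    χ.1 v.proj = χ'.1 v.proj := by
  obtain ⟨m, y⟩ := v
  have h1 : ∀ᶠ v' : V.Total in 𝓝 ⟨m, y⟩, 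
      linPt v' (χ.1 v'.proj - χ'.1 v'.proj) = 0 := by
    filter_upwards [h] with v' hv'
    rw [map_sub, ← lin_apply, ← lin_apply, hv', sub_self]
  refine sub_eq_zero.1 (eq_zero_of_linPt_eq_zero y h1.self_of_nhds fun w => ?_)
  have h2 := (continuous_line (V := V) y w).tendsto 0
  rw [zero_smul, add_zero] at h2
  have h3 := (h2.eventually h1).filter_mono (nhdsWithin_le_nhds (s := {0}ᶜ))
  obtain ⟨ε, h4, h5⟩ := (h3.and self_mem_nhdsWithin).exists
  exact ⟨ε, h5, h4⟩

/-- The functions of weight one are the linear functions. -/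
lemma exists_lin_of_bideg {s : FnD V A C} {p : ℤ} (hs : s ∈ Bideg V A C 1 (p - 1)) :
    ∃ χ ∈ Mod.part A (fun k => - totDeg k) (fun k => (tot V C k).dual) p, s = lin V A C χ := by
  have h1 : ∀ v₀, ∃ χ ∈ Mod.part A (fun k => - totDeg k) (fun k => (tot V C k).dual) p,
      ∀ᶠ v in 𝓝 v₀, s.1 v = (lin V A C χ).1 v := by
    intro v₀
    obtain ⟨t, ht, h⟩ := hs v₀
    suffices ∃ χ ∈ Mod.part A (fun k => - totDeg k) (fun k => (tot V C k).dual) p,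
        t = (lin V A C χ).1 by
      obtain ⟨χ, hχ, rfl⟩ := this
      exact ⟨χ, hχ, h⟩
    clear h
    induction ht using Submodule.span_induction with
    | mem x hx => simpa using hx.eq_pull_or_lin.2 rfl
    | zero => exact ⟨0, zero_mem _, by rw [map_zero]; rfl⟩
    | add x y _ _ h1 h2 =>
      obtain ⟨χ, hχ, rfl⟩ := h1
      obtain ⟨χ', hχ', rfl⟩ := h2
      exact ⟨χ + χ', add_mem hχ hχ', by rw [map_add]; rfl⟩
    | smul r x _ h =>
      obtain ⟨χ, hχ, rfl⟩ := h
      exact ⟨r • χ, Submodule.smul_mem _ r hχ, by rw [map_smul]; rfl⟩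
  choose χ hχ hs' using h1
  -- The section found near `v₀` may be replaced by the one found near `v`, over the base point of
  -- `v`, as soon as it still represents `s` near `v`.
  have key : ∀ (v₀ v : V.Total), (∀ᶠ v' in 𝓝 v, s.1 v' = (lin V A C (χ v₀)).1 v') →
      (χ v₀).1 v.proj = (χ v).1 v.proj := by
    intro v₀ v h
    refine eq_of_lin_eventuallyEq ?_
    filter_upwards [h, hs' v] with v' h h'
    rw [← h, h']
  -- Along the line from `0` to `y` the value at `m` of the local section is locally constant, hence
  -- constant. Thus all points of a fibre yield the same value, which can be read off at the zero
  -- vector.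
  have hline : ∀ m (y : V.fiber m), (χ ⟨m, y⟩).1 m = (χ ⟨m, 0⟩).1 m := by
    intro m y
    have hc : IsLocallyConstant fun ε : ℝ => (χ ⟨m, 0 + ε • y⟩).1 m := by
      rw [IsLocallyConstant.iff_eventually_eq]
      intro ε₀
      filter_upwards [((continuous_line (V := V) 0 y).tendsto ε₀).eventually
        (hs' ⟨m, 0 + ε₀ • y⟩).eventually_nhds] with ε hε
      exact (key _ _ hε).symm
    simpa using hc.apply_eq_of_preconnectedSpace 1 0
  let χ₀ : RawMod A (fun k => (tot V C k).dual) := fun m => (χ ⟨m, 0⟩).1 m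
  -- Smoothness of the glued section: by continuity of the zero section it agrees near `m₀` with the
  -- single section found at the zero vector over `m₀`.
  have hloc : ∀ m₀, ∀ᶠ m in 𝓝 m₀, χ₀ m = (χ ⟨m₀, 0⟩).1 m := by
    intro m₀
    have h0 : Continuous (Bundle.zeroSection V.F V.fiber) :=
      (Bundle.contMDiff_zeroSection (n := ∞) ℝ V.fiber (IB := 𝓡 d)).continuous
    filter_upwards [(h0.tendsto m₀).eventually (hs' ⟨m₀, 0⟩).eventually_nhds] with m hm
    exact (key _ _ hm).symm
  have hhom : χ₀ ∈ HomogMod A (fun k => - totDeg k) (fun k => (tot V C k).dual) p := by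
    refine ⟨fun k m₀ => ?_, fun m k => (hχ ⟨m, 0⟩).2 m k⟩
    obtain ⟨u, hu, h⟩ := (hχ ⟨m₀, 0⟩).1 k m₀
    refine ⟨u, hu, ?_⟩
    filter_upwards [h, hloc m₀] with m h h'
    rw [h']
    exact h
  refine ⟨⟨χ₀, mem_Mod_of_homog hhom⟩, hhom, Subtype.ext (funext fun v => ?_)⟩
  rw [(hs' v).self_of_nhds, lin_apply, lin_apply]
  exact congrArg _ (hline v.1 v.2)

end Bidegree
/-! ### From morphisms of VB-Lie algebroids to morphisms of representations -/

section Morphisms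

variable {d : ℕ} {M : Type u} [TopologicalSpace M] [ChartedSpace (EuclideanSpace ℝ (Fin d)) M]
  {n : ℕ} {V V' : VB d M} {A C C' : Fin n → VB d M} {QA : LieStr A}

lemma neg_one_zpow_smul_cancel {X : Type*} [AddCommGroup X] [Module ℝ X] {p : ℤ} {x y : X}
    (h : (-1 : ℝ) ^ p • x = (-1 : ℝ) ^ p • y) : x = y :=
  smul_right_injective X (zpow_ne_zero p (by norm_num)) h

lemma RepHom.ext_map {κ κ' : Type} {e : κ → ℤ} {e' : κ' → ℤ} {B : κ → VB d M} {B' : κ' → VB d M}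
    {D : Rep e B QA} {D' : Rep e' B' QA} {μ μ' : RepHom D D'} (h : ∀ η, μ.map η = μ'.map η) :
    μ = μ' := by
  obtain ⟨f, _, _⟩ := μ
  obtain ⟨f', _, _⟩ := μ'
  obtain rfl : f = f' := LinearMap.ext h
  rfl

variable [T2Space M] [IsManifold (𝓡 d) ∞ M]
  {QD : VBStr V C QA} {QD' : VBStr V' C' QA} {D : Rep totDeg (tot V C) QA}
  {D' : Rep totDeg (tot V' C') QA}

/-- The restriction of a morphism to linear functions. -/
lemma VBHom.exists_linear_restriction (G : VBHom QD QD') :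
    ∃ ν : DualMod A totDeg (tot V' C') →ₗ[FnA A] DualMod A totDeg (tot V C),
      (∀ p, ∀ ψ ∈ Mod.part A (fun k => - totDeg k) (fun k => (tot V' C' k).dual) p,
        ν ψ ∈ Mod.part A (fun k => - totDeg k) (fun k => (tot V C k).dual) p) ∧
      ∀ ψ, lin V A C (ν ψ) = G.comap (lin V' A C' ψ) := by
  -- Linear functions of degree `p` have bidegree `(1, p - 1)`. This is preserved by `G.comap`, and
  -- functions of this bidegree are linear of degree `p`.
  have h1 : ∀ p, ∀ ψ ∈ Mod.part A (fun k => - totDeg k) (fun k => (tot V' C' k).dual) p,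
      ∃ χ ∈ Mod.part A (fun k => - totDeg k) (fun k => (tot V C k).dual) p,
        G.comap (lin V' A C' ψ) = lin V A C χ := fun p ψ hψ =>
    exists_lin_of_bideg (G.comap_bideg _ _ _ (lin_mem_bideg hψ))
  obtain ⟨ν, hν⟩ := VBLie.exists_linear_restriction (V := V) (V' := V') G.comap.toLinearMap
    (fun ψ => by
      induction ψ using Mod_induction with
      | homog p ψ hψ =>
        obtain ⟨χ, -, h⟩ := h1 p ψ hψ
        exact ⟨χ, h⟩
      | zero => exact ⟨0, by rw [map_zero, map_zero, map_zero]⟩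
      | add ψ ψ' h h' =>
        obtain ⟨χ, h⟩ := h
        obtain ⟨χ', h'⟩ := h'
        exact ⟨χ + χ', by rw [map_add, map_add, map_add, h, h']⟩
      | smul r ψ h =>
        obtain ⟨χ, h⟩ := h
        exact ⟨r • χ, by rw [map_smul, map_smul, map_smul, h]⟩)
  refine ⟨{ ν with map_smul' := fun f ψ => lin_injective ?_ }, fun p ψ hψ => ?_, hν⟩
  · change lin V A C (ν (f • ψ)) = lin V A C (f • ν ψ)
    rw [hν, lin_smul, lin_smul, hν, AlgHom.toLinearMap_apply, map_mul, G.comap_pull]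
    rfl
  · obtain ⟨χ, hχ, h⟩ := h1 p ψ hψ
    have : ν ψ = χ := lin_injective ((hν ψ).trans h)
    change ν ψ ∈ _
    rwa [this]

/-- A morphism of VB-Lie algebroids corresponds to exactly one morphism of representations. -/
theorem existsUnique_repHom (hD : IsAssociated QD D) (hD' : IsAssociated QD' D')
    (G : VBHom QD QD') : ∃! μ : RepHom D D', Corresponds G μ := by
  obtain ⟨ν, hν, hG⟩ := G.exists_linear_restriction
  obtain ⟨μ, hμ, h⟩ := exists_predual_map ν hν
  refine ⟨⟨μ, hμ, fun η => eq_of_pair_left fun k β => ?_⟩, fun ψ => ⟨ν ψ, (hG ψ).symm, h ψ⟩,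
    fun μ' hμ' => RepHom.ext_map fun η => eq_of_pair_left fun k β => ?_⟩
  · have hβ := sec_mem (A := A) (e := fun k => - totDeg k) (B := fun k => (tot V' C' k).dual) k β
    obtain ⟨χ, h1, h2⟩ := hD _ _ (hν _ _ hβ)
    obtain ⟨χ', h1', h2'⟩ := hD' _ _ hβ
    -- `χ'` and `χ` are the dual differentials of `β` and of its image under `ν`; compatibility of
    -- `G` with the vector fields says that `ν` intertwines them.
    have h3 : ν χ' = χ := lin_injective (by rw [← h1, hG, hG, ← h1', G.comm])
    have h4 := h2 η
    have h4' := h2' (μ η)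
    rw [← h χ', h3, ← h, h4] at h4'
    exact (h _ _).symm.trans (neg_one_zpow_smul_cancel (add_left_cancel h4'))
  · obtain ⟨χ, h1, h2⟩ := hμ' (sec A (fun k => - totDeg k) (fun k => (tot V' C' k).dual) k β)
    -- Any other corresponding morphism has the same dual on sections, because a linear function
    -- determines its section.
    have h3 : ν _ = χ := lin_injective ((hG _).trans h1)
    exact (h2 η).symm.trans ((congrArg (pair · η) h3.symm).trans (h _ η))

/-- The dual of a morphism of representations commutes with the homological vector fields. -/
lemma lin_dual_comm (hD : IsAssociated QD D) (hD' : IsAssociated QD' D') (μ : RepHom D D')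
    (ν : DualMod A totDeg (tot V' C') →ₗ[FnA A] DualMod A totDeg (tot V C))
    (hν : ∀ p, ∀ ψ ∈ Mod.part A (fun k => - totDeg k) (fun k => (tot V' C' k).dual) p,
        ν ψ ∈ Mod.part A (fun k => - totDeg k) (fun k => (tot V C k).dual) p)
    (h : ∀ ψ η, pair (ν ψ) η = pair ψ (μ.map η)) {p : ℤ} {ψ : DualMod A totDeg (tot V' C')}
    (hψ : ψ ∈ Mod.part A (fun k => - totDeg k) (fun k => (tot V' C' k).dual) p) :
    ∃ χ, QD'.op (lin V' A C' ψ) = lin V' A C' χ ∧ QD.op (lin V A C (ν ψ)) = lin V A C (ν χ) := by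
  obtain ⟨χ, h1, h2⟩ := hD _ _ (hν _ _ hψ)
  obtain ⟨χ', h1', h2'⟩ := hD' _ _ hψ
  refine ⟨χ', h1', h1.trans (congrArg _ (eq_of_pair_right fun k b => ?_))⟩
  set η := sec A totDeg (tot V C) k b
  have h4 := h2 η
  have h4' := h2' (μ.map η)
  rw [← h, ← μ.comm, ← h ψ (D.op η), ← h χ', h4] at h4'
  exact add_right_cancel h4'

end Morphisms
/-! ### Homomorphisms of algebras of functions -/

section PointDerivation

variable {EN HN : Type*} [NormedAddCommGroup EN] [NormedSpace ℝ EN] [FiniteDimensional ℝ EN]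
  [TopologicalSpace HN] {J : ModelWithCorners ℝ EN HN}
  {N : Type*} [TopologicalSpace N] [ChartedSpace HN N] [IsManifold J ∞ N] [T2Space N]
  {Z : Type*} [AddCommGroup Z] [Module ℝ Z]

/-- For a cut-off `ρ` supported where `f = g`, the product `ρ * (f - g)` is zero. Since `f - g`
vanishes at `x₀` and `ρ x₀ = 1`, the Leibniz rule leaves only `δ (f - g)`. -/
lemma pointDerivation_congr {x₀ : N} (δ : C^∞⟮J, N; 𝓘(ℝ, ℝ), ℝ⟯ →ₗ[ℝ] Z)
    (hδ : ∀ f g, δ (f * g) = f x₀ • δ g + g x₀ • δ f) {f g : C^∞⟮J, N; 𝓘(ℝ, ℝ), ℝ⟯}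
    (h : ∀ᶠ x in 𝓝 x₀, f x = g x) : δ f = δ g := by
  obtain ⟨ρ, h1, h2⟩ := exists_bump J h
  have h3 : ρ * (f - g) = 0 := by
    ext x
    change ρ x * (f x - g x) = 0
    by_cases hx : x ∈ tsupport ρ
    · rw [show f x = g x from h2 hx, sub_self, mul_zero]
    · rw [image_eq_zero_of_notMem_tsupport hx, zero_mul]
  have h4 := hδ ρ (f - g)
  rw [h3, map_zero, show (f - g) x₀ = f x₀ - g x₀ from rfl, h.self_of_nhds, h1.self_of_nhds,
    sub_self, zero_smul, one_smul, add_zero, map_sub] at h4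
  exact sub_eq_zero.1 h4.symm

/-- A derivation at a point vanishes if it vanishes on the coordinate functions. -/
lemma pointDerivation_eq_zero [J.Boundaryless] {x₀ : N} (δ : C^∞⟮J, N; 𝓘(ℝ, ℝ), ℝ⟯ →ₗ[ℝ] Z)
    (hδ : ∀ f g, δ (f * g) = f x₀ • δ g + g x₀ • δ f)
    (h : ∀ l : EN →L[ℝ] ℝ, ∃ f : C^∞⟮J, N; 𝓘(ℝ, ℝ), ℝ⟯, δ f = 0 ∧
      ∀ᶠ x in 𝓝 x₀, f x = l (extChartAt J x₀ x - extChartAt J x₀ x₀)) : δ = 0 := by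
  refine LinearMap.ext fun f => ?_
  have h1 : δ 1 = 0 := by
    have := hδ 1 1
    rw [mul_one, show (1 : C^∞⟮J, N; 𝓘(ℝ, ℝ), ℝ⟯) x₀ = 1 from rfl, one_smul] at this
    exact left_eq_add.1 this
  let c := Module.finBasis ℝ EN
  obtain ⟨g, hg⟩ := exists_hadamard_manifold c f x₀
  choose x hx hx' using fun i => h (LinearMap.toContinuousLinearMap (c.coord i))
  -- Hadamard's formula, with the coordinate differences replaced by global functions `x i` of the
  -- same germ that `δ` kills.
  have h2 : δ f = δ (f x₀ • 1 + ∑ i, x i * g i) := by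
    refine pointDerivation_congr δ hδ ?_
    filter_upwards [hg, Filter.eventually_all.2 hx'] with y hy hy'
    rw [hy]
    change _ = f x₀ • (1 : ℝ) + (∑ i, x i * g i : C^∞⟮J, N; 𝓘(ℝ, ℝ), ℝ⟯) y
    rw [smul_eq_mul, mul_one]
    congr 1
    have : (∑ i, x i * g i : C^∞⟮J, N; 𝓘(ℝ, ℝ), ℝ⟯) y = ∑ i, (x i * g i) y :=
      map_sum (ContMDiffMap.evalRingHom (I := J) (I' := 𝓘(ℝ, ℝ)) (n := ∞) (R := ℝ) y) _ _
    rw [this]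
    refine Finset.sum_congr rfl fun i _ => ?_
    change _ = x i y * g i y
    rw [hy' i]
    rfl
  rw [h2, map_add, map_smul, h1, smul_zero, zero_add, map_sum]
  refine Finset.sum_eq_zero fun i _ => ?_
  -- Both Leibniz terms of `x i * g i` vanish: one since `x i` is zero at `x₀`, the other since `δ
  -- (x i) = 0`.
  have h3 : x i x₀ = 0 := by
    rw [(hx' i).self_of_nhds, sub_self, map_zero]
  rw [hδ, hx, h3, zero_smul, smul_zero, add_zero]

end PointDerivation

/-! ### Locality of homomorphisms; compatibility with vector fields -/

section Locality

variable {d : ℕ} {M : Type u} [TopologicalSpace M] [ChartedSpace (EuclideanSpace ℝ (Fin d)) M]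
  {EN HN : Type*} [NormedAddCommGroup EN] [NormedSpace ℝ EN] [TopologicalSpace HN]
  {J : ModelWithCorners ℝ EN HN} {N : Type u} [TopologicalSpace N] [ChartedSpace HN N]
  {q : N → M} {κ : Type} {deg : κ → ℕ} {W : κ → VB d M}

variable (J q deg W) in
/-- A section of `W k` as a function. -/
def Fn.ofSec (k : κ) (a : (W k).Sec) : Fn J q deg W :=
  ⟨Raw.ofSec deg k a, mem_Fn_of_homog (ofSec_mem_homog k a)⟩

lemma Fn.ofFun_mem_part (f : C^∞⟮J, N; 𝓘(ℝ, ℝ), ℝ⟯) :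
    Fn.ofFun q deg W f ∈ Fn.part J q deg W 0 := ofFun_mem_homog f.contMDiff

lemma Fn.ofSec_mem_part (k : κ) (a : (W k).Sec) :
    Fn.ofSec J q deg W k a ∈ Fn.part J q deg W (deg k) := ofSec_mem_homog k a

/-- The inclusion of the smooth functions on the base. -/
def Fn.ofFunHom : C^∞⟮J, N; 𝓘(ℝ, ℝ), ℝ⟯ →ₐ[ℝ] Fn J q deg W where
  toFun := Fn.ofFun q deg W
  map_one' := Subtype.ext (funext fun _ => map_one (algebraMap ℝ _))
  map_mul' f g := Subtype.ext (funext fun y => map_mul (algebraMap ℝ _) (f y) (g y))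
  map_zero' := Subtype.ext (funext fun _ => map_zero (algebraMap ℝ _))
  map_add' f g := Subtype.ext (funext fun y => map_add (algebraMap ℝ _) (f y) (g y))
  commutes' _ := rfl

lemma Fn.ofFun_mul_apply (f : C^∞⟮J, N; 𝓘(ℝ, ℝ), ℝ⟯) (s : Fn J q deg W) (x : N) :
    (Fn.ofFun q deg W f * s).1 x = f x • s.1 x :=
  (Algebra.smul_def (f x) (s.1 x)).symm

lemma Poly_induction {P : Fn J q deg W → Prop} (ofFun : ∀ f, P (Fn.ofFun q deg W f))
    (ofSec : ∀ k a, P (Fn.ofSec J q deg W k a)) (algebraMap : ∀ r, P (algebraMap ℝ _ r))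
    (add : ∀ s t, P s → P t → P (s + t)) (mul : ∀ s t, P s → P t → P (s * t))
    {s : Fn J q deg W} (hs : s.1 ∈ Poly J q deg W) : P s := by
  obtain ⟨s, h⟩ := s
  suffices ∃ h, P ⟨s, h⟩ from this.2
  change s ∈ Poly J q deg W at hs
  clear h
  induction hs using Algebra.adjoin_induction with
  | mem x hx =>
    rcases hx with ⟨f, hf, rfl⟩ | ⟨k, a, rfl⟩
    · exact ⟨_, ofFun ⟨f, hf⟩⟩
    · exact ⟨_, ofSec k a⟩
  | algebraMap r => exact ⟨_, algebraMap r⟩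
  | add x y _ _ h h' => exact ⟨_, add _ _ h.2 h'.2⟩
  | mul x y _ _ h h' => exact ⟨_, mul _ _ h.2 h'.2⟩

lemma exists_poly_eventuallyEq (s : Fn J q deg W) (x₀ : N) :
    ∃ t : Fn J q deg W, t.1 ∈ Poly J q deg W ∧ ∀ᶠ x in 𝓝 x₀, s.1 x = t.1 x := by
  obtain ⟨t, ht, h⟩ := smooth_of_mem_Fn s.2 x₀
  exact ⟨⟨t, poly_le_Fn ht⟩, ht, h⟩

variable [FiniteDimensional ℝ EN] [IsManifold J ∞ N] [T2Space N]

lemma exists_bump_mul_eq {s t : Fn J q deg W} {x₀ : N} (h : ∀ᶠ x in 𝓝 x₀, s.1 x = t.1 x) :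
    ∃ ρ : C^∞⟮J, N; 𝓘(ℝ, ℝ), ℝ⟯, ρ x₀ = 1 ∧
      Fn.ofFun q deg W ρ * s = Fn.ofFun q deg W ρ * t := by
  obtain ⟨ρ, h1, h2⟩ := exists_bump J h
  refine ⟨ρ, h1.self_of_nhds, Subtype.ext (funext fun x => ?_)⟩
  rw [Fn.ofFun_mul_apply, Fn.ofFun_mul_apply]
  by_cases hx : x ∈ tsupport ρ
  · rw [show s.1 x = t.1 x from h2 hx]
  · rw [image_eq_zero_of_notMem_tsupport hx, zero_smul, zero_smul]

variable {EN' HN' : Type*} [NormedAddCommGroup EN'] [NormedSpace ℝ EN'] [TopologicalSpace HN']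
  {J' : ModelWithCorners ℝ EN' HN'} {N' : Type u} [TopologicalSpace N'] [ChartedSpace HN' N']
  {q' : N' → M} {κ' : Type} {deg' : κ' → ℕ} {W' : κ' → VB d M} {g : N' → N}

/-- The hypothesis says that `φ` covers `g`. A cut-off equal to `1` at `g x` therefore becomes the
scalar `1` at `x`, and the value of `φ s` at `x` depends only on the germ of `s` at `g x`. -/
lemma algHom_apply_congr {φ : Fn J q deg W →ₐ[ℝ] Fn J' q' deg' W'}
    (hφ : ∀ f x, (φ (Fn.ofFun q deg W f)).1 x = algebraMap ℝ _ (f (g x))) {s t : Fn J q deg W}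
    {x : N'} (h : ∀ᶠ y in 𝓝 (g x), s.1 y = t.1 y) : (φ s).1 x = (φ t).1 x := by
  obtain ⟨ρ, h1, h2⟩ := exists_bump_mul_eq h
  have h3 := congrFun (congrArg Subtype.val (congrArg φ h2)) x
  rw [map_mul, map_mul] at h3
  change (φ (Fn.ofFun q deg W ρ)).1 x * (φ s).1 x = (φ (Fn.ofFun q deg W ρ)).1 x * (φ t).1 x at h3
  rwa [hφ, h1, map_one, one_mul, one_mul] at h3

/-- Morphisms of graded manifolds are determined by the map of the bases and the pull-backs of
the sections. -/
lemma algHom_eq {φ φ' : Fn J q deg W →ₐ[ℝ] Fn J' q' deg' W'}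
    (hφ : ∀ f x, (φ (Fn.ofFun q deg W f)).1 x = algebraMap ℝ _ (f (g x)))
    (hφ' : ∀ f x, (φ' (Fn.ofFun q deg W f)).1 x = algebraMap ℝ _ (f (g x)))
    (h : ∀ k a, φ (Fn.ofSec J q deg W k a) = φ' (Fn.ofSec J q deg W k a)) : φ = φ' := by
  refine AlgHom.ext fun s => Subtype.ext (funext fun x => ?_)
  obtain ⟨t, ht, hs⟩ := exists_poly_eventuallyEq s (g x)
  rw [algHom_apply_congr hφ hs, algHom_apply_congr hφ' hs]
  suffices φ t = φ' t by rw [this]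
  refine Poly_induction (P := fun t => φ t = φ' t) (fun f => ?_) h (fun r => ?_) ?_ ?_ ht
  · exact Subtype.ext (funext fun x => (hφ f x).trans (hφ' f x).symm)
  · rw [AlgHom.commutes, AlgHom.commutes]
  · intro s t hs ht
    rw [map_add, map_add, hs, ht]
  · intro s t hs ht
    rw [map_mul, map_mul, hs, ht]

/-- The failure of a homomorphism to commute with homological vector fields. -/
def defect (φ : Fn J q deg W →ₐ[ℝ] Fn J' q' deg' W') (Q : HomVF J q deg W)
    (Q' : HomVF J' q' deg' W') : Fn J q deg W →ₗ[ℝ] Fn J' q' deg' W' :=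
  φ.toLinearMap ∘ₗ Q.op - Q'.op ∘ₗ φ.toLinearMap

variable {φ : Fn J q deg W →ₐ[ℝ] Fn J' q' deg' W'} {Q : HomVF J q deg W}
    {Q' : HomVF J' q' deg' W'}

lemma defect_apply (s : Fn J q deg W) : defect φ Q Q' s = φ (Q.op s) - Q'.op (φ s) := rfl

/-- The defect is a derivation of degree one along `φ`; as `φ` preserves degrees, the Leibniz rules
of `Q` and `Q'` carry the same sign. -/
lemma defect_mul (hpart : ∀ i, ∀ s ∈ Fn.part J q deg W i, φ s ∈ Fn.part J' q' deg' W' i) {i : ℕ}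
    {s : Fn J q deg W} (hs : s ∈ Fn.part J q deg W i) (t : Fn J q deg W) :
    defect φ Q Q' (s * t) =
      defect φ Q Q' s * φ t + (-1 : ℝ) ^ i • (φ s * defect φ Q Q' t) := by
  simp only [defect_apply]
  rw [Q.leibniz i s hs, map_add, map_smul, map_mul, map_mul, map_mul,
    Q'.leibniz i _ (hpart i s hs), sub_mul, mul_sub, smul_sub]
  abel

/-- A morphism of graded manifolds commutes with homological vector fields if it does so on
generators. -/
lemma comm_of_generators [J.Boundaryless]
    (hφ : ∀ f x, (φ (Fn.ofFun q deg W f)).1 x = algebraMap ℝ _ (f (g x)))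
    (hpart : ∀ i, ∀ s ∈ Fn.part J q deg W i, φ s ∈ Fn.part J' q' deg' W' i)
    (hsec : ∀ k a, defect φ Q Q' (Fn.ofSec J q deg W k a) = 0)
    (hcoord : ∀ x₀ : N, ∀ l : EN →L[ℝ] ℝ, ∃ f : C^∞⟮J, N; 𝓘(ℝ, ℝ), ℝ⟯,
      defect φ Q Q' (Fn.ofFun q deg W f) = 0 ∧
      ∀ᶠ x in 𝓝 x₀, f x = l (extChartAt J x₀ x - extChartAt J x₀ x₀)) (s : Fn J q deg W) :
    φ (Q.op s) = Q'.op (φ s) := by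
  have hmul : ∀ (f : C^∞⟮J, N; 𝓘(ℝ, ℝ), ℝ⟯) (s : Fn J q deg W) (x : N'),
      (defect φ Q Q' (Fn.ofFun q deg W f * s)).1 x =
        (defect φ Q Q' (Fn.ofFun q deg W f)).1 x * (φ s).1 x +
          f (g x) • (defect φ Q Q' s).1 x := by
    intro f s x
    rw [defect_mul hpart (Fn.ofFun_mem_part f), pow_zero, one_smul]
    change _ + (φ (Fn.ofFun q deg W f)).1 x * (defect φ Q Q' s).1 x = _
    rw [hφ, ← Algebra.smul_def]
    rfl
  -- For fixed `x`, the value at `x` of the defect on functions is a point derivation at `g x` with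
  -- values in the fibre algebra, so it is determined by the coordinates.
  have hfun : ∀ f, defect φ Q Q' (Fn.ofFun q deg W f) = 0 := by
    intro f
    refine Subtype.ext (funext fun x => ?_)
    let δ : C^∞⟮J, N; 𝓘(ℝ, ℝ), ℝ⟯ →ₗ[ℝ] GSym deg' (fun k => (W' k).fiber (q' x)) :=
      (LinearMap.proj x ∘ₗ (Fn J' q' deg' W').val.toLinearMap) ∘ₗ defect φ Q Q' ∘ₗ
        Fn.ofFunHom.toLinearMap
    have hδ : δ = 0 := by
      refine pointDerivation_eq_zero (x₀ := g x) δ (fun f f' => ?_) fun l => ?_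
      · change (defect φ Q Q' (Fn.ofFunHom (f * f'))).1 x = _
        rw [map_mul]
        change (defect φ Q Q' (Fn.ofFun q deg W f * Fn.ofFun q deg W f')).1 x = _
        rw [hmul, hφ, ← Algebra.commutes, ← Algebra.smul_def, add_comm]
        rfl
      · obtain ⟨f, h1, h2⟩ := hcoord (g x) l
        exact ⟨f, congrFun (congrArg Subtype.val h1) x, h2⟩
    exact congrFun (congrArg DFunLike.coe hδ) f
  have hpoly : ∀ t : Fn J q deg W, t.1 ∈ Poly J q deg W → defect φ Q Q' t = 0 := by
    intro t ht
    have key : ∀ i, ∀ s ∈ Fn.part J q deg W i, defect φ Q Q' s = 0 →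
        ∀ u, defect φ Q Q' u = 0 → defect φ Q Q' (s * u) = 0 := by
      intro i s hs h u hu
      rw [defect_mul hpart hs, h, hu, zero_mul, mul_zero, smul_zero, add_zero]
    have h1 : defect φ Q Q' (1 : Fn J q deg W) = 0 := by
      rw [← map_one (Fn.ofFunHom (J := J) (q := q) (deg := deg) (W := W))]
      exact hfun 1
    -- A polynomial need not be homogeneous, whereas the Leibniz rule needs a homogeneous left
    -- factor. The induction therefore shows that multiplication by `t` preserves the kernel of the
    -- defect; only generators are then used as left factors.
    have := Poly_induction (P := fun t => ∀ u, defect φ Q Q' u = 0 → defect φ Q Q' (t * u) = 0)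
      (fun f => key 0 _ (Fn.ofFun_mem_part f) (hfun f))
      (fun k a => key _ _ (Fn.ofSec_mem_part k a) (hsec k a))
      (fun r u hu => by rw [← Algebra.smul_def, map_smul, hu, smul_zero])
      (fun s t hs ht u hu => by rw [add_mul, map_add, hs u hu, ht u hu, add_zero])
      (fun s t hs ht u hu => by rw [mul_assoc]; exact hs _ (ht u hu)) ht 1 h1
    rwa [mul_one] at this
  suffices defect φ Q Q' s = 0 from sub_eq_zero.1 this
  refine Subtype.ext (funext fun x => ?_)
  obtain ⟨t, ht, hs⟩ := exists_poly_eventuallyEq s (g x)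
  obtain ⟨ρ, h1, h2⟩ := exists_bump_mul_eq hs
  have h3 := hmul ρ s x
  -- The products of `s` and of the polynomial `t` with `ρ` coincide, and the defect vanishes on `ρ`
  -- and on `t`; the Leibniz rule at `x` leaves the defect of `s`.
  have h4 := hmul ρ t x
  rw [h2, h4, hpoly t ht, hfun ρ, h1] at h3
  simpa using h3.symm

end Locality
/-! ### Coordinates on the total space of a vector bundle -/

namespace VB

variable {d : ℕ} {M : Type u} [TopologicalSpace M] [ChartedSpace (EuclideanSpace ℝ (Fin d)) M]
  (B : VB d M)

/-- A smooth function on the base as a function on the total space. -/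
def pullFun (f : C^∞⟮𝓡 d, M; 𝓘(ℝ, ℝ), ℝ⟯) : C^∞⟮B.model, B.Total; 𝓘(ℝ, ℝ), ℝ⟯ :=
  ⟨f ∘ B.proj, f.contMDiff.comp (Bundle.contMDiff_proj B.fiber)⟩

/-- The smooth function `ℓ_ψ`. -/
def linSmooth (ψ : B.dual.Sec) : C^∞⟮B.model, B.Total; 𝓘(ℝ, ℝ), ℝ⟯ :=
  ⟨B.linFun ψ, B.contMDiff_linFun ψ⟩

lemma trivialization_sum (e : Bundle.Trivialization B.F (Bundle.TotalSpace.proj : B.Total → M))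
    [e.IsLinear ℝ] {m : M} (hm : m ∈ e.baseSet) {ι : Type*} (s : Finset ι) (c : ι → ℝ)
    (b : ι → B.fiber m) :
    (e (⟨m, ∑ j ∈ s, c j • b j⟩ : B.Total)).2 = ∑ j ∈ s, c j • (e (⟨m, b j⟩ : B.Total)).2 := by
  have h : ∀ y : B.fiber m, (e (⟨m, y⟩ : B.Total)).2 = e.linearMapAt ℝ m y := fun y => by
    rw [e.coe_linearMapAt_of_mem hm]
  simp only [h, map_sum, map_smul]

variable [IsManifold (𝓡 d) ∞ M]

/-- In the trivialization at `g x₀`, which is linear on fibres, the fibre component is a finite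
combination of smooth vector-valued functions. -/
lemma contMDiffAt_sum_section {EN HN : Type*} [NormedAddCommGroup EN] [NormedSpace ℝ EN]
    [TopologicalSpace HN] {J : ModelWithCorners ℝ EN HN} {N : Type*} [TopologicalSpace N]
    [ChartedSpace HN N] {g : N → M} {x₀ : N} (hg : ContMDiffAt J (𝓡 d) ∞ g x₀)
    {ι : Type*} (s : Finset ι) {f : ι → N → ℝ} (hf : ∀ j, ContMDiffAt J 𝓘(ℝ, ℝ) ∞ (f j) x₀)
    (b : ι → B.Sec) : ContMDiffAt J B.model ∞
      (fun x => (⟨g x, ∑ j ∈ s, f j x • b j (g x)⟩ : B.Total)) x₀ := by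
  rw [Bundle.contMDiffAt_totalSpace]
  refine ⟨hg, ?_⟩
  let e := trivializationAt B.F B.fiber (g x₀)
  have h1 : ∀ᶠ x in 𝓝 x₀, g x ∈ e.baseSet := hg.continuousAt.eventually
    (e.open_baseSet.mem_nhds (FiberBundle.mem_baseSet_trivializationAt' (g x₀)))
  have h2 : ∀ j, ContMDiffAt J 𝓘(ℝ, B.F) ∞ (fun x => (e (⟨g x, b j (g x)⟩ : B.Total)).2) x₀ :=
    fun j => ((Bundle.contMDiffAt_section _).1 (b j).contMDiff.contMDiffAt).comp x₀ hg
  have h3 : ContMDiffAt J 𝓘(ℝ, B.F) ∞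
      (fun x => ∑ j ∈ s, f j x • (e (⟨g x, b j (g x)⟩ : B.Total)).2) x₀ :=
    contMDiffAt_finsetSum fun j _ => (hf j).smul (h2 j)
  refine h3.congr_of_eventuallyEq ?_
  filter_upwards [h1] with x hx
  exact B.trivialization_sum e hx s _ _

variable [T2Space M]

/-- Coordinates on the total space are combinations of functions on the base and fibrewise linear
functions. -/
lemma exists_coordinate (w₀ : B.Total) (l : EuclideanSpace ℝ (Fin d) × B.F →L[ℝ] ℝ) :
    ∃ (r : ℕ) (f₀ : C^∞⟮𝓡 d, M; 𝓘(ℝ, ℝ), ℝ⟯) (f : Fin r → C^∞⟮𝓡 d, M; 𝓘(ℝ, ℝ), ℝ⟯)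
      (β : Fin r → B.dual.Sec), ∀ᶠ w in 𝓝 w₀,
        (B.pullFun f₀ + ∑ j, B.pullFun (f j) * B.linSmooth (β j) :
          C^∞⟮B.model, B.Total; 𝓘(ℝ, ℝ), ℝ⟯) w =
          l (extChartAt B.model w₀ w - extChartAt B.model w₀ w₀) := by
  let m₀ := w₀.proj
  let e := trivializationAt B.F B.fiber m₀
  have hm₀ : m₀ ∈ e.baseSet := FiberBundle.mem_baseSet_trivializationAt' m₀
  obtain ⟨r, b, β, hb⟩ := B.exists_frame m₀
  let c := extChartAt B.model w₀ w₀
  -- The part of the coordinate that comes from the base; the constant `l c` of the base point is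
  -- absorbed here.
  have h0 : ContMDiffOn (𝓡 d) 𝓘(ℝ, ℝ) ∞ (fun m => l (extChartAt (𝓡 d) m₀ m, 0) - l c)
      (chartAt (EuclideanSpace ℝ (Fin d)) m₀).source := by
    have h1 : ContMDiff 𝓘(ℝ, EuclideanSpace ℝ (Fin d)) 𝓘(ℝ, ℝ) ∞
        (fun a : EuclideanSpace ℝ (Fin d) => l (a, 0) - l c) := by
      refine ContDiff.contMDiff ?_
      fun_prop
    exact h1.comp_contMDiffOn contMDiffOn_extChartAt
  obtain ⟨f₀, hf₀⟩ := exists_smooth_eventuallyEq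
    (chartAt (EuclideanSpace ℝ (Fin d)) m₀).open_source (mem_chart_source _ m₀) h0
  -- The fibre part of `l` is linear, so it is a combination of the coordinates `ℓ_{β j}` whose
  -- coefficients are its values on the frame `b`.
  have h1 (j) : ContMDiffOn (𝓡 d) 𝓘(ℝ, ℝ) ∞ (fun m => l (0, (e (⟨m, b j m⟩ : B.Total)).2))
      e.baseSet := by
    have h2 : ContMDiff 𝓘(ℝ, B.F) 𝓘(ℝ, ℝ) ∞ (fun y : B.F => l (0, y)) := by
      refine ContDiff.contMDiff ?_
      fun_prop
    exact h2.comp_contMDiffOn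
      (e.contMDiffOn_section_baseSet_iff.1 (b j).contMDiff.contMDiffOn)
  choose f hf using fun j => exists_smooth_eventuallyEq e.open_baseSet hm₀ (h1 j)
  refine ⟨r, f₀, f, β, ?_⟩
  have hall := ((hf₀.and (Filter.eventually_all.2 hf)).and hb).and (e.open_baseSet.mem_nhds hm₀)
  filter_upwards [continuous_proj.continuousAt.eventually hall] with w hw
  obtain ⟨⟨⟨hw0, hw1⟩, hw2⟩, hw3⟩ := hw
  have hsum : (∑ j, B.pullFun (f j) * B.linSmooth (β j) : C^∞⟮B.model, B.Total; 𝓘(ℝ, ℝ), ℝ⟯) w =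
      ∑ j, f j w.proj * B.linFun (β j) w :=
    map_sum (ContMDiffMap.evalRingHom (I := B.model) (I' := 𝓘(ℝ, ℝ)) (n := ∞) (R := ℝ) w) _ _
  change f₀ w.proj + (∑ j, B.pullFun (f j) * B.linSmooth (β j) :
    C^∞⟮B.model, B.Total; 𝓘(ℝ, ℝ), ℝ⟯) w = l (extChartAt B.model w₀ w - c)
  have hfst : (e w).1 = w.proj := e.coe_fst' hw3
  have hchart : extChartAt B.model w₀ w = (extChartAt (𝓡 d) m₀ w.proj, (e w).2) := by
    rw [FiberBundle.extChartAt]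
    change (extChartAt (𝓡 d) m₀ (e w).1, (e w).2) = _
    rw [hfst]
  have hfib : (e w).2 = ∑ j, B.linFun (β j) w • (e (⟨w.proj, b j w.proj⟩ : B.Total)).2 := by
    rw [← B.trivialization_sum e hw3]
    congr 2
    exact congrArg (Bundle.TotalSpace.mk w.proj) (hw2 w.2)
  have hl : l (extChartAt (𝓡 d) m₀ w.proj, (e w).2) =
      l (extChartAt (𝓡 d) m₀ w.proj, 0) + l (0, (e w).2) := by
    rw [← map_add]
    simp
  have hl2 : l (0, (e w).2) = ∑ j, B.linFun (β j) w • l (0, (e (⟨w.proj, b j w.proj⟩ : B.Total)).2) := by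
    rw [hfib]
    have := map_sum (l.comp (ContinuousLinearMap.inr ℝ (EuclideanSpace ℝ (Fin d)) B.F))
      (fun j => B.linFun (β j) w • (e (⟨w.proj, b j w.proj⟩ : B.Total)).2) Finset.univ
    simp only [map_smul] at this
    exact this
  rw [hsum, hw0, map_sub, hchart, hl, hl2]
  have : ∑ j, f j w.proj * B.linFun (β j) w =
      ∑ j, B.linFun (β j) w • l (0, (e (⟨w.proj, b j w.proj⟩ : B.Total)).2) :=
    Finset.sum_congr rfl fun j _ => by rw [hw1 j, smul_eq_mul, mul_comm]
  rw [this]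
  ring

lemma eq_of_smooth_eq {m m' : M} (h : ∀ f : C^∞⟮𝓡 d, M; 𝓘(ℝ, ℝ), ℝ⟯, f m = f m') : m = m' := by
  by_contra hne
  obtain ⟨ρ, h1, h2⟩ := exists_bump (𝓡 d) (isOpen_compl_singleton.mem_nhds hne)
  have h3 := h ρ
  rw [h1.self_of_nhds, image_eq_zero_of_notMem_tsupport fun h4 => h2 h4 rfl] at h3
  exact one_ne_zero h3

/-- Points of the total space are separated by functions on the base and linear functions. -/
lemma eq_of_functions_eq {w w' : B.Total}
    (h : ∀ f : C^∞⟮𝓡 d, M; 𝓘(ℝ, ℝ), ℝ⟯, f w.proj = f w'.proj)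
    (h' : ∀ ψ, B.linFun ψ w = B.linFun ψ w') : w = w' := by
  obtain ⟨m, y⟩ := w
  obtain ⟨m', y'⟩ := w'
  obtain rfl : m = m' := eq_of_smooth_eq h
  congr 1
  rw [B.dp.frame_eq m y, B.dp.frame_eq m y']
  exact Finset.sum_congr rfl fun j _ => congrArg (· • _) (h' (B.dp.cofr m j))

end VB

/-! ### A morphism is determined by its linear part -/

section Uniqueness

variable {d : ℕ} {M : Type u} [TopologicalSpace M] [ChartedSpace (EuclideanSpace ℝ (Fin d)) M]
  {n : ℕ} {V V' : VB d M} {A C C' : Fin n → VB d M} {QA : LieStr A}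

lemma pull_cf (f : C^∞⟮𝓡 d, M; 𝓘(ℝ, ℝ), ℝ⟯) :
    pull V A C (cf A f) = Fn.ofFun V.proj dgD (coframe A C) (V.pullFun f) :=
  Subtype.ext (pullRaw_ofFun f)

lemma pull_ofSec (i : Fin n) (α : (A i).dual.Sec) :
    pull V A C (Fn.ofSec (𝓡 d) (fun m : M => m) dg (fun i => (A i).dual) i α) =
      Fn.ofSec V.model V.proj dgD (coframe A C) (Sum.inl i) α :=
  Subtype.ext (pullRaw_ofSec i α)

lemma lin_lsec_none (ψ : V.dual.Sec) :
    lin V A C (lsec V A C none ψ) = Fn.ofFun V.proj dgD (coframe A C) (V.linSmooth ψ) :=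
  Subtype.ext (lin_sec_none ψ)

lemma lin_lsec_some (i : Fin n) (γ : (C i).dual.Sec) :
    lin V A C (lsec V A C (some i) γ) =
      Fn.ofSec V.model V.proj dgD (coframe A C) (Sum.inr i) γ :=
  Subtype.ext (lin_sec_some i γ)

/-- The augmentation recovers the scalar from its image in the fibre algebra. -/
lemma ofFun_injective {EN HN : Type*} [NormedAddCommGroup EN] [NormedSpace ℝ EN]
    [TopologicalSpace HN] {J : ModelWithCorners ℝ EN HN} {N : Type u} [TopologicalSpace N]
    [ChartedSpace HN N] {q : N → M} {κ : Type} {deg : κ → ℕ} {W : κ → VB d M}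
    {f g : C^∞⟮J, N; 𝓘(ℝ, ℝ), ℝ⟯} (h : Fn.ofFun q deg W f = Fn.ofFun q deg W g) (x : N) :
    f x = g x := by
  have h1 := congrArg GSym.aug (congrFun (congrArg Subtype.val h) x)
  change GSym.aug (algebraMap ℝ _ (f x)) = GSym.aug (algebraMap ℝ _ (g x)) at h1
  rwa [AlgHom.commutes, AlgHom.commutes] at h1

variable [T2Space M] [IsManifold (𝓡 d) ∞ M]
  {QD : VBStr V C QA} {QD' : VBStr V' C' QA} {D : Rep totDeg (tot V C) QA}
  {D' : Rep totDeg (tot V' C') QA}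

/-- A morphism of VB-Lie algebroids is determined by its restriction to linear functions. -/
lemma VBHom.eq_of_lin {G G' : VBHom QD QD'}
    (h : ∀ ψ, G.comap (lin V' A C' ψ) = G'.comap (lin V' A C' ψ)) : G = G' := by
  -- Functions pulled back from `M` are basic, so a morphism acting trivially on them has a side map
  -- over the identity of `M`.
  have hproj : ∀ (G : VBHom QD QD') (f : C^∞⟮𝓡 d, M; 𝓘(ℝ, ℝ), ℝ⟯) v,
      f (G.base v).proj = f v.proj := by
    intro G f v
    have h1 := G.comap_pull (cf A f)
    rw [pull_cf, pull_cf, G.comap_ofFun] at h1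
    exact ofFun_injective h1 v
  have hbase : G.base = G'.base := by
    ext1 v
    refine V'.eq_of_functions_eq (fun f => by rw [hproj, hproj]) fun ψ => ?_
    have h1 := h (lsec V' A C' none ψ)
    rw [lin_lsec_none, G.comap_ofFun, G'.comap_ofFun] at h1
    exact ofFun_injective h1 v
  -- The generators from the side A are basic and those from the core are linear, so both
  -- homomorphisms agree on every section.
  have hcomap : G.comap = G'.comap := by
    refine algHom_eq (g := G.base) (fun f v => ?_) (fun f v => ?_) fun k a => ?_
    · rw [G.comap_ofFun]; rfl
    · rw [G'.comap_ofFun, hbase]; rfl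
    · rcases k with i | i
      · exact (congrArg G.comap (pull_ofSec i a)).symm.trans ((G.comap_pull _).trans
          ((G'.comap_pull _).symm.trans (congrArg G'.comap (pull_ofSec i a))))
      · exact (congrArg G.comap (lin_lsec_some i a)).symm.trans ((h _).trans
          (congrArg G'.comap (lin_lsec_some i a)))
  obtain ⟨b, c, _, _, _, _, _⟩ := G
  obtain ⟨b', c', _, _, _, _, _⟩ := G'
  obtain rfl : b = b' := hbase
  obtain rfl : c = c' := hcomap
  rfl

/-- Both restrictions to linear functions are dual to `μ`, and the dual is unique by nondegeneracy.
-/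
lemma Corresponds.unique {G G' : VBHom QD QD'} {μ : RepHom D D'} (h : Corresponds G μ)
    (h' : Corresponds G' μ) : G = G' := by
  refine VBHom.eq_of_lin fun ψ => ?_
  obtain ⟨χ, h1, h2⟩ := h ψ
  obtain ⟨χ', h1', h2'⟩ := h' ψ
  rw [h1, h1', eq_of_pair_right (ψ := χ) (ψ' := χ') fun k b => (h2 _).trans (h2' _).symm]

end Uniqueness
/-! ### From morphisms of representations to morphisms of VB-Lie algebroids -/

section Construction

variable {d : ℕ} {M : Type u} [TopologicalSpace M] [ChartedSpace (EuclideanSpace ℝ (Fin d)) M]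
  {n : ℕ} {V V' : VB d M} {A C C' : Fin n → VB d M}

/-- The augmentation kills the sections among the generators, so a local polynomial is sent to a
polynomial in its smooth coefficients. -/
lemma contMDiff_aug {EN HN : Type*} [NormedAddCommGroup EN] [NormedSpace ℝ EN]
    [TopologicalSpace HN] {J : ModelWithCorners ℝ EN HN} {N : Type u} [TopologicalSpace N]
    [ChartedSpace HN N] {q : N → M} {κ : Type} {deg : κ → ℕ} {W : κ → VB d M}
    {s : Raw q deg W} (hs : s ∈ Smooth J q deg W) :
    ContMDiff J 𝓘(ℝ, ℝ) ∞ (fun x => GSym.aug (s x)) := by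
  intro x₀
  obtain ⟨t, ht, h⟩ := hs x₀
  have h1 : ContMDiff J 𝓘(ℝ, ℝ) ∞ (fun x => GSym.aug (t x)) := by
    clear h
    induction ht using Algebra.adjoin_induction with
    | mem x hx =>
      rcases hx with ⟨f, hf, rfl⟩ | ⟨k, a, rfl⟩
      · simpa [Raw.ofFun] using hf
      · simpa [Raw.ofSec] using contMDiff_const
    | algebraMap r => simpa using contMDiff_const
    | add x y _ _ h h' =>
      simp only [Pi.add_apply, map_add]
      exact h.add h'
    | mul x y _ _ h h' =>
      simp only [Pi.mul_apply, map_mul]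
      exact h.mul h'
  refine h1.contMDiffAt.congr_of_eventuallyEq ?_
  filter_upwards [h] with x hx
  rw [hx]

variable [T2Space M] [IsManifold (𝓡 d) ∞ M]
  (ν : DualMod A totDeg (tot V' C') →ₗ[FnA A] DualMod A totDeg (tot V C))

/-- By linearity of `ν` over functions, the value at `v` depends only on `β` at the base point. This
justifies the pointwise definitions of `sideMap` and `coreMap`. -/
lemma lin_map_eq_sum (k : Option (Fin n)) (v : V.Total) (β : (tot V' C' k).dual.Sec) :
    (lin V A C (ν (lsec V' A C' k β))).1 v =
      ∑ j, (tot V' C' k).ev v.proj (β v.proj) ((tot V' C' k).dp.fr v.proj j v.proj) •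
        (lin V A C (ν (lsec V' A C' k ((tot V' C' k).dp.cofr v.proj j)))).1 v := by
  let T : (tot V' C' k).dual.Sec →ₗ[ℝ] GSym dgD (fun k => (coframe A C k).fiber v.proj) :=
    (LinearMap.proj v ∘ₗ (FnD V A C).val.toLinearMap) ∘ₗ lin V A C ∘ₗ ν.restrictScalars ℝ ∘ₗ
      lsec V' A C' k
  refine (tot V' C' k).dp.flip.apply_eq_sum v.proj T (fun f w => ?_)
    (b := (tot V' C' k).dp.cofr v.proj) (b' := (tot V' C' k).dp.fr v.proj) ?_ β
  · change (lin V A C (ν (lsec V' A C' k _))).1 v = f v.proj • (lin V A C (ν (lsec V' A C' k w))).1 v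
    rw [lsec, sec_fmul, map_smul, lin_smul, pull_cf, Fn.ofFun_mul_apply]
    rfl
  · filter_upwards [(tot V' C' k).dp.eventually_frame v.proj] with m hm
    exact hm.2

/-- The map of the sides. -/
def sideMap (v : V.Total) : V'.Total :=
  ⟨v.proj, ∑ j, GSym.aug ((lin V A C (ν (lsec V' A C' none (V'.dp.cofr v.proj j)))).1 v) •
    V'.dp.fr v.proj j v.proj⟩

/-- The images of the generators from `(C'_i)^*`. -/
def coreMap (v : V.Total) (i : Fin n) : (C' i).dual.fiber v.proj →ₗ[ℝ]
    GSym dgD (fun k => (coframe A C k).fiber v.proj) :=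
  ∑ j, (((C' i).ev v.proj).flip ((C' i).dp.fr v.proj j v.proj)).smulRight
    ((lin V A C (ν (lsec V' A C' (some i) ((C' i).dp.cofr v.proj j)))).1 v)

lemma coreMap_apply (v : V.Total) (i : Fin n) (γ : (C' i).dual.Sec) :
    coreMap ν v i (γ v.proj) = (lin V A C (ν (lsec V' A C' (some i) γ))).1 v := by
  refine Eq.trans ?_ (lin_map_eq_sum ν (some i) v γ).symm
  rw [coreMap, LinearMap.sum_apply]
  rfl

variable (hν : ∀ p, ∀ ψ ∈ Mod.part A (fun k => - totDeg k) (fun k => (tot V' C' k).dual) p,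
    ν ψ ∈ Mod.part A (fun k => - totDeg k) (fun k => (tot V C k).dual) p)

include hν

lemma lin_map_lsec_mem (k : Option (Fin n)) (β : (tot V' C' k).dual.Sec) :
    lin V A C (ν (lsec V' A C' k β)) ∈
      Fn.part V.model V.proj dgD (coframe A C) (- totDeg k).toNat :=
  lin_mem_part (hν _ _ (lsec_mem k β))

lemma coreMap_mem (v : V.Total) (i : Fin n) (γ : (C' i).dual.fiber v.proj) :
    coreMap ν v i γ ∈ GSym.part dgD (fun k => (coframe A C k).fiber v.proj) (dg i) := by
  rw [coreMap, LinearMap.sum_apply]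
  refine sum_mem fun j _ => Submodule.smul_mem _ _ ?_
  have := (lin_map_lsec_mem ν hν (some i) ((C' i).dp.cofr v.proj j)).2 v
  rw [show (- totDeg (some i)).toNat = dg i by simp [totDeg]] at this
  exact this

/-- The image of `ℓ_ψ` has degree `0`, so at each point it is a scalar; in the frame at the base
point this scalar is `ℓ_ψ` evaluated at the side map. -/
lemma lin_map_none (v : V.Total) (ψ : V'.dual.Sec) :
    (lin V A C (ν (lsec V' A C' none ψ))).1 v =
      algebraMap ℝ _ (V'.linFun ψ (sideMap ν v)) := by
  have h1 : ∀ β : V'.dual.Sec, (lin V A C (ν (lsec V' A C' none β))).1 v =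
      algebraMap ℝ _ (GSym.aug ((lin V A C (ν (lsec V' A C' none β))).1 v)) := fun β =>
    GSym.eq_aug_of_mem_part_zero (by rintro (k | k) <;> simp [dgD, dg])
      ((lin_map_lsec_mem ν hν none β).2 v)
  refine (lin_map_eq_sum ν none v ψ).trans ?_
  change _ = algebraMap ℝ _ (V'.ev v.proj (ψ v.proj) (∑ j, GSym.aug
    ((lin V A C (ν (lsec V' A C' none (V'.dp.cofr v.proj j)))).1 v) • V'.dp.fr v.proj j v.proj))
  rw [map_sum, map_sum]
  refine Finset.sum_congr rfl fun j _ => ?_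
  rw [map_smul, smul_eq_mul, map_mul, ← h1, ← Algebra.commutes, ← Algebra.smul_def]
  rfl

/-- The definition uses a frame chosen separately for each base point. Near `v₀` the map is
rewritten in one fixed frame, with coefficients smooth by `contMDiff_aug`. -/
lemma contMDiff_sideMap : ContMDiff V.model V'.model ∞ (sideMap ν) := by
  intro v₀
  obtain ⟨r, b, β, hb⟩ := V'.exists_frame v₀.proj
  have h1 := V'.contMDiffAt_sum_section (J := V.model) (g := V.proj) (x₀ := v₀)
    (Bundle.contMDiff_proj V.fiber).contMDiffAt Finset.univ
    (f := fun j v => GSym.aug ((lin V A C (ν (lsec V' A C' none (β j)))).1 v))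
    (fun j => (contMDiff_aug (smooth_of_mem_Fn (lin V A C (ν (lsec V' A C' none (β j)))).2)).contMDiffAt)
    b
  refine h1.congr_of_eventuallyEq ?_
  filter_upwards [continuous_proj.continuousAt.eventually hb] with v hv
  refine (congrArg (Bundle.TotalSpace.mk v.proj) (hv (sideMap ν v).2)).trans ?_
  congr 1
  refine Finset.sum_congr rfl fun j _ => ?_
  congr 1
  rw [lin_map_none ν hν, AlgHom.commutes]
  rfl

/-- The homomorphism on the fibres. -/
def fibHom (v : V.Total) : GSym dgD (fun k => (coframe A C' k).fiber v.proj) →ₐ[ℝ]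
    GSym dgD (fun k => (coframe A C k).fiber v.proj) :=
  GSym.lift dgD (fun k => (coframe A C' k).fiber v.proj)
    (fun k => match k with
      | .inl i => GSym.gen dgD (fun k => (coframe A C k).fiber v.proj) (Sum.inl i)
      | .inr i => coreMap ν v i) (by
    -- The images have the degrees of the generators, so the relations follow from graded
    -- commutativity of the target.
    have h : ∀ (i : Fin n) (γ : (C' i).dual.fiber v.proj), coreMap ν v i γ ∈
      GSym.part dgD (fun k => (coframe A C k).fiber v.proj) (dg i) := coreMap_mem ν hν v
    have h' := fun i => GSym.gen_mem_part dgD (fun k => (coframe A C k).fiber v.proj) (Sum.inl i)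
    rintro (i | i) (k | k) x y
    · exact GSym.mul_comm_of_mem_part (h' i x) (h' k y)
    · exact GSym.mul_comm_of_mem_part (h' i x) (h k y)
    · exact GSym.mul_comm_of_mem_part (h i x) (h' k y)
    · exact GSym.mul_comm_of_mem_part (h i x) (h k y))

lemma fibHom_gen_inl (v : V.Total) (i : Fin n) (α : (A i).dual.fiber v.proj) :
    fibHom ν hν v (GSym.gen dgD (fun k => (coframe A C' k).fiber v.proj) (Sum.inl i) α) =
      GSym.gen dgD (fun k => (coframe A C k).fiber v.proj) (Sum.inl i) α :=
  GSym.lift_gen dgD (fun k => (coframe A C' k).fiber v.proj) _ _ (Sum.inl i) α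

lemma fibHom_gen_inr (v : V.Total) (i : Fin n) (γ : (C' i).dual.fiber v.proj) :
    fibHom ν hν v (GSym.gen dgD (fun k => (coframe A C' k).fiber v.proj) (Sum.inr i) γ) =
      coreMap ν v i γ :=
  GSym.lift_gen dgD (fun k => (coframe A C' k).fiber v.proj) _ _ (Sum.inr i) γ

lemma fibHom_incl (v : V.Total) (ξ : SA A v.proj) :
    fibHom ν hν v (incl A C' v.proj ξ) = incl A C v.proj ξ := by
  have : (fibHom ν hν v).comp (incl A C' v.proj) = incl A C v.proj :=
    GSym.algHom_ext fun i α => by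
      change fibHom ν hν v (incl A C' v.proj _) = _
      rw [incl_gen, incl_gen, fibHom_gen_inl]
  exact congrArg (fun φ => φ ξ) this

lemma fibHom_part (v : V.Total) {i : ℕ} {x : GSym dgD (fun k => (coframe A C' k).fiber v.proj)}
    (hx : x ∈ GSym.part dgD (fun k => (coframe A C' k).fiber v.proj) i) :
    fibHom ν hν v x ∈ GSym.part dgD (fun k => (coframe A C k).fiber v.proj) i := by
  refine GSym.map_mem_part _ _ _ (fun k x => ?_) hx
  rcases k with k | k
  · rw [show fibHom ν hν v _ = _ from fibHom_gen_inl ν hν v k x]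
    exact GSym.gen_mem_part dgD (fun k => (coframe A C k).fiber v.proj) (Sum.inl k) x
  · rw [show fibHom ν hν v _ = _ from fibHom_gen_inr ν hν v k x]
    exact coreMap_mem ν hν v k x

/-- The homomorphism on families. -/
def rawHom : Raw V'.proj dgD (coframe A C') →ₐ[ℝ] Raw V.proj dgD (coframe A C) :=
  AlgHom.pi (fun v : V.Total => (fibHom ν hν v).comp (Pi.evalAlgHom ℝ _ (sideMap ν v)))

lemma rawHom_apply (s : Raw V'.proj dgD (coframe A C')) (v : V.Total) :
    rawHom ν hν s v = fibHom ν hν v (s (sideMap ν v)) := rfl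

lemma rawHom_ofFun (f : V'.Total → ℝ) :
    rawHom ν hν (Raw.ofFun dgD f) = Raw.ofFun dgD (f ∘ sideMap ν) :=
  funext fun v => AlgHom.commutes (fibHom ν hν v) _

lemma rawHom_pullRaw (s : Raw (fun m : M => m) dg (fun i => (A i).dual)) :
    rawHom ν hν (pullRaw V' A C' s) = pullRaw V A C s :=
  funext fun v => fibHom_incl ν hν v (s v.proj)

lemma rawHom_lsec (k : Option (Fin n)) (β : (tot V' C' k).dual.Sec) :
    rawHom ν hν (lin V' A C' (lsec V' A C' k β)).1 = (lin V A C (ν (lsec V' A C' k β))).1 := by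
  funext v
  cases k with
  | none =>
    refine Eq.trans ?_ (lin_map_none ν hν v β).symm
    rw [show (lin V' A C' (lsec V' A C' none β)).1 = Raw.ofFun dgD (V'.linFun β) from
      lin_sec_none β, rawHom_ofFun]
    rfl
  | some i =>
    refine Eq.trans ?_ (coreMap_apply ν v i β)
    rw [show (lin V' A C' (lsec V' A C' (some i) β)).1 = _ from lin_sec_some i β]
    exact fibHom_gen_inr ν hν v i (β v.proj)

lemma rawHom_ofSec_inl (i : Fin n) (α : (A i).dual.Sec) :
    rawHom ν hν (Raw.ofSec dgD (Sum.inl i) α) = Raw.ofSec dgD (Sum.inl i) α := by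
  rw [← pullRaw_ofSec, rawHom_pullRaw, pullRaw_ofSec]

lemma rawHom_ofSec_inr (i : Fin n) (γ : (C' i).dual.Sec) :
    rawHom ν hν (Raw.ofSec dgD (Sum.inr i) γ) = (lin V A C (ν (lsec V' A C' (some i) γ))).1 := by
  rw [← lin_sec_some]
  exact rawHom_lsec ν hν (some i) γ

lemma rawHom_linFun (ψ : V'.dual.Sec) :
    rawHom ν hν (Raw.ofFun dgD (V'.linFun ψ)) = (lin V A C (ν (lsec V' A C' none ψ))).1 := by
  rw [← lin_sec_none]
  exact rawHom_lsec ν hν none ψ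

/-- On polynomials this is checked on generators: functions are composed with the smooth side map,
sections of A_i^* are fixed, and sections of C'_i^* go to smooth linear functions. Continuity of the
side map carries it over to germs. -/
lemma rawHom_smooth {s : Raw V'.proj dgD (coframe A C')}
    (hs : s ∈ Smooth V'.model V'.proj dgD (coframe A C')) :
    rawHom ν hν s ∈ Smooth V.model V.proj dgD (coframe A C) := by
  intro v₀
  obtain ⟨t, ht, h⟩ := hs (sideMap ν v₀)
  have h1 : rawHom ν hν t ∈ Smooth V.model V.proj dgD (coframe A C) := by
    clear h
    induction ht using Algebra.adjoin_induction with
    | mem x hx =>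
      rcases hx with ⟨f, hf, rfl⟩ | ⟨k | k, a, rfl⟩
      · rw [rawHom_ofFun]
        exact mem_smooth_of_poly
          (Algebra.subset_adjoin (Or.inl ⟨_, hf.comp (contMDiff_sideMap ν hν), rfl⟩))
      · rw [show rawHom ν hν _ = _ from rawHom_ofSec_inl ν hν k a]
        exact mem_smooth_of_poly
          (Algebra.subset_adjoin (Or.inr ⟨Sum.inl k, (a : (A k).dual.Sec), rfl⟩))
      · rw [show rawHom ν hν _ = _ from rawHom_ofSec_inr ν hν k a]
        exact smooth_of_mem_Fn (Subtype.prop _)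
    | algebraMap r => rw [AlgHom.commutes]; exact algebraMap_mem _ r
    | add x y _ _ h h' => rw [map_add]; exact add_mem h h'
    | mul x y _ _ h h' => rw [map_mul]; exact mul_mem h h'
  obtain ⟨t', ht', h'⟩ := h1 v₀
  refine ⟨t', ht', ?_⟩
  filter_upwards [(contMDiff_sideMap ν hν).continuous.continuousAt.eventually h, h'] with v h h'
  rw [← h', rawHom_apply, rawHom_apply, h]

lemma rawHom_homog {i : ℕ} {s : Raw V'.proj dgD (coframe A C')}
    (hs : s ∈ Homog V'.model V'.proj dgD (coframe A C') i) :
    rawHom ν hν s ∈ Homog V.model V.proj dgD (coframe A C) i :=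
  ⟨rawHom_smooth ν hν hs.1, fun v => fibHom_part ν hν v (hs.2 (sideMap ν v))⟩

lemma rawHom_mem {s : Raw V'.proj dgD (coframe A C')} (hs : s ∈ FnD V' A C') :
    rawHom ν hν s ∈ FnD V A C := by
  induction hs using Algebra.adjoin_induction with
  | mem x hx =>
    obtain ⟨i, hi⟩ := hx
    exact mem_Fn_of_homog (rawHom_homog ν hν hi)
  | algebraMap r => rw [AlgHom.commutes]; exact algebraMap_mem _ r
  | add x y _ _ h h' => rw [map_add]; exact add_mem h h'
  | mul x y _ _ h h' => rw [map_mul]; exact mul_mem h h'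

/-- Each generator is sent to a function of the same bidegree; for the linear ones this holds
because `ν` preserves degrees and `lin_mem_bideg` applies. -/
lemma rawHom_monomial {a : ℕ} {b : ℤ} {t : Raw V'.proj dgD (coframe A C')}
    (ht : Monomial V' A C' a b t) : rawHom ν hν t ∈ RawBideg V A C a b := by
  have hmul : ∀ {a a' a'' : ℕ} {b b' b'' : ℤ} {s t : Raw V.proj dgD (coframe A C)},
      s ∈ RawBideg V A C a b → t ∈ RawBideg V A C a' b' → a + a' = a'' → b + b' = b'' →
      s * t ∈ RawBideg V A C a'' b'' := by
    rintro a a' _ b b' _ s t hs ht rfl rfl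
    exact rawBideg_mul hs ht
  induction ht with
  | one => rw [map_one]; exact Monomial.one.mem_rawBideg
  | base f hf _ ih =>
    rw [map_mul, rawHom_ofFun]
    have : Monomial V A C 0 0 (Raw.ofFun dgD (f ∘ V.proj) * 1) := .base f hf .one
    rw [mul_one] at this
    exact hmul this.mem_rawBideg ih (zero_add _) (zero_add _)
  | side i α _ ih =>
    rw [map_mul, rawHom_ofSec_inl]
    have : Monomial V A C 0 (0 + dg i) (Raw.ofSec dgD (Sum.inl i) α * 1) := .side i α .one
    rw [mul_one] at this
    exact hmul this.mem_rawBideg ih (zero_add _) (by ring)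
  | linear ψ _ ih =>
    rw [map_mul, rawHom_linFun]
    refine hmul (lin_mem_bideg (hν _ _ (lsec_mem none ψ))) ih (by ring) ?_
    simp [totDeg]
    ring
  | core i γ _ ih =>
    rw [map_mul, rawHom_ofSec_inr]
    refine hmul (lin_mem_bideg (hν _ _ (lsec_mem (some i) γ))) ih (by ring) ?_
    simp [totDeg]
    ring

lemma rawHom_bideg {a : ℕ} {b : ℤ} {s : Raw V'.proj dgD (coframe A C')}
    (hs : s ∈ RawBideg V' A C' a b) : rawHom ν hν s ∈ RawBideg V A C a b := by
  intro v₀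
  obtain ⟨t, ht, h⟩ := hs (sideMap ν v₀)
  refine rawBideg_congr (t := rawHom ν hν t) ?_ ?_
  · clear h
    induction ht using Submodule.span_induction with
    | mem x hx => exact rawHom_monomial ν hν hx
    | zero => simp
    | add x y _ _ h1 h2 => rw [map_add]; exact add_mem h1 h2
    | smul r x _ h => rw [map_smul]; exact Submodule.smul_mem _ r h
  · filter_upwards [(contMDiff_sideMap ν hν).continuous.continuousAt.eventually h] with v h
    rw [rawHom_apply, rawHom_apply, h]

/-- The homomorphism of algebras of functions. -/
def fnHom : FnD V' A C' →ₐ[ℝ] FnD V A C :=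
  ((rawHom ν hν).comp (FnD V' A C').val).codRestrict _ (fun s => rawHom_mem ν hν s.2)

lemma fnHom_pull (α : FnA A) : fnHom ν hν (pull V' A C' α) = pull V A C α :=
  Subtype.ext (rawHom_pullRaw ν hν α.1)

/-- Both sides are linear over the functions on A, so it is enough to compare them on sections,
where they agree by construction. -/
lemma fnHom_lin (ψ : DualMod A totDeg (tot V' C')) :
    fnHom ν hν (lin V' A C' ψ) = lin V A C (ν ψ) := by
  refine Subtype.ext (funext fun v => ?_)
  let T : DualMod A totDeg (tot V' C') →ₗ[ℝ] GSym dgD (fun k => (coframe A C k).fiber v.proj) :=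
    (LinearMap.proj v ∘ₗ (FnD V A C).val.toLinearMap) ∘ₗ
      ((fnHom ν hν).toLinearMap ∘ₗ lin V' A C' - lin V A C ∘ₗ ν.restrictScalars ℝ)
  have hT : ∀ ψ, T ψ = (fnHom ν hν (lin V' A C' ψ)).1 v - (lin V A C (ν ψ)).1 v := fun _ => rfl
  have hmul : ∀ (f : FnA A) ψ, T (f • ψ) = incl A C v.proj (f.1 v.proj) * T ψ := by
    intro f ψ
    rw [hT, hT, lin_smul, map_mul, fnHom_pull, map_smul, lin_smul, mul_sub]
    rfl
  refine sub_eq_zero.1 (ext_mod (m₀ := v.proj) (T := T) (fun f ψ => ?_) (fun k β i f _ => ?_) ψ)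
  · rw [hmul]
    refine (congrArg (· * T ψ) (AlgHom.commutes (incl A C v.proj) (f v.proj))).trans ?_
    exact (Algebra.smul_def _ _).symm
  · rw [hmul, hT]
    have := congrFun (rawHom_lsec ν hν k β) v
    exact mul_eq_zero_of_right _ (sub_eq_zero.2 this)

end Construction

/-! ### Existence of the morphism with given linear part -/

section Existence

variable {d : ℕ} {M : Type u} [TopologicalSpace M] [ChartedSpace (EuclideanSpace ℝ (Fin d)) M]
  [T2Space M] [IsManifold (𝓡 d) ∞ M]
  {n : ℕ} {V V' : VB d M} {A C C' : Fin n → VB d M} {QA : LieStr A}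
  {QD : VBStr V C QA} {QD' : VBStr V' C' QA} {D : Rep totDeg (tot V C) QA}
  {D' : Rep totDeg (tot V' C') QA}

/-- A morphism of representations corresponds to exactly one morphism of VB-Lie algebroids. -/
theorem existsUnique_vbHom (hD : IsAssociated QD D) (hD' : IsAssociated QD' D')
    (μ : RepHom D D') : ∃! G : VBHom QD QD', Corresponds G μ := by
  obtain ⟨ν, hν, h⟩ := exists_dual_map μ.map μ.map_part
  have hofFun : ∀ f v, (fnHom ν hν (Fn.ofFun V'.proj dgD (coframe A C') f)).1 v =
      algebraMap ℝ _ (f (sideMap ν v)) := fun f v => congrFun (rawHom_ofFun ν hν f) v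
  have hpart : ∀ i, ∀ s ∈ Fn.part V'.model V'.proj dgD (coframe A C') i,
      fnHom ν hν s ∈ Fn.part V.model V.proj dgD (coframe A C) i :=
    fun i s hs => rawHom_homog ν hν hs
  have hpull : ∀ α, defect (fnHom ν hν) QD'.toHomVF QD.toHomVF (pull V' A C' α) = 0 := by
    intro α
    rw [defect_apply, QD'.basic, fnHom_pull, fnHom_pull, QD.basic, sub_self]
  have hlin : ∀ p, ∀ ψ ∈ Mod.part A (fun k => - totDeg k) (fun k => (tot V' C' k).dual) p,
      defect (fnHom ν hν) QD'.toHomVF QD.toHomVF (lin V' A C' ψ) = 0 := by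
    intro p ψ hψ
    obtain ⟨χ, h1, h2⟩ := lin_dual_comm hD hD' μ ν hν h hψ
    rw [defect_apply, h1, fnHom_lin, fnHom_lin, h2, sub_self]
  have hcomm := comm_of_generators (φ := fnHom ν hν) (Q := QD'.toHomVF) (Q' := QD.toHomVF)
    (g := sideMap ν) hofFun hpart
    (fun k a => by
      rcases k with i | i
      · exact (congrArg _ (pull_ofSec i a)).symm.trans (hpull _)
      · exact (congrArg _ (lin_lsec_some i a)).symm.trans (hlin _ _ (lsec_mem (some i) a)))
    -- A coordinate of V' has the germ of a function of the form `f₀ + ∑ f_j ℓ_{β_j}`, which is a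
    -- basic function plus a linear function of degree `0`; the defect vanishes on both.
    (fun w₀ l => by
      obtain ⟨r, f₀, f, β, hf⟩ := V'.exists_coordinate w₀ l
      refine ⟨_, ?_, hf⟩
      have h1 : Fn.ofFun V'.proj dgD (coframe A C')
          (V'.pullFun f₀ + ∑ j, V'.pullFun (f j) * V'.linSmooth (β j)) =
          pull V' A C' (cf A f₀) +
            lin V' A C' (∑ j, cf A (f j) • lsec V' A C' none (β j)) := by
        change Fn.ofFunHom (V'.pullFun f₀ + ∑ j, V'.pullFun (f j) * V'.linSmooth (β j)) = _
        rw [map_add, map_sum, map_sum, pull_cf]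
        refine congrArg (_ + ·) (Finset.sum_congr rfl fun j _ => ?_)
        rw [map_mul, lin_smul, pull_cf]
        exact congrArg (_ * ·) (lin_lsec_none (β j)).symm
      rw [h1, map_add, hpull, zero_add]
      exact hlin 0 _ (sum_mem fun j _ =>
        smul_mem_part (cf_mem A (f j)) (lsec_mem (V := V') (C := C') none (β j)) (by simp [totDeg])))
  refine ⟨⟨⟨sideMap ν, contMDiff_sideMap ν hν⟩, fnHom ν hν,
    fun f => Subtype.ext (rawHom_ofFun ν hν f), hpart, fun a b s hs => rawHom_bideg ν hν hs,
    fnHom_pull ν hν, hcomm⟩, fun ψ => ⟨ν ψ, fnHom_lin ν hν ψ, h ψ⟩, fun G hG => ?_⟩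
  exact hG.unique fun ψ => ⟨ν ψ, fnHom_lin ν hν ψ, h ψ⟩

end Existence
end VBLie

end

/-! ### The correspondence of morphisms -/

theorem mainTheorem9 {d : ℕ} {M : Type u}
    [TopologicalSpace M] [T2Space M] [SecondCountableTopology M]
    [ChartedSpace (EuclideanSpace ℝ (Fin d)) M] [IsManifold (𝓡 d) ∞ M]
    {n : ℕ} (V V' : VBLie.VB d M) (A C C' : Fin n → VBLie.VB d M)
    (QA : VBLie.LieStr A) (QD : VBLie.VBStr V C QA) (QD' : VBLie.VBStr V' C' QA) :
    (∃! D : VBLie.Rep VBLie.totDeg (VBLie.tot V C) QA, VBLie.IsAssociated QD D) ∧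
    (∃! D' : VBLie.Rep VBLie.totDeg (VBLie.tot V' C') QA, VBLie.IsAssociated QD' D') ∧
    ∀ (D : VBLie.Rep VBLie.totDeg (VBLie.tot V C) QA)
      (D' : VBLie.Rep VBLie.totDeg (VBLie.tot V' C') QA),
      VBLie.IsAssociated QD D → VBLie.IsAssociated QD' D' →
      ∃ Φ : VBLie.VBHom QD QD' ≃ VBLie.RepHom D D',
        ∀ G μ, Φ G = μ ↔ VBLie.Corresponds G μ := by
  refine ⟨VBLie.existsUnique_isAssociated QD, VBLie.existsUnique_isAssociated QD',
    fun D D' hD hD' => ?_⟩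
  -- Each `G` corresponds to exactly one `μ`, which defines `F`; that each `μ` corresponds to
  -- exactly one `G` makes `F` bijective.
  choose F hF hF' using fun G : VBLie.VBHom QD QD' => VBLie.existsUnique_repHom hD hD' G
  refine ⟨Equiv.ofBijective F ⟨fun G₁ G₂ h => ?_, fun μ => ?_⟩,
    fun G μ => ⟨fun h => h ▸ hF G, fun h => (hF' G μ h).symm⟩⟩
  · exact (VBLie.existsUnique_vbHom hD hD' (F G₂)).unique (h ▸ hF G₁) (hF G₂)
  · obtain ⟨G, hG, -⟩ := VBLie.existsUnique_vbHom hD hD' μ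
    exact ⟨G, (hF' G μ hG).symm⟩
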